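/- Identify $\mathbb{S}^3$ with the unit quaternions and let $\mathbb{S}^3\times\mathbb{S}^3$ carry its homogeneous nearly Kähler structure: for tangent vectors $Z=(U,V)$, $Z'$ at $(p,q)$, $$JZ=\tfrac1{\sqrt3}\big(2pq^{-1}V-U,\,-2qp^{-1}U+V\big),\qquad g(Z,Z')=\tfrac12\big(\langle Z,Z'\rangle+\langle JZ,JZ'\rangle\big),$$ where $\langle\cdot,\cdot\rangle$ is the standard product metric. Let $M$ be a smooth $3$-manifold, immersed in $\mathbb{S}^3\times\mathbb{S}^3$ as a Lagrangian submanifold by a smooth immersion $f$, i.e. $J$ interchanges the tangent and the normal spaces of $M$. Let $\nabla$, $\nabla^\perp$ and $h$ be the induced connection, the normal connection and the second fundamental form, and $(\nabla h)(X,Y,Z)=\nabla^\perp_Xh(Y,Z)-h(\nabla_XY,Z)-h(Y,\nabla_XZ)$. Suppose that $M$ is $J$-isotropic: there is a function $\lambda:M\to\mathbb{R}$ such that $$g((\nabla h)(v,v,v),Jv)=\lambda(p)\,g(v,v)^2\qquad\text{for all } p\in M,\ v\in T_pM .$$ Then $\lambda$ vanishes identically (i.e. $M$ is $J$-parallel),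 and $M$ is locally congruent to one of the following immersions: every point of $M$ has an open neighbourhood $W$ on which, for one of the eight immersions $f_i$ below, $f=\Phi\circ f_i\circ\theta$ with a diffeomorphism $\theta$ of $W$ onto an open subset of the domain of $f_i$ and an isometry $\Phi(p,q)=(apc^{-1},bqc^{-1})$, where $a,b,c$ are unit quaternions; the index $i$ can be chosen locally constant in the point (so it is the same for all points if $M$ is connected). 1. $f_1:\mathbb{S}^3\to\mathbb{S}^3\times\mathbb{S}^3$, $u\mapsto(1,u)$; 2. $f_2:\mathbb{S}^3\to\mathbb{S}^3\times\mathbb{S}^3$, $u\mapsto(u,1)$; 3. $f_3:\mathbb{S}^3\to\mathbb{S}^3\times\mathbb{S}^3$, $u\mapsto(u,u)$; 4. $f_4:\mathbb{S}^3\to\mathbb{S}^3\times\mathbb{S}^3$, $u\mapsto(u,u\mathbf{i})$; 5. $f_5:\mathbb{S}^3\to\mathbb{S}^3\times\mathbb{S}^3$, $u\mapsto(u\mathbf{i}u^{-1},u^{-1})$; 6. $f_6:\mathbb{S}^3\to\mathbb{S}^3\times\mathbb{S}^3$, $u\mapsto(u^{-1},u\mathbf{i}u^{-1})$; 7. $f_7:\mathbb{S}^3\to\mathbb{S}^3\times\mathbb{S}^3$,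 $u\mapsto(u\mathbf{i}u^{-1},u\mathbf{j}u^{-1})$; 8. $f_8:\mathbb{R}^3\to\mathbb{S}^3\times\mathbb{S}^3$, $(u,v,w)\mapsto(p(u,w),q(u,v))$, where, with $(x_0,x_1,x_2,x_3)$ standing for $x_0+x_1\mathbf{i}+x_2\mathbf{j}+x_3\mathbf{k}$ and $\hat u=\tfrac{\sqrt3u}2$, $\hat v=\tfrac{\sqrt3v}2$, $\hat w=\tfrac{\sqrt3w}2$, $$p(u,w)=(\cos\hat u\cos\hat w,\ \cos\hat u\sin\hat w,\ \sin\hat u\cos\hat w,\ \sin\hat u\sin\hat w),$$ $$q(u,v)=\tfrac1{\sqrt2}\big(\cos\hat v(\sin\hat u+\cos\hat u),\ \sin\hat v(\sin\hat u+\cos\hat u),\ \cos\hat v(\sin\hat u-\cos\hat u),\ \sin\hat v(\sin\hat u-\cos\hat u)\big).$$ -/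

import Mathlib

open scoped Quaternion Manifold ContDiff

noncomputable section

namespace NearlyKahler

/-! ### The homogeneous nearly Kähler manifold `S³ × S³`

`S³` is the set of unit quaternions and `S³ × S³` is regarded as a subset of `ℍ × ℍ`.  Tangent
vectors at `x = (p, q)` are pairs `Z = (U, V)` of quaternions with `U ⊥ p` and `V ⊥ q`. -/

/-- `S³ × S³` inside `ℍ × ℍ`. -/
def S3S3 : Set (ℍ[ℝ] × ℍ[ℝ]) := {x | ‖x.1‖ = 1 ∧ ‖x.2‖ = 1}

/-- The tangent space of `S³ × S³` at `x`. -/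
def tangentSpaceAt (x : ℍ[ℝ] × ℍ[ℝ]) : Submodule ℝ (ℍ[ℝ] × ℍ[ℝ]) where
  carrier := {Z | inner ℝ x.1 Z.1 = 0 ∧ inner ℝ x.2 Z.2 = 0}
  add_mem' := by
    rintro Z W ⟨h1, h2⟩ ⟨h3, h4⟩
    exact ⟨by simp [inner_add_right, h1, h3], by simp [inner_add_right, h2, h4]⟩
  zero_mem' := by simp
  smul_mem' := by
    rintro c Z ⟨h1, h2⟩
    exact ⟨by simp [inner_smul_right, h1], by simp [inner_smul_right, h2]⟩

/-- The almost complex structure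
`J (U, V) = (1/√3) (2 p q⁻¹ V - U, -2 q p⁻¹ U + V)` at `x = (p, q)`. -/
def J (x Z : ℍ[ℝ] × ℍ[ℝ]) : ℍ[ℝ] × ℍ[ℝ] :=
  (1 / Real.sqrt 3) • ((2 : ℝ) • (x.1 * x.2⁻¹ * Z.2) - Z.1,
    -((2 : ℝ) • (x.2 * x.1⁻¹ * Z.1)) + Z.2)

/-- The standard product metric on `S³ × S³`. -/
def stdInner (Z W : ℍ[ℝ] × ℍ[ℝ]) : ℝ := inner ℝ Z.1 W.1 + inner ℝ Z.2 W.2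

/-- The nearly Kähler metric `g (Z, W) = ½ (⟨Z, W⟩ + ⟨J Z, J W⟩)` at `x`. -/
def g (x Z W : ℍ[ℝ] × ℍ[ℝ]) : ℝ :=
  (1 / 2) * (stdInner Z W + stdInner (J x Z) (J x W))

/-- The vector product `a × b = ½ (a b - b a)` of imaginary quaternions. -/
def cross (a b : ℍ[ℝ]) : ℍ[ℝ] := (1 / 2 : ℝ) • (a * b - b * a)

section LeviCivita

variable {E : Type*} [NormedAddCommGroup E] [NormedSpace ℝ E]

/-- The pair `(p⁻¹ U, q⁻¹ V)` of imaginary quaternions that represents the tangent vector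
`(U, V)` at `(p, q)` in the left trivialization. -/
def leftTriv (x Z : ℍ[ℝ] × ℍ[ℝ]) : ℍ[ℝ] × ℍ[ℝ] := (x.1⁻¹ * Z.1, x.2⁻¹ * Z.2)

/-- The Levi-Civita connection of `g` for the left-invariant fields on `S³ × S³` that correspond to
`a`, `b` in the left trivialization. -/
def leftGamma (a b : ℍ[ℝ] × ℍ[ℝ]) : ℍ[ℝ] × ℍ[ℝ] :=
  (cross a.1 b.1 + (1 / 3 : ℝ) • (cross a.2 b.1 - cross a.1 b.2),
    cross a.2 b.2 - (1 / 3 : ℝ) • (cross a.2 b.1 - cross a.1 b.2))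

/-- The Levi-Civita connection `∇̃` of `g`, as a covariant derivative at the parameter `x` in the
direction `v` of a vector field `Y` along a map `F` into `S³ × S³`.  The facts `covDeriv_mem`,
`covDeriv_metric` and `covDeriv_torsionFree` below show that it takes tangent values, is compatible
with `g` and torsion free. -/
def covDeriv (F Y : E → ℍ[ℝ] × ℍ[ℝ]) (x v : E) : ℍ[ℝ] × ℍ[ℝ] :=
  let w := fderiv ℝ (fun y => leftTriv (F y) (Y y)) x v
    + leftGamma (leftTriv (F x) (fderiv ℝ F x v)) (leftTriv (F x) (Y x))
  ((F x).1 * w.1, (F x).2 * w.2)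

theorem inner_unit_mul {p : ℍ[ℝ]} (hp : ‖p‖ = 1) (a b : ℍ[ℝ]) :
    inner ℝ (p * a) (p * b) = inner ℝ a b := by
  have h : Quaternion.normSq p = 1 := by
    rw [Quaternion.normSq_eq_norm_mul_self, hp, one_mul]
  rw [Quaternion.normSq_def'] at h
  simp only [Quaternion.inner_def, Quaternion.re_mul, Quaternion.imI_mul, Quaternion.imJ_mul,
    Quaternion.imK_mul, Quaternion.re_star, Quaternion.imI_star, Quaternion.imJ_star,
    Quaternion.imK_star]
  linear_combination (a.re * b.re + a.imI * b.imI + a.imJ * b.imJ + a.imK * b.imK) * h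

/-- The metric `g` in the left trivialization. -/
def gLeft (a b : ℍ[ℝ] × ℍ[ℝ]) : ℝ :=
  4 / 3 * (inner ℝ a.1 b.1 + inner ℝ a.2 b.2) - 2 / 3 * (inner ℝ a.1 b.2 + inner ℝ b.1 a.2)

/-- `g (Z, Z') = 4/3 (⟨U, U'⟩ + ⟨V, V'⟩) - 2/3 (⟨p⁻¹ U, q⁻¹ V'⟩ + ⟨p⁻¹ U', q⁻¹ V⟩)`. -/
theorem g_eq_gLeft {x : ℍ[ℝ] × ℍ[ℝ]} (hx : x ∈ S3S3) (Z W : ℍ[ℝ] × ℍ[ℝ]) :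
    g x Z W = gLeft (leftTriv x Z) (leftTriv x W) := by
  obtain ⟨h1, h2⟩ := hx
  have hp : x.1 ≠ 0 := by intro h; simp [h] at h1
  have hq : x.2 ≠ 0 := by intro h; simp [h] at h2
  obtain ⟨a, ha⟩ : ∃ a, a = x.1⁻¹ * Z.1 := ⟨_, rfl⟩
  obtain ⟨b, hb⟩ : ∃ b, b = x.2⁻¹ * Z.2 := ⟨_, rfl⟩
  obtain ⟨c, hc⟩ : ∃ c, c = x.1⁻¹ * W.1 := ⟨_, rfl⟩
  obtain ⟨d, hd⟩ : ∃ d, d = x.2⁻¹ * W.2 := ⟨_, rfl⟩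
  have ha' : Z.1 = x.1 * a := by rw [ha, mul_inv_cancel_left₀ hp]
  have hb' : Z.2 = x.2 * b := by rw [hb, mul_inv_cancel_left₀ hq]
  have hc' : W.1 = x.1 * c := by rw [hc, mul_inv_cancel_left₀ hp]
  have hd' : W.2 = x.2 * d := by rw [hd, mul_inv_cancel_left₀ hq]
  have hs : (1 / Real.sqrt 3) * (1 / Real.sqrt 3) = 1 / 3 := by
    rw [div_mul_div_comm, Real.mul_self_sqrt (by norm_num), one_mul]
  have hZ : J x Z = (x.1 * ((1 / Real.sqrt 3) • ((2 : ℝ) • b - a)),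
      x.2 * ((1 / Real.sqrt 3) • (b - (2 : ℝ) • a))) := by
    simp only [J, Prod.smul_mk, mul_assoc, ← ha, ← hb, Prod.mk.injEq]
    refine ⟨?_, ?_⟩
    · rw [ha']; simp only [mul_smul_comm, mul_sub]
    · rw [hb']; simp only [mul_smul_comm, mul_sub]; rw [neg_add_eq_sub]
  have hW : J x W = (x.1 * ((1 / Real.sqrt 3) • ((2 : ℝ) • d - c)),
      x.2 * ((1 / Real.sqrt 3) • (d - (2 : ℝ) • c))) := by
    simp only [J, Prod.smul_mk, mul_assoc, ← hc, ← hd, Prod.mk.injEq]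
    refine ⟨?_, ?_⟩
    · rw [hc']; simp only [mul_smul_comm, mul_sub]
    · rw [hd']; simp only [mul_smul_comm, mul_sub]; rw [neg_add_eq_sub]
  simp only [g, stdInner, hZ, hW, gLeft, leftTriv, ← ha, ← hb, ← hc, ← hd]
  rw [ha', hb', hc', hd']
  simp only [inner_unit_mul h1, inner_unit_mul h2, inner_smul_left, inner_smul_right,
    inner_sub_left, inner_sub_right, conj_trivial]
  rw [real_inner_comm b c]
  linear_combination (1 / 2) * (5 * inner ℝ a c + 5 * inner ℝ b d - 4 * inner ℝ a d
    - 4 * inner ℝ b c) * hs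

theorem leftTriv_re {x Z : ℍ[ℝ] × ℍ[ℝ]} (hx : x ∈ S3S3) (hZ : Z ∈ tangentSpaceAt x) :
    (leftTriv x Z).1.re = 0 ∧ (leftTriv x Z).2.re = 0 := by
  obtain ⟨h1, h2⟩ := hx
  obtain ⟨h3, h4⟩ := hZ
  have key : ∀ {p U : ℍ[ℝ]}, ‖p‖ = 1 → inner ℝ p U = 0 → (p⁻¹ * U).re = 0 := by
    intro p U hp h
    have hp0 : p ≠ 0 := by intro h; simp [h] at hp
    have h' := inner_unit_mul hp 1 (p⁻¹ * U)
    rw [mul_inv_cancel_left₀ hp0, mul_one, h, Quaternion.inner_def, one_mul,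
      Quaternion.re_star] at h'
    exact h'.symm
  exact ⟨key h1 h3, key h2 h4⟩

theorem mem_tangentSpaceAt_mul {x a : ℍ[ℝ] × ℍ[ℝ]} (hx : x ∈ S3S3) (h1 : a.1.re = 0)
    (h2 : a.2.re = 0) : (x.1 * a.1, x.2 * a.2) ∈ tangentSpaceAt x := by
  have key : ∀ {p U : ℍ[ℝ]}, ‖p‖ = 1 → U.re = 0 → inner ℝ p (p * U) = 0 := by
    intro p U hp h
    have h' := inner_unit_mul hp 1 U
    rw [mul_one] at h'
    rw [h', Quaternion.inner_def]
    simpa using h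
  exact ⟨key hx.1 h1, key hx.2 h2⟩

theorem fderiv_mem_tangentSpaceAt {F : E → ℍ[ℝ] × ℍ[ℝ]} {x : E} (hF : DifferentiableAt ℝ F x)
    (hS : ∀ᶠ y in nhds x, F y ∈ S3S3) (v : E) : fderiv ℝ F x v ∈ tangentSpaceAt (F x) := by
  have key : ∀ {G : E → ℍ[ℝ]}, DifferentiableAt ℝ G x → (∀ᶠ y in nhds x, ‖G y‖ = 1) →
      inner ℝ (G x) (fderiv ℝ G x v) = 0 := by
    intro G hG h
    have e : (fun y => inner ℝ (G y) (G y)) =ᶠ[nhds x] fun _ => (1 : ℝ) := by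
      filter_upwards [h] with y hy
      rw [real_inner_self_eq_norm_sq, hy, one_pow]
    have h' := fderiv_inner_apply ℝ hG hG v
    rw [e.fderiv_eq, real_inner_comm (G x) (fderiv ℝ G x v)] at h'
    simp at h'
    linarith
  have f1 : fderiv ℝ (fun y => (F y).1) x v = (fderiv ℝ F x v).1 := by
    rw [fderiv.fst hF]; rfl
  have f2 : fderiv ℝ (fun y => (F y).2) x v = (fderiv ℝ F x v).2 := by
    rw [fderiv.snd hF]; rfl
  exact ⟨f1 ▸ key hF.fst (hS.mono fun y hy => hy.1), f2 ▸ key hF.snd (hS.mono fun y hy => hy.2)⟩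

theorem differentiableAt_leftTriv {F Y : E → ℍ[ℝ] × ℍ[ℝ]} {x : E}
    (hF : DifferentiableAt ℝ F x) (hY : DifferentiableAt ℝ Y x) (hS : F x ∈ S3S3) :
    DifferentiableAt ℝ (fun y => leftTriv (F y) (Y y)) x := by
  have hp : (F x).1 ≠ 0 := by intro h; have := hS.1; simp [h] at this
  have hq : (F x).2 ≠ 0 := by intro h; have := hS.2; simp [h] at this
  exact ((hF.fst.inv hp).mul hY.fst).prodMk ((hF.snd.inv hq).mul hY.snd)

theorem fderiv_leftTriv_re {F Y : E → ℍ[ℝ] × ℍ[ℝ]} {x : E}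
    (hF : DifferentiableAt ℝ F x) (hY : DifferentiableAt ℝ Y x)
    (hS : ∀ᶠ y in nhds x, F y ∈ S3S3) (hT : ∀ᶠ y in nhds x, Y y ∈ tangentSpaceAt (F y)) (v : E) :
    (fderiv ℝ (fun y => leftTriv (F y) (Y y)) x v).1.re = 0 ∧
      (fderiv ℝ (fun y => leftTriv (F y) (Y y)) x v).2.re = 0 := by
  have hd := differentiableAt_leftTriv hF hY hS.self_of_nhds
  have key : ∀ {G : E → ℍ[ℝ]}, DifferentiableAt ℝ G x → (∀ᶠ y in nhds x, (G y).re = 0) →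
      (fderiv ℝ G x v).re = 0 := by
    intro G hG h
    have e : (fun y => inner ℝ (1 : ℍ[ℝ]) (G y)) =ᶠ[nhds x] fun _ => (0 : ℝ) := by
      filter_upwards [h] with y hy
      rw [Quaternion.inner_def]
      simpa using hy
    have h' := fderiv_inner_apply ℝ (differentiableAt_const (1 : ℍ[ℝ])) hG v
    rw [e.fderiv_eq, Quaternion.inner_def] at h'
    simpa using h'.symm
  have f1 := key hd.fst (by
    filter_upwards [hS, hT] with y h1 h2
    exact (leftTriv_re h1 h2).1)
  have f2 := key hd.snd (by
    filter_upwards [hS, hT] with y h1 h2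
    exact (leftTriv_re h1 h2).2)
  rw [fderiv.fst hd] at f1
  rw [fderiv.snd hd] at f2
  exact ⟨f1, f2⟩

theorem leftGamma_re (a b : ℍ[ℝ] × ℍ[ℝ]) : (leftGamma a b).1.re = 0 ∧ (leftGamma a b).2.re = 0 := by
  constructor <;> simp [leftGamma, cross] <;> ring

/-- `∇̃_v Y` is tangent to `S³ × S³`. -/
theorem covDeriv_mem {F Y : E → ℍ[ℝ] × ℍ[ℝ]} {x : E}
    (hF : DifferentiableAt ℝ F x) (hY : DifferentiableAt ℝ Y x)
    (hS : ∀ᶠ y in nhds x, F y ∈ S3S3) (hT : ∀ᶠ y in nhds x, Y y ∈ tangentSpaceAt (F y)) (v : E) :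
    covDeriv F Y x v ∈ tangentSpaceAt (F x) := by
  have h := fderiv_leftTriv_re hF hY hS hT v
  have h' := leftGamma_re (leftTriv (F x) (fderiv ℝ F x v)) (leftTriv (F x) (Y x))
  refine mem_tangentSpaceAt_mul hS.self_of_nhds ?_ ?_
  · rw [Prod.fst_add, Quaternion.re_add, h.1, h'.1, add_zero]
  · rw [Prod.snd_add, Quaternion.re_add, h.2, h'.2, add_zero]

theorem gLeft_leftGamma {a b c : ℍ[ℝ] × ℍ[ℝ]} :
    gLeft (leftGamma a b) c + gLeft b (leftGamma a c) = 0 := by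
  simp only [gLeft, leftGamma, cross, Quaternion.inner_def]
  simp
  ring

theorem leftTriv_mul {x : ℍ[ℝ] × ℍ[ℝ]} (hx : x ∈ S3S3) (w : ℍ[ℝ] × ℍ[ℝ]) :
    leftTriv x (x.1 * w.1, x.2 * w.2) = w := by
  have hp : x.1 ≠ 0 := by intro h; have := hx.1; simp [h] at this
  have hq : x.2 ≠ 0 := by intro h; have := hx.2; simp [h] at this
  simp [leftTriv, inv_mul_cancel_left₀ hp, inv_mul_cancel_left₀ hq]

/-- Compatibility with the metric: `v (g (Y, Z)) = g (∇̃_v Y, Z) + g (Y, ∇̃_v Z)`. -/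
theorem covDeriv_metric {F Y Z : E → ℍ[ℝ] × ℍ[ℝ]} {x : E}
    (hF : DifferentiableAt ℝ F x) (hY : DifferentiableAt ℝ Y x) (hZ : DifferentiableAt ℝ Z x)
    (hS : ∀ᶠ y in nhds x, F y ∈ S3S3) (v : E) :
    fderiv ℝ (fun y => g (F y) (Y y) (Z y)) x v =
      g (F x) (covDeriv F Y x v) (Z x) + g (F x) (Y x) (covDeriv F Z x v) := by
  have hx := hS.self_of_nhds
  have e : (fun y => g (F y) (Y y) (Z y)) =ᶠ[nhds x]
      fun y => gLeft (leftTriv (F y) (Y y)) (leftTriv (F y) (Z y)) := by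
    filter_upwards [hS] with y hy
    exact g_eq_gLeft hy _ _
  have hA := differentiableAt_leftTriv hF hY hx
  have hB := differentiableAt_leftTriv hF hZ hx
  rw [e.fderiv_eq, g_eq_gLeft hx, g_eq_gLeft hx]
  simp only [covDeriv, leftTriv_mul hx]
  generalize hAdef : (fun y => leftTriv (F y) (Y y)) = A at *
  generalize hBdef : (fun y => leftTriv (F y) (Z y)) = B at *
  have hA0 : leftTriv (F x) (Y x) = A x := by rw [← hAdef]
  have hB0 : leftTriv (F x) (Z x) = B x := by rw [← hBdef]
  have e2 : (fun y => gLeft (leftTriv (F y) (Y y)) (leftTriv (F y) (Z y))) =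
      fun y => gLeft (A y) (B y) := by rw [← hAdef, ← hBdef]
  rw [e2, hA0, hB0]
  have hd : HasFDerivAt (fun y => gLeft (A y) (B y)) _ x :=
    (((hA.fst.hasFDerivAt.inner ℝ hB.fst.hasFDerivAt).add
      (hA.snd.hasFDerivAt.inner ℝ hB.snd.hasFDerivAt)).const_mul (4 / 3)).sub
    (((hA.fst.hasFDerivAt.inner ℝ hB.snd.hasFDerivAt).add
      (hB.fst.hasFDerivAt.inner ℝ hA.snd.hasFDerivAt)).const_mul (2 / 3))
  rw [hd.fderiv]
  have hG := gLeft_leftGamma (a := leftTriv (F x) (fderiv ℝ F x v)) (b := A x) (c := B x)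
  have add_l : ∀ a b c, gLeft (a + b) c = gLeft a c + gLeft b c := by
    intro a b c; simp only [gLeft, Prod.fst_add, Prod.snd_add, inner_add_left, inner_add_right]
    ring
  have add_r : ∀ a b c, gLeft a (b + c) = gLeft a b + gLeft a c := by
    intro a b c; simp only [gLeft, Prod.fst_add, Prod.snd_add, inner_add_left, inner_add_right]
    ring
  rw [add_l, add_r]
  have : ∀ r s : ℝ, r = s → r = s + 0 := fun r s h => by rw [h, add_zero]
  rw [show ∀ p q r s : ℝ, p + q + (r + s) = p + r + (q + s) from fun p q r s => by ring, hG]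
  apply this
  simp [fderiv.fst hA, fderiv.snd hA, fderiv.fst hB, fderiv.snd hB, fderivInnerCLM_apply, gLeft]
  ring

/-- Torsion freeness: `∇̃_v dF(w) = ∇̃_w dF(v)` for constant fields `v`, `w`. -/
theorem covDeriv_torsionFree {F : E → ℍ[ℝ] × ℍ[ℝ]} {x : E} (hF : ContDiffAt ℝ 2 F x)
    (hx : F x ∈ S3S3) (v w : E) :
    covDeriv F (fun y => fderiv ℝ F y w) x v = covDeriv F (fun y => fderiv ℝ F y v) x w := by
  have hp : (F x).1 ≠ 0 := by intro h; have := hx.1; simp [h] at this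
  have hq : (F x).2 ≠ 0 := by intro h; have := hx.2; simp [h] at this
  have hF1 : DifferentiableAt ℝ F x := hF.differentiableAt (by norm_num)
  have hdF : DifferentiableAt ℝ (fderiv ℝ F) x :=
    (hF.fderiv_right (m := 1) (by norm_num)).differentiableAt (by norm_num)
  have hsym : fderiv ℝ (fderiv ℝ F) x v w = fderiv ℝ (fderiv ℝ F) x w v :=
    (hF.isSymmSndFDerivAt (by simp)) v w
  have key : ∀ v w : E, fderiv ℝ (fun y => leftTriv (F y) (fderiv ℝ F y w)) x v =
      ((F x).1⁻¹ * (fderiv ℝ (fderiv ℝ F) x v w).1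
          - (F x).1⁻¹ * (fderiv ℝ F x v).1 * ((F x).1⁻¹ * (fderiv ℝ F x w).1),
        (F x).2⁻¹ * (fderiv ℝ (fderiv ℝ F) x v w).2
          - (F x).2⁻¹ * (fderiv ℝ F x v).2 * ((F x).2⁻¹ * (fderiv ℝ F x w).2)) := by
    intro v w
    have hw : HasFDerivAt (fun y => fderiv ℝ F y w) _ x :=
      hdF.hasFDerivAt.clm_apply (hasFDerivAt_const w x)
    have h1 : HasFDerivAt (fun y => (F y).1⁻¹ * (fderiv ℝ F y w).1) _ x :=
      ((hasFDerivAt_inv' hp).comp x hF1.hasFDerivAt.fst).mul' hw.fst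
    have h2 : HasFDerivAt (fun y => (F y).2⁻¹ * (fderiv ℝ F y w).2) _ x :=
      ((hasFDerivAt_inv' hq).comp x hF1.hasFDerivAt.snd).mul' hw.snd
    have h3 := (h1.prodMk h2).fderiv
    have h4 : (fun y => leftTriv (F y) (fderiv ℝ F y w)) =
      fun y => ((F y).1⁻¹ * (fderiv ℝ F y w).1, (F y).2⁻¹ * (fderiv ℝ F y w).2) := rfl
    rw [h4, h3]
    ext1
    · simp [mul_assoc, sub_eq_add_neg]
    · simp [mul_assoc, sub_eq_add_neg]
  have hsub : fderiv ℝ (fun y => leftTriv (F y) (fderiv ℝ F y w)) x v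
      + leftGamma (leftTriv (F x) (fderiv ℝ F x v)) (leftTriv (F x) (fderiv ℝ F x w)) =
      fderiv ℝ (fun y => leftTriv (F y) (fderiv ℝ F y v)) x w
      + leftGamma (leftTriv (F x) (fderiv ℝ F x w)) (leftTriv (F x) (fderiv ℝ F x v)) := by
    rw [key v w, key w v, hsym]
    generalize fderiv ℝ (fderiv ℝ F) x w v = S
    generalize fderiv ℝ F x v = A
    generalize fderiv ℝ F x w = B
    simp only [leftGamma, leftTriv, cross]
    generalize (F x).1⁻¹ * A.1 = a1
    generalize (F x).2⁻¹ * A.2 = a2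
    generalize (F x).1⁻¹ * B.1 = b1
    generalize (F x).2⁻¹ * B.2 = b2
    ext1
    · simp only [Prod.fst_add]
      module
    · simp only [Prod.snd_add]
      module
  simp only [covDeriv, hsub]

end LeviCivita

/-! ### Submanifolds in local coordinates

`F : ℝ³ → ℍ × ℍ` is (near the point `x` considered) an immersion into `S³ × S³`.  All tensors are
evaluated on the constant coordinate fields that extend the given vectors `u, v, w ∈ ℝ³`. -/

/-- `ℝ³`. -/
abbrev E3 : Type := EuclideanSpace ℝ (Fin 3)

/-- The `i`-th coordinate field `∂ᵢ F`. -/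
def partialF (F : E3 → ℍ[ℝ] × ℍ[ℝ]) (x : E3) (i : Fin 3) : ℍ[ℝ] × ℍ[ℝ] :=
  fderiv ℝ F x (EuclideanSpace.single i 1)

/-- The Gram matrix `g (∂ᵢ F, ∂ⱼ F)` of the induced metric. -/
def gram (F : E3 → ℍ[ℝ] × ℍ[ℝ]) (x : E3) : Matrix (Fin 3) (Fin 3) ℝ :=
  Matrix.of fun i j => g (F x) (partialF F x i) (partialF F x j)

/-- The coordinates of the `g`-orthogonal projection of `Z` to the tangent space of the
submanifold. -/
def tangentCoord (F : E3 → ℍ[ℝ] × ℍ[ℝ]) (x : E3) (Z : ℍ[ℝ] × ℍ[ℝ]) : E3 :=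
  WithLp.toLp 2 (Matrix.mulVec (gram F x)⁻¹ fun j => g (F x) Z (partialF F x j))

/-- The normal part of `Z`. -/
def normalPart (F : E3 → ℍ[ℝ] × ℍ[ℝ]) (x : E3) (Z : ℍ[ℝ] × ℍ[ℝ]) : ℍ[ℝ] × ℍ[ℝ] :=
  Z - fderiv ℝ F x (tangentCoord F x Z)

/-- The induced connection `∇_v w` (coordinate expression, `v` and `w` constant): the tangential
part of `∇̃_v dF(w)`. -/
def indConn (F : E3 → ℍ[ℝ] × ℍ[ℝ]) (x v w : E3) : E3 :=
  tangentCoord F x (covDeriv F (fun y => fderiv ℝ F y w) x v)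

/-- The second fundamental form `h (v, w)`: the normal part of `∇̃_v dF(w)`. -/
def secondFF (F : E3 → ℍ[ℝ] × ℍ[ℝ]) (x v w : E3) : ℍ[ℝ] × ℍ[ℝ] :=
  normalPart F x (covDeriv F (fun y => fderiv ℝ F y w) x v)

/-- `(∇h)(u, v, w) = ∇^⊥_u (h(v, w)) - h(∇_u v, w) - h(v, ∇_u w)`. -/
def nablaSecondFF (F : E3 → ℍ[ℝ] × ℍ[ℝ]) (x u v w : E3) : ℍ[ℝ] × ℍ[ℝ] :=
  normalPart F x (covDeriv F (fun y => secondFF F y v w) x u)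
    - secondFF F x (indConn F x u v) w - secondFF F x v (indConn F x u w)

/-! ### Lagrangian submanifolds -/

section Submanifold

variable {M : Type*} [TopologicalSpace M] [ChartedSpace E3 M]

/-- The differential of `f` at `p`. -/
def diff (f : M → ℍ[ℝ] × ℍ[ℝ]) (p : M) : E3 →L[ℝ] ℍ[ℝ] × ℍ[ℝ] :=
  mfderiv (𝓡 3) 𝓘(ℝ, ℍ[ℝ] × ℍ[ℝ]) f p

/-- The normal space at `p` of the immersion `f` into `S³ × S³`. -/
def normalSpace (f : M → ℍ[ℝ] × ℍ[ℝ]) (p : M) : Set (ℍ[ℝ] × ℍ[ℝ]) :=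
  {Z | Z ∈ tangentSpaceAt (f p) ∧ ∀ v : E3, g (f p) Z (diff f p v) = 0}

/-- `f` is a smooth immersion of the `3`-manifold `M` into `S³ × S³` that is Lagrangian: `J`
interchanges the tangent spaces and the normal spaces. -/
structure IsLagrangianImmersion (f : M → ℍ[ℝ] × ℍ[ℝ]) : Prop where
  smooth : ContMDiff (𝓡 3) 𝓘(ℝ, ℍ[ℝ] × ℍ[ℝ]) ∞ f
  maps_to : ∀ p, f p ∈ S3S3
  immersion : ∀ p, Function.Injective (diff f p)
  lagrangian : ∀ p, J (f p) '' Set.range (diff f p) = normalSpace f p ∧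
    J (f p) '' normalSpace f p = Set.range (diff f p)

/-- The expression of `f` in the preferred chart of `M` at `p`.  Its derivative at the image of
`p` is the differential of `f` at `p`. -/
def localExpr (f : M → ℍ[ℝ] × ℍ[ℝ]) (p : M) : E3 → ℍ[ℝ] × ℍ[ℝ] :=
  f ∘ (extChartAt (𝓡 3) p).symm

theorem fderiv_localExpr {f : M → ℍ[ℝ] × ℍ[ℝ]} {p : M}
    (hf : MDifferentiableAt (𝓡 3) 𝓘(ℝ, ℍ[ℝ] × ℍ[ℝ]) f p) :
    fderiv ℝ (localExpr f p) (extChartAt (𝓡 3) p p) = diff f p := by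
  simp only [diff, hf.mfderiv, localExpr]
  simp [writtenInExtChartAt, fderivWithin_univ]
  rfl

/-- `(∇h)(u, v, w)` of the immersion `f` at the point `p`, for `u, v, w ∈ T_p M = ℝ³`. -/
def nablaH (f : M → ℍ[ℝ] × ℍ[ℝ]) (p : M) (u v w : E3) : ℍ[ℝ] × ℍ[ℝ] :=
  nablaSecondFF (localExpr f p) (extChartAt (𝓡 3) p p) u v w

/-- `f` is `J`-isotropic with isotropic function `lam`:
`g ((∇h)(v, v, v), J v) = lam(p) g(v, v)²` for all `v ∈ T_p M`. -/
def IsJIsotropic (f : M → ℍ[ℝ] × ℍ[ℝ]) (lam : M → ℝ) : Prop :=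
  ∀ (p : M) (v : E3), g (f p) (nablaH f p v v v) (J (f p) (diff f p v)) =
    lam p * g (f p) (diff f p v) (diff f p v) ^ 2

/-- `J`-parallel: `J`-isotropic with vanishing isotropic function. -/
def IsJParallel (f : M → ℍ[ℝ] × ℍ[ℝ]) : Prop := IsJIsotropic f fun _ => 0

end Submanifold

/-! ### The eight immersions -/

instance finrankQuaternion : Fact (Module.finrank ℝ ℍ[ℝ] = 3 + 1) :=
  ⟨Quaternion.finrank_eq_four⟩

/-- The `3`-sphere of unit quaternions, with its standard manifold structure. -/
abbrev S3 : Type := Metric.sphere (0 : ℍ[ℝ]) 1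

/-- The imaginary unit `i`. -/
def qi : ℍ[ℝ] := ⟨0, 1, 0, 0⟩

/-- The imaginary unit `j`. -/
def qj : ℍ[ℝ] := ⟨0, 0, 1, 0⟩

def f1 (u : S3) : ℍ[ℝ] × ℍ[ℝ] := (1, u)

def f2 (u : S3) : ℍ[ℝ] × ℍ[ℝ] := (u, 1)

def f3 (u : S3) : ℍ[ℝ] × ℍ[ℝ] := (u, u)

def f4 (u : S3) : ℍ[ℝ] × ℍ[ℝ] := (u, u * qi)

def f5 (u : S3) : ℍ[ℝ] × ℍ[ℝ] := (u * qi * (u : ℍ[ℝ])⁻¹, (u : ℍ[ℝ])⁻¹)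

def f6 (u : S3) : ℍ[ℝ] × ℍ[ℝ] := ((u : ℍ[ℝ])⁻¹, u * qi * (u : ℍ[ℝ])⁻¹)

def f7 (u : S3) : ℍ[ℝ] × ℍ[ℝ] := (u * qi * (u : ℍ[ℝ])⁻¹, u * qj * (u : ℍ[ℝ])⁻¹)

/-- The torus `p(u, w)`. -/
def torusP (u w : ℝ) : ℍ[ℝ] :=
  ⟨Real.cos (Real.sqrt 3 * u / 2) * Real.cos (Real.sqrt 3 * w / 2),
    Real.cos (Real.sqrt 3 * u / 2) * Real.sin (Real.sqrt 3 * w / 2),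
    Real.sin (Real.sqrt 3 * u / 2) * Real.cos (Real.sqrt 3 * w / 2),
    Real.sin (Real.sqrt 3 * u / 2) * Real.sin (Real.sqrt 3 * w / 2)⟩

/-- The torus `q(u, v)`. -/
def torusQ (u v : ℝ) : ℍ[ℝ] :=
  (1 / Real.sqrt 2) •
    (⟨Real.cos (Real.sqrt 3 * v / 2) *
        (Real.sin (Real.sqrt 3 * u / 2) + Real.cos (Real.sqrt 3 * u / 2)),
      Real.sin (Real.sqrt 3 * v / 2) *
        (Real.sin (Real.sqrt 3 * u / 2) + Real.cos (Real.sqrt 3 * u / 2)),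
      Real.cos (Real.sqrt 3 * v / 2) *
        (Real.sin (Real.sqrt 3 * u / 2) - Real.cos (Real.sqrt 3 * u / 2)),
      Real.sin (Real.sqrt 3 * v / 2) *
        (Real.sin (Real.sqrt 3 * u / 2) - Real.cos (Real.sqrt 3 * u / 2))⟩ : ℍ[ℝ])

/-- `(u, v, w) ↦ (p(u, w), q(u, v))` on `ℝ³`. -/
def f8 (t : E3) : ℍ[ℝ] × ℍ[ℝ] := (torusP (t 0) (t 2), torusQ (t 0) (t 1))

/-! ### Local congruence -/

/-- The transformation `(p, q) ↦ (a p c⁻¹, b q c⁻¹)`; for unit quaternions `a, b, c` these are the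
isometries of the nearly Kähler `S³ × S³` that preserve `J` and the almost product structure
`P (U, V) = (p q⁻¹ V, q p⁻¹ U)`. -/
def nkIsometry (a b c : ℍ[ℝ]) (x : ℍ[ℝ] × ℍ[ℝ]) : ℍ[ℝ] × ℍ[ℝ] :=
  (a * x.1 * c⁻¹, b * x.2 * c⁻¹)

/-- Near `p` the immersion `f` is, up to a diffeomorphism `Θ` from an open neighbourhood of `p`
onto an open subset of the domain `D` of `ψ` and up to an isometry of `S³ × S³`, the immersion
`ψ`. -/
def LocallyCongruentAt {M D : Type*} [TopologicalSpace M] [ChartedSpace E3 M]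
    [TopologicalSpace D] [ChartedSpace E3 D]
    (f : M → ℍ[ℝ] × ℍ[ℝ]) (p : M) (ψ : D → ℍ[ℝ] × ℍ[ℝ]) : Prop :=
  ∃ a b c : ℍ[ℝ], ‖a‖ = 1 ∧ ‖b‖ = 1 ∧ ‖c‖ = 1 ∧
    ∃ Θ : OpenPartialHomeomorph M D, p ∈ Θ.source ∧
      ContMDiffOn (𝓡 3) (𝓡 3) ∞ Θ Θ.source ∧
      ContMDiffOn (𝓡 3) (𝓡 3) ∞ Θ.symm Θ.target ∧
      ∀ x ∈ Θ.source, f x = nkIsometry a b c (ψ (Θ x))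

/-- Near `p` the immersion `f` is given by the `i`-th immersion of the list `f1, …, f8`
(`i = 0, …, 7`). -/
def LocallyGivenBy {M : Type*} [TopologicalSpace M] [ChartedSpace E3 M]
    (f : M → ℍ[ℝ] × ℍ[ℝ]) (p : M) (i : Fin 8) : Prop :=
  match i with
  | 0 => LocallyCongruentAt f p f1
  | 1 => LocallyCongruentAt f p f2
  | 2 => LocallyCongruentAt f p f3
  | 3 => LocallyCongruentAt f p f4
  | 4 => LocallyCongruentAt f p f5
  | 5 => LocallyCongruentAt f p f6
  | 6 => LocallyCongruentAt f p f7
  | 7 => LocallyCongruentAt f p f8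

end NearlyKahler

end

/-! In the left trivialization a tangent vector is a pair `x` of vectors of `ℝ³`, and `x.1 + ω x.2`
with `ω = exp (2πi/3)` identifies the tangent space with `ℂ³`. Then `gV` is 4/3 of the standard
metric, `J` is multiplication by `-i`, `kap` is a multiple of the Kähler form and `tri` a multiple
of the imaginary part of the complex determinant.

A Lagrangian immersion is studied through its trivialized differential `ζ`, which satisfies the
Maurer-Cartan equation and annihilates `kap`. Differentiating the latter shows that the cubic form
is totally symmetric and that `tri` vanishes on tangent spaces (`eventually_tri_eq_zero`). Each
tangent space is spanned by vectors `z_k n_k` with an oriented orthonormal frame `n` of `ℝ³` and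
complex numbers `z_k = a_k + ω b_k` of argument `θ_k` (`exists_isAdapted`); `tri = 0` says that `z_0
z_1 z_2` is real, that is, the angles add up to a multiple of π (`exists_duality`).

Derivatives of `tri = 0` make the cubic form and its covariant derivative trace free, and the
Codazzi equation gives the antisymmetric part of that derivative (`nabC_diagonal`). Isotropy fixes
the symmetrized part. Together they force `lam = 0` and the equality of `sin 2(θ_i - θ_j)` over the
three cyclic pairs (`IsAdapted.isotropic`). Because of the angle sum, a difference of two such sines
is a multiple of `sin 3θ_j cos (θ_i - θ_k)`, and only seven normal forms remain
(`IsAdapted.exists_normalForm`). A continuous invariant separates them, so the form is locally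
constant.

Each form is then integrated by the principle that two maps to the unit quaternions with the same
logarithmic derivative differ by a constant left factor (`HasLog.exists_eq_mul`). In forms 0, 1, 2 a
component is constant or the two logarithmic derivatives agree. In form 3 they differ by a rotation
by π, whose axis must be constant (`fderiv_eq_zero_of_reflection`); forms 4 and 5 reduce to this
one. In form 6 a moving frame leads to structure equations with one parameter, which can only be 0
(the flat `f8`) or -1/2 (the sphere `f7`). Since `f7` and `f8` are nowhere locally congruent, the
index can be chosen locally constant. -/

noncomputable section

namespace NearlyKahler

/-! ### Tangent vectors in coordinates -/

/-- The space of imaginary quaternions in coordinates. -/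
abbrev V3 : Type := Fin 3 → ℝ

/-- The Levi-Civita connection of left-invariant fields, in coordinates. -/
def gam (x y : V3 × V3) : V3 × V3 :=
  (crossProduct x.1 y.1 + (1 / 3 : ℝ) • (crossProduct x.2 y.1 - crossProduct x.1 y.2),
    crossProduct x.2 y.2 - (1 / 3 : ℝ) • (crossProduct x.2 y.1 - crossProduct x.1 y.2))

/-- The fundamental form `√3 / 2 * g (x, J y)`, in coordinates. -/
def kap (x y : V3 × V3) : ℝ := x.1 ⬝ᵥ y.2 - x.2 ⬝ᵥ y.1

/-- The nearly Kähler metric, in coordinates. -/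
def gV (x y : V3 × V3) : ℝ :=
  4 / 3 * (x.1 ⬝ᵥ y.1 + x.2 ⬝ᵥ y.2) - 2 / 3 * (x.1 ⬝ᵥ y.2 + y.1 ⬝ᵥ x.2)

/-- The torsion form `g ((∇̃_x J) y, z)` up to a factor, in coordinates. -/
def tri (x y z : V3 × V3) : ℝ := kap (gam x y) z + kap y (gam x z)

/-- The Codazzi equation for a diagonal Lagrangian frame: the antisymmetric part of the covariant
derivative of the cubic form. -/
theorem codazzi_diagonal (a b : V3) (ρ : ℝ)
    (hN : ∀ k, 4 / 3 * (a k ^ 2 + b k ^ 2 - a k * b k) = 1)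
    (ha2 : a 0 * a 1 - a 0 * b 1 - a 1 * b 0 = ρ * a 2)
    (hb2 : b 0 * b 1 - a 0 * b 1 - a 1 * b 0 = ρ * b 2)
    (z : Fin 3 → V3 × V3)
    (hz0 : z 0 = (![a 0, 0, 0], ![b 0, 0, 0]))
    (hz1 : z 1 = (![0, a 1, 0], ![0, b 1, 0]))
    (P C : Fin 3 → Fin 3 → Fin 3 → ℝ)
    (hP : ∀ i j k, P i j k = P j i k) (hC1 : ∀ i j k, C i j k = C j i k)
    (hC2 : ∀ i j k, C i j k = C i k j)
    (Z : Fin 3 → Fin 3 → V3 × V3)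
    (hZ : ∀ i j, Z i j = (fun k => P i j k * a k + 2 / 3 * C i j k * (2 * b k - a k),
      fun k => P i j k * b k + 2 / 3 * C i j k * (b k - 2 * a k))) :
    (kap (gam (Z 0 1 - gam (z 0) (z 1)) (z 0) + gam (z 1) (Z 0 0 - gam (z 0) (z 0))) (z 1)
      + kap (Z 1 0) (Z 0 1 - gam (z 0) (z 1)))
    - (kap (gam (Z 1 0 - gam (z 1) (z 0)) (z 0) + gam (z 0) (Z 1 0 - gam (z 1) (z 0))) (z 1)
      + kap (Z 0 0) (Z 1 1 - gam (z 1) (z 1)))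
    - (∑ k, (P 0 0 k * C k 1 1 + P 0 1 k * C k 0 1))
    + (∑ k, (P 1 0 k * C k 0 1 + P 1 1 k * C k 0 0)) =
    -(2 / 3) * (a 0 * b 1 - b 0 * a 1) * (4 / 3 * (a 0 * a 1 + b 0 * b 1)
      - 2 / 3 * (a 0 * b 1 + b 0 * a 1)) - 2 / 3 * ρ * C 0 1 2 := by
  rw [hZ, hZ, hZ, hZ, hz0, hz1]
  simp only [kap, gam, cross_apply, Matrix.vec3_dotProduct, Fin.sum_univ_three, Prod.fst_add,
    Prod.snd_add, Prod.fst_sub, Prod.snd_sub, Pi.add_apply, Pi.sub_apply, Pi.smul_apply,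
    smul_eq_mul, Matrix.cons_val]
  rw [hP 1 0 0, hP 1 0 1, hP 1 0 2, hC1 1 0 0, hC1 1 0 1, hC1 1 0 2, hC1 2 0 1, hC1 2 0 0,
    hC2 0 2 0, hC1 2 1 1, hC2 1 2 1, hC2 0 1 0, hC2 0 2 1, hC2 1 1 0, hC1 1 0 1]
  -- The second derivatives of the frame are already dropped on the left: they are symmetric and
  -- cancel in the antisymmetrization. The products of `P` and `C` cancel by the normalizations;
  -- what survives is the ambient curvature and, by the duality relations, the torsion term in `C 0
  -- 1 2`.
  linear_combination (P 0 0 0 * C 0 1 1 - C 0 0 0 * P 1 1 0) * hN 0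
    + (P 0 0 1 * C 1 1 1 - C 0 0 1 * P 1 1 1) * hN 1
    + (P 0 0 2 * C 1 1 2 - C 0 0 2 * P 1 1 2 - 2 / 3 * ρ * C 0 1 2) * hN 2
    - 2 / 3 * (P 0 1 2 * a 2 + 2 / 3 * C 0 1 2 * (2 * b 2 - a 2)) * hb2
    + 2 / 3 * (P 0 1 2 * b 2 + 2 / 3 * C 0 1 2 * (b 2 - 2 * a 2)) * ha2

/-- A polynomial identity modulo the normalizations and the duality relations. The factor `2 / 3 *
ρ` is the one of `tri_diagonal`, so that the right side cancels against the second derivative of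
`tri = 0` in `trace_diagonal`. -/
theorem trace_diagonal_aux (a b : V3) (ρ : ℝ)
    (h0 : b 0 ^ 2 = 3 / 4 - a 0 ^ 2 + a 0 * b 0)
    (h1 : b 1 ^ 2 = 3 / 4 - a 1 ^ 2 + a 1 * b 1)
    (hρ : ρ ^ 2 = 3 / 4)
    (ha2 : a 2 = 4 / 3 * ρ * (a 0 * a 1 - a 0 * b 1 - a 1 * b 0))
    (hb2 : b 2 = 4 / 3 * ρ * (b 0 * b 1 - a 0 * b 1 - a 1 * b 0))
    (z : Fin 3 → V3 × V3)
    (hz0 : z 0 = (![a 0, 0, 0], ![b 0, 0, 0]))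
    (hz1 : z 1 = (![0, a 1, 0], ![0, b 1, 0]))
    (hz2 : z 2 = (![0, 0, a 2], ![0, 0, b 2]))
    (P C : Fin 3 → V3)
    (c01 : C 1 0 = C 0 1) (c02 : C 2 0 = C 0 2) (c12 : C 2 1 = C 1 2)
    (c22 : C 2 2 = -C 0 0 - C 1 1)
    (Z D : Fin 3 → V3 × V3)
    (hZ : ∀ j, Z j = (fun k => P j k * a k + 2 / 3 * C j k * (2 * b k - a k),
      fun k => P j k * b k + 2 / 3 * C j k * (b k - 2 * a k)))
    (hD : ∀ j, D j = Z j - gam (z 0) (z j)) :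
    2 / 3 * ρ * ((kap (gam (D 0) (z 0) + gam (z 0) (D 0)) (z 0) + kap (Z 0) (D 0)) +
      (kap (gam (D 0) (z 1) + gam (z 0) (D 1)) (z 1) + kap (Z 1) (D 1)) +
      (kap (gam (D 0) (z 2) + gam (z 0) (D 2)) (z 2) + kap (Z 2) (D 2))
      - 2 * (P 0 0 * C 0 0 + P 0 1 * C 0 1 + P 0 2 * C 0 2 + P 1 0 * C 0 1 + P 1 1 * C 1 1
        + P 1 2 * C 1 2 + P 2 0 * C 0 2 + P 2 1 * C 1 2 + P 2 2 * C 2 2)) =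
    -(2 * (tri (z 0) (D 1) (D 2) + tri (D 0) (D 1) (z 2) + tri (D 0) (z 1) (D 2))) := by
  -- The relations are used as rewriting rules for `b 0 ^ 2`, `b 1 ^ 2` and `ρ ^ 2`; the higher
  -- powers that occur after expansion need rules of their own.
  have h03 : b 0 ^ 3 = (3 / 4 - a 0 ^ 2) * b 0 + a 0 * (3 / 4 - a 0 ^ 2 + a 0 * b 0) := by
    linear_combination (b 0 + a 0) * h0
  have h04 : b 0 ^ 4 = (3 / 4 - a 0 ^ 2 + a 0 * b 0) ^ 2 := by
    linear_combination (b 0 ^ 2 + 3 / 4 - a 0 ^ 2 + a 0 * b 0) * h0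
  have r3 : ρ ^ 3 = 3 / 4 * ρ := by linear_combination ρ * hρ
  simp only [hD, hZ, hz0, hz1, hz2, tri, kap, gam, cross_apply, Matrix.vec3_dotProduct,
    Prod.fst_add, Prod.snd_add, Prod.fst_sub, Prod.snd_sub, Pi.add_apply, Pi.sub_apply,
    Pi.smul_apply, smul_eq_mul, Matrix.cons_val, c01, c02, c12, c22, mul_zero, zero_mul, add_zero,
    zero_add, sub_zero, zero_sub]
  generalize a 0 = a0 at *
  generalize a 1 = a1 at *
  generalize a 2 = a2 at *
  generalize b 0 = b0 at *
  generalize b 1 = b1 at *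
  generalize b 2 = b2 at *
  subst ha2 hb2
  rw [← sub_eq_zero]
  ring_nf
  simp only [h0, h1, h03, h04, hρ, r3]
  ring_nf
  simp only [h0]
  ring

/-- The hypotheses say that the conjugate of the product of two of the numbers `a k + ω b k` is `ρ`
times the third. Hence contracting the determinant form with two frame vectors leaves the
fundamental form paired with the third. This is what turns derivatives of `tri = 0` into traces. -/
theorem tri_diagonal (a b : V3) (ρ : ℝ)
    (ha0 : a 1 * a 2 - a 1 * b 2 - a 2 * b 1 = ρ * a 0)
    (hb0 : b 1 * b 2 - a 1 * b 2 - a 2 * b 1 = ρ * b 0)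
    (ha1 : a 2 * a 0 - a 2 * b 0 - a 0 * b 2 = ρ * a 1)
    (hb1 : b 2 * b 0 - a 2 * b 0 - a 0 * b 2 = ρ * b 1)
    (ha2 : a 0 * a 1 - a 0 * b 1 - a 1 * b 0 = ρ * a 2)
    (hb2 : b 0 * b 1 - a 0 * b 1 - a 1 * b 0 = ρ * b 2)
    (z : Fin 3 → V3 × V3)
    (hz0 : z 0 = (![a 0, 0, 0], ![b 0, 0, 0]))
    (hz1 : z 1 = (![0, a 1, 0], ![0, b 1, 0]))
    (hz2 : z 2 = (![0, 0, a 2], ![0, 0, b 2])) (ξ : V3 × V3) :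
    tri ξ (z 1) (z 2) = -(2 / 3) * ρ * kap ξ (z 0) ∧
      tri (z 0) ξ (z 2) = -(2 / 3) * ρ * kap ξ (z 1) ∧
      tri (z 0) (z 1) ξ = -(2 / 3) * ρ * kap ξ (z 2) := by
  simp only [hz0, hz1, hz2, tri, kap, gam, cross_apply, Matrix.vec3_dotProduct, Pi.add_apply,
    Pi.sub_apply, Pi.smul_apply, smul_eq_mul, Matrix.cons_val]
  refine ⟨?_, ?_, ?_⟩
  · linear_combination (-(2 / 3) * ξ.1 0) * hb0 + (2 / 3 * ξ.2 0) * ha0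
  · linear_combination (-(2 / 3) * ξ.1 1) * hb1 + (2 / 3 * ξ.2 1) * ha1
  · linear_combination (-(2 / 3) * ξ.1 2) * hb2 + (2 / 3 * ξ.2 2) * ha2

/-- The covariant derivative of the cubic form is trace free, for a diagonal Lagrangian frame:
`D j` and `DD j` stand for the derivatives of the frame along its first vector. -/
theorem trace_diagonal (a b : V3) (ρ : ℝ)
    (hN : ∀ k, 4 / 3 * (a k ^ 2 + b k ^ 2 - a k * b k) = 1)
    (hρ : ρ ^ 2 = 3 / 4)
    (ha2 : a 0 * a 1 - a 0 * b 1 - a 1 * b 0 = ρ * a 2)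
    (hb2 : b 0 * b 1 - a 0 * b 1 - a 1 * b 0 = ρ * b 2)
    (z : Fin 3 → V3 × V3)
    (hz0 : z 0 = (![a 0, 0, 0], ![b 0, 0, 0]))
    (hz1 : z 1 = (![0, a 1, 0], ![0, b 1, 0]))
    (hz2 : z 2 = (![0, 0, a 2], ![0, 0, b 2]))
    (ht : ∀ ξ, tri ξ (z 1) (z 2) = -(2 / 3) * ρ * kap ξ (z 0) ∧
      tri (z 0) ξ (z 2) = -(2 / 3) * ρ * kap ξ (z 1) ∧
      tri (z 0) (z 1) ξ = -(2 / 3) * ρ * kap ξ (z 2))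
    (P C : Fin 3 → V3) (hC : ∀ j k, C j k = C k j) (hC' : C 0 0 + C 1 1 + C 2 2 = 0)
    (Z D DD : Fin 3 → V3 × V3)
    (hZ : ∀ j, Z j = (fun k => P j k * a k + 2 / 3 * C j k * (2 * b k - a k),
      fun k => P j k * b k + 2 / 3 * C j k * (b k - 2 * a k)))
    (hD : ∀ j, D j = Z j - gam (z 0) (z j))
    (hDD : tri (DD 0) (z 1) (z 2) + tri (z 0) (DD 1) (z 2) + tri (z 0) (z 1) (DD 2) + 2 *
      (tri (z 0) (D 1) (D 2) + tri (D 0) (D 1) (z 2) + tri (D 0) (z 1) (D 2)) = 0) :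
    (kap (DD 0 + gam (D 0) (z 0) + gam (z 0) (D 0)) (z 0) + kap (Z 0) (D 0)) +
      (kap (DD 1 + gam (D 0) (z 1) + gam (z 0) (D 1)) (z 1) + kap (Z 1) (D 1)) +
      (kap (DD 2 + gam (D 0) (z 2) + gam (z 0) (D 2)) (z 2) + kap (Z 2) (D 2))
      = 2 * ∑ j, ∑ k, P j k * C j k := by
  have hρ0 : ρ ≠ 0 := by rintro rfl; norm_num at hρ
  have main := trace_diagonal_aux a b ρ (by linear_combination 3 / 4 * hN 0)
    (by linear_combination 3 / 4 * hN 1) hρ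
    (by linear_combination (-4 / 3 * ρ) * ha2 - 4 / 3 * a 2 * hρ)
    (by linear_combination (-4 / 3 * ρ) * hb2 - 4 / 3 * b 2 * hρ) z hz0 hz1 hz2 P C (hC _ _)
    (hC _ _) (hC _ _) (by linear_combination hC') Z D hZ hD
  rw [(ht _).1, (ht _).2.1, (ht _).2.2] at hDD
  have kadd : ∀ x y w w' : V3 × V3, kap (x + y + w) w' = kap x w' + kap (y + w) w' := by
    intro x y w w'
    simp only [kap, Prod.fst_add, Prod.snd_add, add_dotProduct]
    ring
  rw [kadd, kadd, kadd]
  simp only [Fin.sum_univ_three]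
  rw [hC 1 0, hC 2 0, hC 2 1, ← sub_eq_zero]
  refine (mul_eq_zero_iff_left (a := 2 / 3 * ρ) (by simpa using hρ0)).1 ?_
  linear_combination main - hDD

end NearlyKahler

end

/-! ### Calculus of the forms `gam`, `kap` and `tri`. -/

noncomputable section

namespace NearlyKahler

open Filter Topology

theorem gam_add_left (x x' y : V3 × V3) : gam (x + x') y = gam x y + gam x' y := by
  ext i <;> fin_cases i <;> simp [gam, cross_apply] <;> ring

theorem gam_add_right (x y y' : V3 × V3) : gam x (y + y') = gam x y + gam x y' := by
  ext i <;> fin_cases i <;> simp [gam, cross_apply] <;> ring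

theorem gam_smul_left (c : ℝ) (x y : V3 × V3) : gam (c • x) y = c • gam x y := by
  ext i <;> fin_cases i <;> simp [gam, cross_apply] <;> ring

theorem gam_smul_right (c : ℝ) (x y : V3 × V3) : gam x (c • y) = c • gam x y := by
  ext i <;> fin_cases i <;> simp [gam, cross_apply] <;> ring

theorem kap_add_left (x x' y : V3 × V3) : kap (x + x') y = kap x y + kap x' y := by
  simp only [kap, Prod.fst_add, Prod.snd_add, add_dotProduct]; ring

theorem kap_add_right (x y y' : V3 × V3) : kap x (y + y') = kap x y + kap x y' := by
  simp only [kap, Prod.fst_add, Prod.snd_add, dotProduct_add]; ring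

theorem kap_smul_left (c : ℝ) (x y : V3 × V3) : kap (c • x) y = c * kap x y := by
  simp only [kap, Prod.smul_fst, Prod.smul_snd, smul_dotProduct, smul_eq_mul]; ring

theorem kap_smul_right (c : ℝ) (x y : V3 × V3) : kap x (c • y) = c * kap x y := by
  simp only [kap, Prod.smul_fst, Prod.smul_snd, dotProduct_smul, smul_eq_mul]; ring

theorem kap_comm (x y : V3 × V3) : kap x y = -kap y x := by
  simp only [kap, dotProduct_comm x.1, dotProduct_comm x.2]; ring

/-- `gam` as a continuous bilinear map. -/
def gamL : V3 × V3 →L[ℝ] V3 × V3 →L[ℝ] V3 × V3 :=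
  (LinearMap.mk₂ ℝ gam gam_add_left gam_smul_left gam_add_right
    gam_smul_right).toContinuousBilinearMap

/-- `kap` as a continuous bilinear map. -/
def kapL : V3 × V3 →L[ℝ] V3 × V3 →L[ℝ] ℝ :=
  (LinearMap.mk₂ ℝ kap kap_add_left kap_smul_left kap_add_right
    kap_smul_right).toContinuousBilinearMap

theorem gamL_apply (x y : V3 × V3) : gamL x y = gam x y := rfl

theorem kapL_apply (x y : V3 × V3) : kapL x y = kap x y := rfl

theorem tri_swap_left (x y z : V3 × V3) : tri y x z = -tri x y z := by
  simp only [tri, kap, gam, cross_apply, Matrix.vec3_dotProduct, Pi.add_apply, Pi.sub_apply,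
    Pi.smul_apply, smul_eq_mul, Matrix.cons_val]
  ring

theorem tri_swap_right (x y z : V3 × V3) : tri x z y = -tri x y z := by
  simp only [tri]
  rw [kap_comm (gam x z), kap_comm z]
  ring

section Derivative

variable {E : Type*} [NormedAddCommGroup E] [NormedSpace ℝ E]

theorem differentiableAt_gam {f h : E → V3 × V3} {x : E} (hf : DifferentiableAt ℝ f x)
    (hh : DifferentiableAt ℝ h x) : DifferentiableAt ℝ (fun y => gam (f y) (h y)) x :=
  (gamL.hasFDerivAt_of_bilinear hf.hasFDerivAt hh.hasFDerivAt).differentiableAt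

theorem differentiableAt_kap {f h : E → V3 × V3} {x : E} (hf : DifferentiableAt ℝ f x)
    (hh : DifferentiableAt ℝ h x) : DifferentiableAt ℝ (fun y => kap (f y) (h y)) x :=
  (kapL.hasFDerivAt_of_bilinear hf.hasFDerivAt hh.hasFDerivAt).differentiableAt

theorem fderiv_gam {f h : E → V3 × V3} {x : E} (hf : DifferentiableAt ℝ f x)
    (hh : DifferentiableAt ℝ h x) (s : E) :
    fderiv ℝ (fun y => gam (f y) (h y)) x s = gam (fderiv ℝ f x s) (h x)
      + gam (f x) (fderiv ℝ h x s) := by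
  have := gamL.fderiv_of_bilinear hf hh
  simp only [gamL_apply] at this
  rw [this, add_comm]
  simp [gamL_apply]

theorem fderiv_kap {f h : E → V3 × V3} {x : E} (hf : DifferentiableAt ℝ f x)
    (hh : DifferentiableAt ℝ h x) (s : E) :
    fderiv ℝ (fun y => kap (f y) (h y)) x s = kap (fderiv ℝ f x s) (h x)
      + kap (f x) (fderiv ℝ h x s) := by
  have := kapL.fderiv_of_bilinear hf hh
  simp only [kapL_apply] at this
  rw [this, add_comm]
  simp [kapL_apply]

theorem differentiableAt_tri {f h k : E → V3 × V3} {x : E} (hf : DifferentiableAt ℝ f x)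
    (hh : DifferentiableAt ℝ h x) (hk : DifferentiableAt ℝ k x) :
    DifferentiableAt ℝ (fun y => tri (f y) (h y) (k y)) x :=
  (differentiableAt_kap (differentiableAt_gam hf hh) hk).add
    (differentiableAt_kap hh (differentiableAt_gam hf hk))

theorem fderiv_tri {f h k : E → V3 × V3} {x : E} (hf : DifferentiableAt ℝ f x)
    (hh : DifferentiableAt ℝ h x) (hk : DifferentiableAt ℝ k x) (s : E) :
    fderiv ℝ (fun y => tri (f y) (h y) (k y)) x s = tri (fderiv ℝ f x s) (h x) (k x)
      + tri (f x) (fderiv ℝ h x s) (k x) + tri (f x) (h x) (fderiv ℝ k x s) := by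
  unfold tri
  rw [fderiv_fun_add (differentiableAt_kap (differentiableAt_gam hf hh) hk)
    (differentiableAt_kap hh (differentiableAt_gam hf hk)), add_apply,
    fderiv_kap (differentiableAt_gam hf hh) hk, fderiv_kap hh (differentiableAt_gam hf hk),
    fderiv_gam hf hh, fderiv_gam hf hk]
  simp only [kap_add_left, kap_add_right]
  ring

end Derivative

/-! ### Lagrangian immersions in the left trivialization -/

/-- The covariant derivative `∇̃_u ζ(v)` in the left trivialization, where `ζ` is the trivialized
differential of a map to `S³ × S³`. -/
def Zc (ζ : E3 → E3 →L[ℝ] V3 × V3) (y u v : E3) : V3 × V3 :=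
  fderiv ℝ ζ y u v + gam (ζ y u) (ζ y v)

/-- The cubic form `√3 / 2 * g (h (u, v), J w)` in the left trivialization. -/
def cub (ζ : E3 → E3 →L[ℝ] V3 × V3) (y u v w : E3) : ℝ := kap (Zc ζ y u v) (ζ y w)

/-- `ζ` is near `x` the trivialized differential of a Lagrangian immersion: it satisfies the
Maurer-Cartan equation and annihilates the fundamental form. -/
structure IsLagrangianForm (ζ : E3 → E3 →L[ℝ] V3 × V3) (x : E3) : Prop where
  smooth : ∀ᶠ y in 𝓝 x, ContDiffAt ℝ ∞ ζ y
  mc : ∀ᶠ y in 𝓝 x, ∀ u v, Zc ζ y u v = Zc ζ y v u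
  lag : ∀ᶠ y in 𝓝 x, ∀ u v, kap (ζ y u) (ζ y v) = 0

variable {ζ : E3 → E3 →L[ℝ] V3 × V3} {x : E3}

theorem differentiableAt_clm_apply {y : E3} (h : DifferentiableAt ℝ ζ y) (v : E3) :
    DifferentiableAt ℝ (fun y => ζ y v) y := h.clm_apply (differentiableAt_const v)

theorem fderiv_clm_apply_const {y : E3} (h : DifferentiableAt ℝ ζ y) (s v : E3) :
    fderiv ℝ (fun y => ζ y v) y s = fderiv ℝ ζ y s v := by
  rw [fderiv_clm_apply h (differentiableAt_const v)]
  simp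

namespace IsLagrangianForm

theorem eventually_contDiffAt (h : IsLagrangianForm ζ x) : ∀ᶠ y in 𝓝 x, ContDiffAt ℝ 2 ζ y :=
  h.smooth.mono fun _ hy => hy.of_le (by norm_cast)

theorem eventually_differentiableAt (h : IsLagrangianForm ζ x) :
    ∀ᶠ y in 𝓝 x, DifferentiableAt ℝ ζ y :=
  h.eventually_contDiffAt.mono fun _ hy => hy.differentiableAt (by norm_num)

theorem differentiableAt_fderiv {y : E3} (h : ContDiffAt ℝ 2 ζ y) :
    DifferentiableAt ℝ (fderiv ℝ ζ) y :=
  (h.fderiv_right (m := 1) (by norm_num)).differentiableAt (by norm_num)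

/-- Differentiating `kap (ζ v) (ζ w) = 0` along `u` shows that `tri` measures the failure of the
cubic form to be symmetric in its last two slots. It is symmetric in the first two by Maurer-Cartan,
so the cyclic sum of these equations has left side 0, while the alternating `tri` contributes three
equal terms. -/
theorem eventually_tri_eq_zero (h : IsLagrangianForm ζ x) :
    ∀ᶠ y in 𝓝 x, (∀ u v w, tri (ζ y u) (ζ y v) (ζ y w) = 0) ∧
      (∀ u v w, cub ζ y u v w = cub ζ y v u w) ∧ ∀ u v w, cub ζ y u v w = cub ζ y u w v := by
  filter_upwards [h.mc, h.lag.eventually_nhds, h.eventually_differentiableAt] with y h1 h2 h3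
  have s1 : ∀ u v w, cub ζ y u v w = cub ζ y v u w := fun u v w => by rw [cub, h1, cub]
  have s2 : ∀ u v w, cub ζ y u v w - cub ζ y u w v = tri (ζ y u) (ζ y v) (ζ y w) := by
    intro u v w
    have e : (fun y => kap (ζ y v) (ζ y w)) =ᶠ[𝓝 y] fun _ => (0 : ℝ) := h2.mono fun z hz => hz v w
    have e2 := fderiv_kap (differentiableAt_clm_apply h3 v) (differentiableAt_clm_apply h3 w) u
    rw [e.fderiv_eq, fderiv_clm_apply_const h3, fderiv_clm_apply_const h3] at e2
    simp only [fderiv_fun_const, Pi.zero_apply, zero_apply] at e2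
    simp only [cub, Zc, kap_add_left, tri]
    rw [kap_comm (fderiv ℝ ζ y u w), kap_comm (gam (ζ y u) (ζ y w))]
    linear_combination -e2
  have s3 : ∀ u v w, tri (ζ y u) (ζ y v) (ζ y w) = 0 := by
    intro u v w
    have a1 := s2 u v w
    have a2 := s2 v w u
    have a3 := s2 w u v
    have c1 : tri (ζ y v) (ζ y w) (ζ y u) = tri (ζ y u) (ζ y v) (ζ y w) := by
      rw [tri_swap_right, tri_swap_left, neg_neg]
    have c2 : tri (ζ y w) (ζ y u) (ζ y v) = tri (ζ y u) (ζ y v) (ζ y w) := by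
      rw [tri_swap_left, tri_swap_right, neg_neg]
    rw [c1] at a2
    rw [c2] at a3
    have b1 := s1 u v w
    have b2 := s1 v w u
    have b3 := s1 u w v
    linarith
  exact ⟨s3, s1, fun u v w => by linarith [s2 u v w, s3 u v w]⟩

theorem differentiableAt_Zc {y : E3} (h : ContDiffAt ℝ 2 ζ y) (u v : E3) :
    DifferentiableAt ℝ (fun y => Zc ζ y u v) y :=
  (((differentiableAt_fderiv h).clm_apply (differentiableAt_const u)).clm_apply
    (differentiableAt_const v)).add (differentiableAt_gam
      (differentiableAt_clm_apply (h.differentiableAt (by norm_num)) u)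
      (differentiableAt_clm_apply (h.differentiableAt (by norm_num)) v))

theorem differentiableAt_cub {y : E3} (h : ContDiffAt ℝ 2 ζ y) (u v w : E3) :
    DifferentiableAt ℝ (fun y => cub ζ y u v w) y :=
  differentiableAt_kap (differentiableAt_Zc h u v)
    (differentiableAt_clm_apply (h.differentiableAt (by norm_num)) w)

theorem fderiv_fderiv_apply {y : E3} (h : ContDiffAt ℝ 2 ζ y) (s u v : E3) :
    fderiv ℝ (fun y => fderiv ℝ ζ y u v) y s = fderiv ℝ (fderiv ℝ ζ) y s u v := by
  have h1 := differentiableAt_fderiv h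
  rw [fderiv_clm_apply (h1.clm_apply (differentiableAt_const u)) (differentiableAt_const v),
    fderiv_clm_apply h1 (differentiableAt_const u)]
  simp

theorem fderiv_cub {y : E3} (h : ContDiffAt ℝ 2 ζ y) (s u v w : E3) :
    fderiv ℝ (fun y => cub ζ y u v w) y s =
      kap (fderiv ℝ (fderiv ℝ ζ) y s u v + gam (fderiv ℝ ζ y s u) (ζ y v)
        + gam (ζ y u) (fderiv ℝ ζ y s v)) (ζ y w) + kap (Zc ζ y u v) (fderiv ℝ ζ y s w) := by
  have h1 := differentiableAt_fderiv h
  have h0 : DifferentiableAt ℝ ζ y := h.differentiableAt (by norm_num)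
  have hu := differentiableAt_clm_apply h0 u
  have hv := differentiableAt_clm_apply h0 v
  unfold cub
  rw [fderiv_kap (differentiableAt_Zc h u v) (differentiableAt_clm_apply h0 w),
    fderiv_clm_apply_const h0]
  congr 2
  unfold Zc
  rw [fderiv_fun_add ((h1.clm_apply (differentiableAt_const u)).clm_apply
    (differentiableAt_const v)) (differentiableAt_gam hu hv), add_apply,
    fderiv_gam hu hv, fderiv_fderiv_apply h, fderiv_clm_apply_const h0, fderiv_clm_apply_const h0,
    add_assoc]

theorem fderiv_tri_eq_zero (h : IsLagrangianForm ζ x) (s u v w : E3) :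
    tri (fderiv ℝ ζ x s u) (ζ x v) (ζ x w) + tri (ζ x u) (fderiv ℝ ζ x s v) (ζ x w)
      + tri (ζ x u) (ζ x v) (fderiv ℝ ζ x s w) = 0 := by
  have h0 := h.eventually_differentiableAt.self_of_nhds
  have e : (fun y => tri (ζ y u) (ζ y v) (ζ y w)) =ᶠ[𝓝 x] fun _ => (0 : ℝ) :=
    h.eventually_tri_eq_zero.mono fun z hz => hz.1 u v w
  have e2 := fderiv_tri (differentiableAt_clm_apply h0 u) (differentiableAt_clm_apply h0 v)
    (differentiableAt_clm_apply h0 w) s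
  rw [e.fderiv_eq, fderiv_clm_apply_const h0, fderiv_clm_apply_const h0,
    fderiv_clm_apply_const h0] at e2
  simpa using e2.symm

theorem eventually_self (h : IsLagrangianForm ζ x) : ∀ᶠ y in 𝓝 x, IsLagrangianForm ζ y := by
  filter_upwards [h.smooth.eventually_nhds, h.mc.eventually_nhds, h.lag.eventually_nhds] with y a b c
  exact ⟨a, b, c⟩

/-- The source of the trace identity for the covariant derivative of the cubic form, as the first
derivative of `tri = 0` is the source of trace freeness of the cubic form itself. -/
theorem fderiv_fderiv_tri_eq_zero (h : IsLagrangianForm ζ x) (s u v w : E3) :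
    tri (fderiv ℝ (fderiv ℝ ζ) x s s u) (ζ x v) (ζ x w)
      + tri (ζ x u) (fderiv ℝ (fderiv ℝ ζ) x s s v) (ζ x w)
      + tri (ζ x u) (ζ x v) (fderiv ℝ (fderiv ℝ ζ) x s s w)
      + 2 * (tri (ζ x u) (fderiv ℝ ζ x s v) (fderiv ℝ ζ x s w)
        + tri (fderiv ℝ ζ x s u) (fderiv ℝ ζ x s v) (ζ x w)
        + tri (fderiv ℝ ζ x s u) (ζ x v) (fderiv ℝ ζ x s w)) = 0 := by
  have h2 := h.eventually_contDiffAt.self_of_nhds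
  have h0 := h.eventually_differentiableAt.self_of_nhds
  have e : (fun y => tri (fderiv ℝ ζ y s u) (ζ y v) (ζ y w)
      + tri (ζ y u) (fderiv ℝ ζ y s v) (ζ y w)
      + tri (ζ y u) (ζ y v) (fderiv ℝ ζ y s w)) =ᶠ[𝓝 x] fun _ => (0 : ℝ) :=
    h.eventually_self.mono fun z hz => hz.fderiv_tri_eq_zero s u v w
  have hz := fun u => differentiableAt_clm_apply h0 u
  have hd : ∀ u, DifferentiableAt ℝ (fun y => fderiv ℝ ζ y s u) x := fun u =>
    ((differentiableAt_fderiv h2).clm_apply (differentiableAt_const s)).clm_apply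
      (differentiableAt_const u)
  have e2 : fderiv ℝ (fun y => tri (fderiv ℝ ζ y s u) (ζ y v) (ζ y w)
      + tri (ζ y u) (fderiv ℝ ζ y s v) (ζ y w)
      + tri (ζ y u) (ζ y v) (fderiv ℝ ζ y s w)) x s = 0 := by
    rw [e.fderiv_eq]; simp
  have d12 : DifferentiableAt ℝ (fun y => tri (fderiv ℝ ζ y s u) (ζ y v) (ζ y w)
      + tri (ζ y u) (fderiv ℝ ζ y s v) (ζ y w)) x :=
    (differentiableAt_tri (hd u) (hz v) (hz w)).add (differentiableAt_tri (hz u) (hd v) (hz w))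
  rw [fderiv_fun_add d12 (differentiableAt_tri (hz u) (hz v) (hd w)),
    fderiv_fun_add (differentiableAt_tri (hd u) (hz v) (hz w))
      (differentiableAt_tri (hz u) (hd v) (hz w)), add_apply,
    add_apply, fderiv_tri (hd u) (hz v) (hz w),
    fderiv_tri (hz u) (hd v) (hz w), fderiv_tri (hz u) (hz v) (hd w)] at e2
  simp only [fderiv_fderiv_apply h2, fderiv_clm_apply_const h0] at e2
  linear_combination e2

end IsLagrangianForm

end NearlyKahler

end

/-! ### The covariant derivative of the cubic form: Codazzi equation and trace identity. -/

noncomputable section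

namespace NearlyKahler

open Filter Topology

/-- The covariant derivative of the cubic form, with respect to the orthonormal frame `e`. -/
def nabC (ζ : E3 → E3 →L[ℝ] V3 × V3) (x : E3) (e : Fin 3 → E3) (s u v w : E3) : ℝ :=
  fderiv ℝ (fun y => cub ζ y u v w) x s
    - ∑ k, (gV (Zc ζ x s u) (ζ x (e k)) * cub ζ x (e k) v w
      + gV (Zc ζ x s v) (ζ x (e k)) * cub ζ x (e k) u w
      + gV (Zc ζ x s w) (ζ x (e k)) * cub ζ x (e k) u v)

variable {ζ : E3 → E3 →L[ℝ] V3 × V3} {x : E3}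

/-- Expansion of a vector in a diagonal unitary frame. -/
theorem eq_expansion {a b : V3} (hN : ∀ k, 4 / 3 * (a k ^ 2 + b k ^ 2 - a k * b k) = 1)
    {z : Fin 3 → V3 × V3} (hz : ∀ k, z k = (Pi.single k (a k), Pi.single k (b k)))
    (Z : V3 × V3) :
    Z = (fun k => gV Z (z k) * a k + 2 / 3 * kap Z (z k) * (2 * b k - a k),
      fun k => gV Z (z k) * b k + 2 / 3 * kap Z (z k) * (b k - 2 * a k)) := by
  ext k
  · simp only [hz, gV, kap, dotProduct_single, single_dotProduct]
    linear_combination (-Z.1 k) * hN k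
  · simp only [hz, gV, kap, dotProduct_single, single_dotProduct]
    linear_combination (-Z.2 k) * hN k

theorem diagonal_frame_eq {a b : V3} {z : Fin 3 → V3 × V3}
    (hz : ∀ k, z k = (Pi.single k (a k), Pi.single k (b k))) :
    z 0 = (![a 0, 0, 0], ![b 0, 0, 0]) ∧ z 1 = (![0, a 1, 0], ![0, b 1, 0]) ∧
      z 2 = (![0, 0, a 2], ![0, 0, b 2]) := by
  refine ⟨?_, ?_, ?_⟩ <;> rw [hz] <;> ext i <;> fin_cases i <;> simp

namespace IsLagrangianForm

/-- The cubic form is trace free. -/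
theorem trace_cub (h : IsLagrangianForm ζ x) {e : Fin 3 → E3} {a b : V3} {ρ : ℝ} (hρ : ρ ≠ 0)
    (hz : ∀ k, ζ x (e k) = (Pi.single k (a k), Pi.single k (b k)))
    (ht : ∀ ξ, tri ξ (ζ x (e 1)) (ζ x (e 2)) = -(2 / 3) * ρ * kap ξ (ζ x (e 0)) ∧
      tri (ζ x (e 0)) ξ (ζ x (e 2)) = -(2 / 3) * ρ * kap ξ (ζ x (e 1)) ∧
      tri (ζ x (e 0)) (ζ x (e 1)) ξ = -(2 / 3) * ρ * kap ξ (ζ x (e 2))) (s : E3) :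
    cub ζ x s (e 0) (e 0) + cub ζ x s (e 1) (e 1) + cub ζ x s (e 2) (e 2) = 0 := by
  have h1 := h.fderiv_tri_eq_zero s (e 0) (e 1) (e 2)
  rw [(ht _).1, (ht _).2.1, (ht _).2.2] at h1
  -- Both components of a frame vector lie on the `k`-th axis, and every term of `gam _ (ζ x (e k))`
  -- is a cross product with that axis, hence orthogonal to it.
  have key : ∀ k, cub ζ x s (e k) (e k) = kap (fderiv ℝ ζ x s (e k)) (ζ x (e k)) := by
    intro k
    have : kap (gam (ζ x s) (ζ x (e k))) (ζ x (e k)) = 0 := by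
      rw [hz]
      simp only [kap, gam, dotProduct_single]
      fin_cases k <;> simp [cross_apply]
    rw [cub, Zc, kap_add_left, this, add_zero]
  rw [key, key, key]
  refine (mul_eq_zero_iff_left (a := -(2 / 3) * ρ) (by simpa using hρ)).1 ?_
  linear_combination h1

/-- The two identities that hold without isotropy. The first summand on the right of the Codazzi
equation is, in terms of the angles, a multiple of `sin 2(θ₁ - θ₀)`. -/
theorem nabC_diagonal (h : IsLagrangianForm ζ x) {e : Fin 3 → E3} {a b : V3} {ρ : ℝ}
    (hN : ∀ k, 4 / 3 * (a k ^ 2 + b k ^ 2 - a k * b k) = 1) (hρ : ρ ^ 2 = 3 / 4)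
    (hz : ∀ k, ζ x (e k) = (Pi.single k (a k), Pi.single k (b k)))
    (ha0 : a 1 * a 2 - a 1 * b 2 - a 2 * b 1 = ρ * a 0)
    (hb0 : b 1 * b 2 - a 1 * b 2 - a 2 * b 1 = ρ * b 0)
    (ha1 : a 2 * a 0 - a 2 * b 0 - a 0 * b 2 = ρ * a 1)
    (hb1 : b 2 * b 0 - a 2 * b 0 - a 0 * b 2 = ρ * b 1)
    (ha2 : a 0 * a 1 - a 0 * b 1 - a 1 * b 0 = ρ * a 2)
    (hb2 : b 0 * b 1 - a 0 * b 1 - a 1 * b 0 = ρ * b 2) :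
    nabC ζ x e (e 0) (e 1) (e 0) (e 1) - nabC ζ x e (e 1) (e 0) (e 0) (e 1) =
      -(2 / 3) * (a 0 * b 1 - b 0 * a 1) * (4 / 3 * (a 0 * a 1 + b 0 * b 1)
      - 2 / 3 * (a 0 * b 1 + b 0 * a 1)) - 2 / 3 * ρ * cub ζ x (e 0) (e 1) (e 2) ∧
    ∑ k, nabC ζ x e (e 0) (e 0) (e k) (e k) = 0 := by
  have hc := h.eventually_contDiffAt.self_of_nhds
  have hmc := h.mc.self_of_nhds
  obtain ⟨-, s1, s2⟩ := h.eventually_tri_eq_zero.self_of_nhds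
  obtain ⟨hz0, hz1, hz2⟩ := diagonal_frame_eq (z := fun k => ζ x (e k)) hz
  have hρ0 : ρ ≠ 0 := by rintro rfl; norm_num at hρ
  have ht := tri_diagonal a b ρ ha0 hb0 ha1 hb1 ha2 hb2 (fun k => ζ x (e k)) hz0 hz1 hz2
  have htr := h.trace_cub hρ0 hz ht
  have hD : ∀ i j, fderiv ℝ ζ x (e i) (e j) = Zc ζ x (e i) (e j) - gam (ζ x (e i)) (ζ x (e j)) :=
    fun i j => by rw [Zc, add_sub_cancel_right]
  have hZ := fun i j => eq_expansion hN (z := fun k => ζ x (e k)) hz (Zc ζ x (e i) (e j))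
  have c : ∀ j : Fin 3, cub ζ x (e 1) (e 0) (e j) = cub ζ x (e 0) (e 1) (e j) ∧
      cub ζ x (e 2) (e 0) (e j) = cub ζ x (e 0) (e 2) (e j) ∧
      cub ζ x (e 2) (e 1) (e j) = cub ζ x (e 1) (e 2) (e j) ∧
      cub ζ x (e j) (e 1) (e 0) = cub ζ x (e j) (e 0) (e 1) ∧
      cub ζ x (e j) (e 2) (e 0) = cub ζ x (e j) (e 0) (e 2) ∧
      cub ζ x (e j) (e 2) (e 1) = cub ζ x (e j) (e 1) (e 2) := fun j =>
    ⟨s1 _ _ _, s1 _ _ _, s1 _ _ _, s2 _ _ _, s2 _ _ _, s2 _ _ _⟩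
  simp only [forall_and] at c
  obtain ⟨c1, c2, c3, c4, c5, c6⟩ := c
  constructor
  · have main := codazzi_diagonal a b ρ hN ha2 hb2 (fun k => ζ x (e k)) hz0 hz1
      (fun i j k => gV (Zc ζ x (e i) (e j)) (ζ x (e k))) (fun i j k => cub ζ x (e i) (e j) (e k))
      (fun i j k => by rw [hmc]) (fun i j k => s1 _ _ _) (fun i j k => s2 _ _ _)
      (fun i j => Zc ζ x (e i) (e j)) hZ
    rw [← main]
    have hsym : fderiv ℝ (fderiv ℝ ζ) x (e 0) (e 1) = fderiv ℝ (fderiv ℝ ζ) x (e 1) (e 0) :=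
      hc.isSymmSndFDerivAt (by simp) (e 0) (e 1)
    simp only [nabC, fderiv_cub hc, hD, hsym, kap_add_left, Fin.sum_univ_three, hmc (e 1) (e 0)]
    simp only [c1, c2, c3, c4, c5, c6]
    ring
  · have main := trace_diagonal a b ρ hN hρ ha2 hb2 (fun k => ζ x (e k)) hz0 hz1 hz2 ht
      (fun j k => gV (Zc ζ x (e 0) (e j)) (ζ x (e k))) (fun j k => cub ζ x (e 0) (e j) (e k))
      (fun j k => s2 _ _ _) (htr _) (fun j => Zc ζ x (e 0) (e j))
      (fun j => fderiv ℝ ζ x (e 0) (e j)) (fun j => fderiv ℝ (fderiv ℝ ζ) x (e 0) (e 0) (e j))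
      (fun j => hZ 0 j) (fun j => hD 0 j)
      (h.fderiv_fderiv_tri_eq_zero (e 0) (e 0) (e 1) (e 2))
    simp only [Fin.sum_univ_three] at main
    simp only [nabC, fderiv_cub hc, Fin.sum_univ_three]
    have e1 := htr (e 0)
    have e2 := htr (e 1)
    have e3 := htr (e 2)
    simp only [c1, c2, c3, c4, c5, c6] at main e1 e2 e3 ⊢
    -- The connection terms in the untraced slot multiply traces of the cubic form, which vanish.
    linear_combination main - gV (Zc ζ x (e 0) (e 0)) (ζ x (e 0)) * e1
      - gV (Zc ζ x (e 0) (e 0)) (ζ x (e 1)) * e2 - gV (Zc ζ x (e 0) (e 0)) (ζ x (e 2)) * e3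

end IsLagrangianForm

end NearlyKahler

end

/-! ### Multilinearity, symmetries and polarization of the covariant derivative of the cubic form.
-/

noncomputable section

namespace NearlyKahler

open Filter Topology

theorem gV_add_left (x x' y : V3 × V3) : gV (x + x') y = gV x y + gV x' y := by
  simp only [gV, Prod.fst_add, Prod.snd_add, add_dotProduct, dotProduct_add]; ring

theorem gV_smul_left (c : ℝ) (x y : V3 × V3) : gV (c • x) y = c * gV x y := by
  simp only [gV, Prod.smul_fst, Prod.smul_snd, smul_dotProduct, dotProduct_smul, smul_eq_mul]; ring

theorem gV_comm (x y : V3 × V3) : gV x y = gV y x := by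
  rw [gV, gV, dotProduct_comm x.1 y.1, dotProduct_comm x.2 y.2]; ring

theorem gV_self_pos {x : V3 × V3} (hx : x ≠ 0) : 0 < gV x x := by
  have h1 : 0 ≤ x.1 ⬝ᵥ x.1 := by simpa using dotProduct_star_self_nonneg x.1
  have h2 : 0 ≤ x.2 ⬝ᵥ x.2 := by simpa using dotProduct_star_self_nonneg x.2
  have h3 : 0 ≤ (x.1 - x.2) ⬝ᵥ (x.1 - x.2) := by
    simpa using dotProduct_star_self_nonneg (x.1 - x.2)
  have e : gV x x = 2 / 3 * (x.1 ⬝ᵥ x.1) + 2 / 3 * (x.2 ⬝ᵥ x.2)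
      + 2 / 3 * ((x.1 - x.2) ⬝ᵥ (x.1 - x.2)) := by
    simp only [gV, sub_dotProduct, dotProduct_sub, dotProduct_comm x.2 x.1]; ring
  rw [e]
  by_contra! hn
  have h4 : x.1 ⬝ᵥ x.1 = 0 := by linarith
  have h5 : x.2 ⬝ᵥ x.2 = 0 := by linarith
  exact hx (Prod.ext (dotProduct_self_eq_zero.1 h4) (dotProduct_self_eq_zero.1 h5))

variable {ζ : E3 → E3 →L[ℝ] V3 × V3} {x : E3}

theorem Zc_add_smul_left (y u u' v : E3) (c : ℝ) :
    Zc ζ y (u + c • u') v = Zc ζ y u v + c • Zc ζ y u' v := by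
  simp only [Zc, map_add, map_smul, add_apply, smul_apply, gam_add_left, gam_smul_left, smul_add]
  abel

theorem cub_add_smul_left (y u u' v w : E3) (c : ℝ) :
    cub ζ y (u + c • u') v w = cub ζ y u v w + c * cub ζ y u' v w := by
  rw [cub, Zc_add_smul_left, kap_add_left, kap_smul_left, cub, cub]

theorem nabC_add_smul_left (e : Fin 3 → E3) (s s' u v w : E3) (c : ℝ) :
    nabC ζ x e (s + c • s') u v w = nabC ζ x e s u v w + c * nabC ζ x e s' u v w := by
  simp only [nabC, Zc_add_smul_left, map_add, map_smul, gV_add_left, gV_smul_left, smul_eq_mul,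
    Fin.sum_univ_three]
  ring

namespace IsLagrangianForm

theorem nabC_add_smul (h : IsLagrangianForm ζ x) (e : Fin 3 → E3) (s u u' v w : E3) (c : ℝ) :
    nabC ζ x e s (u + c • u') v w = nabC ζ x e s u v w + c * nabC ζ x e s u' v w := by
  have hc := h.eventually_contDiffAt.self_of_nhds
  have hd := differentiableAt_cub hc
  obtain ⟨-, s1, s2⟩ := h.eventually_tri_eq_zero.self_of_nhds
  have e1 : fderiv ℝ (fun y => cub ζ y (u + c • u') v w) x s =
      fderiv ℝ (fun y => cub ζ y u v w) x s + c * fderiv ℝ (fun y => cub ζ y u' v w) x s := by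
    simp only [cub_add_smul_left]
    rw [fderiv_fun_add (hd u v w) ((hd u' v w).const_mul c), fderiv_const_mul (hd u' v w)]
    simp
  have e2 : ∀ k r, cub ζ x k (u + c • u') r = cub ζ x k u r + c * cub ζ x k u' r := by
    intro k r
    rw [s1, cub_add_smul_left, s1, s1 u']
  have e3 : ∀ s, Zc ζ x s (u + c • u') = Zc ζ x s u + c • Zc ζ x s u' := by
    intro s
    rw [h.mc.self_of_nhds, Zc_add_smul_left, h.mc.self_of_nhds, h.mc.self_of_nhds u']
  simp only [nabC, e1, e2, e3, gV_add_left, gV_smul_left, Fin.sum_univ_three]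
  ring

theorem nabC_swap_left (h : IsLagrangianForm ζ x) (e : Fin 3 → E3) (s u v w : E3) :
    nabC ζ x e s u v w = nabC ζ x e s v u w := by
  have hev := h.eventually_tri_eq_zero
  have e1 : (fun y => cub ζ y u v w) =ᶠ[𝓝 x] fun y => cub ζ y v u w :=
    hev.mono fun y hy => hy.2.1 u v w
  have s2 := hev.self_of_nhds.2.2
  simp only [nabC, e1.fderiv_eq, Fin.sum_univ_three, s2 _ u v]
  ring

theorem nabC_swap_right (h : IsLagrangianForm ζ x) (e : Fin 3 → E3) (s u v w : E3) :
    nabC ζ x e s u v w = nabC ζ x e s u w v := by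
  have hev := h.eventually_tri_eq_zero
  have e1 : (fun y => cub ζ y u v w) =ᶠ[𝓝 x] fun y => cub ζ y u w v :=
    hev.mono fun y hy => hy.2.2 u v w
  have s2 := hev.self_of_nhds.2.2
  simp only [nabC, e1.fderiv_eq, Fin.sum_univ_three, s2 _ v w]
  ring

/-- Polarization of the isotropy condition on the covariant derivative of the cubic form. -/
theorem nabC_polarize (h : IsLagrangianForm ζ x) {e : Fin 3 → E3} {lam : ℝ} {G : E3 → ℝ}
    (hiso : ∀ v, nabC ζ x e v v v v = lam * G v ^ 2) {u v : E3} (h1 : G u = 1) (h2 : G v = 1)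
    (h3 : G (u + (1 : ℝ) • v) = 2) (h4 : G (u + (-1 : ℝ) • v) = 2) :
    nabC ζ x e u u v v + nabC ζ x e v u u v = 2 / 3 * lam := by
  have a1 := h.nabC_add_smul e
  have a2 : ∀ s u u' v w c, nabC ζ x e s v (u + c • u') w =
      nabC ζ x e s v u w + c * nabC ζ x e s v u' w := fun s u u' v w c => by
    rw [h.nabC_swap_left, a1, h.nabC_swap_left, h.nabC_swap_left _ _ u']
  have a3 : ∀ s u u' v w c, nabC ζ x e s v w (u + c • u') =
      nabC ζ x e s v w u + c * nabC ζ x e s v w u' := fun s u u' v w c => by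
    rw [h.nabC_swap_right, a2, h.nabC_swap_right, h.nabC_swap_right _ _ _ u']
  have b1 := hiso (u + (1 : ℝ) • v)
  have b2 := hiso (u + (-1 : ℝ) • v)
  have b3 := hiso u
  have b4 := hiso v
  have c1 : ∀ s, nabC ζ x e s v u u = nabC ζ x e s u u v := fun s => by
    rw [h.nabC_swap_left, h.nabC_swap_right]
  have c2 : ∀ s, nabC ζ x e s v v u = nabC ζ x e s u v v := fun s => by
    rw [h.nabC_swap_right, h.nabC_swap_left]
  have c3 : ∀ s, nabC ζ x e s u v u = nabC ζ x e s u u v := fun s => by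
    rw [h.nabC_swap_right]
  have c4 : ∀ s, nabC ζ x e s v u v = nabC ζ x e s u v v := fun s => by
    rw [h.nabC_swap_left]
  simp only [nabC_add_smul_left, a1, a2, a3, c1, c2, c3, c4, h3, h4, h1, h2] at b1 b2 b3 b4
  -- Adding the quartic condition at `u + v` and `u - v` keeps the even part: twice the values at
  -- `u` and `v` plus six times the wanted sum equals `8 * lam`, since both vectors have square norm
  -- 2.
  linear_combination 1 / 6 * b1 + 1 / 6 * b2 - 1 / 3 * b3 - 1 / 3 * b4

end IsLagrangianForm

/-! ### Invariance under rotations -/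

theorem Zc_comp (O : V3 × V3 →L[ℝ] V3 × V3) (hO : ∀ x y, gam (O x) (O y) = O (gam x y)) {y : E3}
    (hd : DifferentiableAt ℝ ζ y) (u v : E3) :
    Zc (fun y => O.comp (ζ y)) y u v = O (Zc ζ y u v) := by
  have : fderiv ℝ (fun y => O.comp (ζ y)) y u v = O (fderiv ℝ ζ y u v) := by
    rw [fderiv_clm_comp (differentiableAt_const O) hd]
    simp
  simp only [Zc, this, ContinuousLinearMap.comp_apply, hO, map_add]

theorem cub_comp (O : V3 × V3 →L[ℝ] V3 × V3) (hO : ∀ x y, gam (O x) (O y) = O (gam x y))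
    (hk : ∀ x y, kap (O x) (O y) = kap x y) {y : E3} (hd : DifferentiableAt ℝ ζ y) (u v w : E3) :
    cub (fun y => O.comp (ζ y)) y u v w = cub ζ y u v w := by
  simp only [cub, Zc_comp O hO hd, ContinuousLinearMap.comp_apply, hk]

namespace IsLagrangianForm

theorem comp (h : IsLagrangianForm ζ x) (O : V3 × V3 →L[ℝ] V3 × V3)
    (hO : ∀ x y, gam (O x) (O y) = O (gam x y)) (hk : ∀ x y, kap (O x) (O y) = kap x y) :
    IsLagrangianForm (fun y => O.comp (ζ y)) x where
  smooth := h.smooth.mono fun y hy => contDiffAt_const.clm_comp hy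
  mc := by
    filter_upwards [h.mc, h.eventually_differentiableAt] with y h1 h2 u v
    rw [Zc_comp O hO h2, h1, Zc_comp O hO h2]
  lag := by
    filter_upwards [h.lag] with y h1 u v
    simp only [ContinuousLinearMap.comp_apply, hk, h1]

theorem nabC_comp (h : IsLagrangianForm ζ x) (O : V3 × V3 →L[ℝ] V3 × V3)
    (hO : ∀ x y, gam (O x) (O y) = O (gam x y)) (hk : ∀ x y, kap (O x) (O y) = kap x y)
    (hg : ∀ x y, gV (O x) (O y) = gV x y) (e : Fin 3 → E3) (s u v w : E3) :
    nabC (fun y => O.comp (ζ y)) x e s u v w = nabC ζ x e s u v w := by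
  have h0 := h.eventually_differentiableAt
  have e1 : (fun y => cub (fun y => O.comp (ζ y)) y u v w) =ᶠ[𝓝 x] fun y => cub ζ y u v w :=
    h0.mono fun y hy => cub_comp O hO hk hy u v w
  simp only [nabC, e1.fderiv_eq, cub_comp O hO hk h0.self_of_nhds, Zc_comp O hO h0.self_of_nhds,
    ContinuousLinearMap.comp_apply, hg]

end IsLagrangianForm

/-- An oriented orthonormal frame of `ℝ³`. -/
structure IsFrame (n : Fin 3 → V3) : Prop where
  dot : ∀ i j, n i ⬝ᵥ n j = if i = j then 1 else 0
  cross : crossProduct (n 0) (n 1) = n 2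

namespace IsFrame

variable {n : Fin 3 → V3}

theorem cross12 (h : IsFrame n) : crossProduct (n 1) (n 2) = n 0 := by
  rw [← h.cross, cross_cross_eq_smul_sub_smul', h.dot, h.dot]
  simp

theorem cross20 (h : IsFrame n) : crossProduct (n 2) (n 0) = n 1 := by
  rw [← h.cross, cross_cross_eq_smul_sub_smul, h.dot, h.dot]
  simp

theorem cyclic (h : IsFrame n) : IsFrame ![n 1, n 2, n 0] where
  dot i j := by fin_cases i <;> fin_cases j <;> simp [h.dot]
  cross := by simpa using h.cross12

/-- The coordinates with respect to a frame. -/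
def coord (n : Fin 3 → V3) : V3 × V3 →L[ℝ] V3 × V3 :=
  LinearMap.toContinuousLinearMap
    ((Matrix.mulVecLin (Matrix.of n)).prodMap (Matrix.mulVecLin (Matrix.of n)))

theorem coord_apply (n : Fin 3 → V3) (x : V3 × V3) :
    coord n x = (fun k => n k ⬝ᵥ x.1, fun k => n k ⬝ᵥ x.2) := rfl

theorem sum_dot_mul_dot (h : IsFrame n) (u v : V3) :
    (fun k => n k ⬝ᵥ u) ⬝ᵥ (fun k => n k ⬝ᵥ v) = u ⬝ᵥ v := by
  have h1 : Matrix.of n * (Matrix.of n).transpose = 1 := by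
    ext i j
    simpa [Matrix.mul_apply, dotProduct, Matrix.one_apply] using h.dot i j
  have h2 : (Matrix.of n).transpose * Matrix.of n = 1 := mul_eq_one_comm.1 h1
  change (Matrix.of n).mulVec u ⬝ᵥ (Matrix.of n).mulVec v = _
  rw [Matrix.dotProduct_mulVec, Matrix.vecMul_mulVec, h2, Matrix.vecMul_one]

theorem cross_coord (h : IsFrame n) (u v : V3) :
    crossProduct (fun k => n k ⬝ᵥ u) (fun k => n k ⬝ᵥ v) = fun k => n k ⬝ᵥ crossProduct u v := by
  have h0 : n 0 ⬝ᵥ crossProduct u v = n 1 ⬝ᵥ u * n 2 ⬝ᵥ v - n 1 ⬝ᵥ v * n 2 ⬝ᵥ u := by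
    rw [← cross_dot_cross, h.cross12]
  have h1 : n 1 ⬝ᵥ crossProduct u v = n 2 ⬝ᵥ u * n 0 ⬝ᵥ v - n 2 ⬝ᵥ v * n 0 ⬝ᵥ u := by
    rw [← cross_dot_cross, h.cross20]
  have h2 : n 2 ⬝ᵥ crossProduct u v = n 0 ⬝ᵥ u * n 1 ⬝ᵥ v - n 0 ⬝ᵥ v * n 1 ⬝ᵥ u := by
    rw [← cross_dot_cross, h.cross]
  ext k
  fin_cases k
  · simp only [Fin.zero_eta, h0]; simp [cross_apply]; ring
  · simp only [Fin.mk_one, h1]; simp [cross_apply]; ring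
  · simp only [Fin.reduceFinMk, h2]; simp [cross_apply]; ring

/-- Passing to the coordinates of a frame is a rotation acting simultaneously on both components,
hence a symmetry of the whole structure. It reduces adapted frames to the coordinate-diagonal case
treated above. -/
theorem gam_coord (h : IsFrame n) (x y : V3 × V3) :
    gam (coord n x) (coord n y) = coord n (gam x y) := by
  simp only [coord_apply, gam, h.cross_coord]
  ext k <;> simp [dotProduct_add, dotProduct_sub]

theorem kap_coord (h : IsFrame n) (x y : V3 × V3) : kap (coord n x) (coord n y) = kap x y := by
  simp only [coord_apply, kap, h.sum_dot_mul_dot]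

theorem gV_coord (h : IsFrame n) (x y : V3 × V3) : gV (coord n x) (coord n y) = gV x y := by
  simp only [coord_apply, gV, h.sum_dot_mul_dot]

theorem coord_smul (h : IsFrame n) (a b : ℝ) (k : Fin 3) :
    coord n (a • n k, b • n k) = (Pi.single k a, Pi.single k b) := by
  ext i <;> simp [coord_apply, h.dot, Pi.single_apply]

end IsFrame

end NearlyKahler

end

/-! ### Adapted frames and the consequences of isotropy. -/

noncomputable section

namespace NearlyKahler

open Filter Topology

variable {ζ : E3 → E3 →L[ℝ] V3 × V3} {x : E3}

theorem gV_add_smul_self (c : ℝ) (x y : V3 × V3) :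
    gV (x + c • y) (x + c • y) = gV x x + 2 * c * gV x y + c ^ 2 * gV y y := by
  rw [gV_add_left, gV_smul_left, gV_comm x, gV_comm y, gV_add_left, gV_add_left, gV_smul_left,
    gV_smul_left, gV_comm y x]
  ring

/-- At `x` the vectors `e k` form an orthonormal basis and the linear map `ζ x` is diagonal with
respect to `e` and the oriented orthonormal frame `n`. -/
structure IsAdapted (ζ : E3 → E3 →L[ℝ] V3 × V3) (x : E3) (n : Fin 3 → V3) (e : Fin 3 → E3)
    (a b : V3) : Prop where
  frame : IsFrame n
  apply_eq : ∀ k, ζ x (e k) = (a k • n k, b k • n k)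
  norm_eq : ∀ k, 4 / 3 * (a k ^ 2 + b k ^ 2 - a k * b k) = 1

/-- The duality relations between the diagonal entries. -/
theorem exists_duality {a b : V3} (hN : ∀ k, 4 / 3 * (a k ^ 2 + b k ^ 2 - a k * b k) = 1)
    (ht : tri (Pi.single 0 (a 0), Pi.single 0 (b 0)) (Pi.single 1 (a 1), Pi.single 1 (b 1))
      (Pi.single 2 (a 2), Pi.single 2 (b 2)) = 0) :
    ∃ ρ : ℝ, ρ ^ 2 = 3 / 4 ∧
      (a 1 * a 2 - a 1 * b 2 - a 2 * b 1 = ρ * a 0) ∧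
      (b 1 * b 2 - a 1 * b 2 - a 2 * b 1 = ρ * b 0) ∧
      (a 2 * a 0 - a 2 * b 0 - a 0 * b 2 = ρ * a 1) ∧
      (b 2 * b 0 - a 2 * b 0 - a 0 * b 2 = ρ * b 1) ∧
      (a 0 * a 1 - a 0 * b 1 - a 1 * b 0 = ρ * a 2) ∧
      (b 0 * b 1 - a 0 * b 1 - a 1 * b 0 = ρ * b 2) := by
  have ht' : a 2 * (b 0 * b 1 - a 0 * b 1 - a 1 * b 0) =
      b 2 * (a 0 * a 1 - a 0 * b 1 - a 1 * b 0) := by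
    simp [tri, kap, gam, cross_apply] at ht
    linear_combination -3 / 2 * ht
  have h0 := hN 0
  have h1 := hN 1
  have h2 := hN 2
  -- 4/3 times the real part of `z_0 z_1 z_2` with `z_k = a k + ω b k`. By `ht'` the product is
  -- real, and multiplying by the conjugate of `z_k`, where `|z_k|² = 3/4`, isolates the product of
  -- the other two.
  set ρ : ℝ := 4 / 3 * (a 0 * a 1 * a 2 + b 0 * b 1 * b 2 - (a 0 * a 1 * b 2 + a 0 * b 1 * a 2
    + b 0 * a 1 * a 2 + a 0 * b 1 * b 2 + b 0 * a 1 * b 2 + b 0 * b 1 * a 2) / 2) with hρ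
  have e1 : a 0 * a 1 - a 0 * b 1 - a 1 * b 0 = ρ * a 2 := by
    rw [hρ]
    linear_combination -(a 0 * a 1 - a 0 * b 1 - a 1 * b 0) * h2
      - (4 / 3 * b 2 - 2 / 3 * a 2) * ht'
  have e2 : b 0 * b 1 - a 0 * b 1 - a 1 * b 0 = ρ * b 2 := by
    rw [hρ]
    linear_combination -(b 0 * b 1 - a 0 * b 1 - a 1 * b 0) * h2
      + (4 / 3 * a 2 - 2 / 3 * b 2) * ht'
  refine ⟨ρ, ?_, ?_, ?_, ?_, ?_, e1, e2⟩
  -- The norm `a ^ 2 + b ^ 2 - a * b` of the Eisenstein form is multiplicative.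
  · have : (a 0 * a 1 - a 0 * b 1 - a 1 * b 0) ^ 2 + (b 0 * b 1 - a 0 * b 1 - a 1 * b 0) ^ 2
        - (a 0 * a 1 - a 0 * b 1 - a 1 * b 0) * (b 0 * b 1 - a 0 * b 1 - a 1 * b 0) =
        (a 0 ^ 2 + b 0 ^ 2 - a 0 * b 0) * (a 1 ^ 2 + b 1 ^ 2 - a 1 * b 1) := by ring
    rw [e1, e2] at this
    have k0 : a 0 ^ 2 + b 0 ^ 2 - a 0 * b 0 = 3 / 4 := by linarith
    have k1 : a 1 ^ 2 + b 1 ^ 2 - a 1 * b 1 = 3 / 4 := by linarith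
    rw [k0, k1] at this
    linear_combination 4 / 3 * this - ρ ^ 2 * h2
  · rw [hρ]
    linear_combination -(a 1 * a 2 - a 1 * b 2 - a 2 * b 1) * h0
      - (4 / 3 * b 0 - 2 / 3 * a 0) * ht'
  · rw [hρ]
    linear_combination -(b 1 * b 2 - a 1 * b 2 - a 2 * b 1) * h0
      + (4 / 3 * a 0 - 2 / 3 * b 0) * ht'
  · rw [hρ]
    linear_combination -(a 2 * a 0 - a 2 * b 0 - a 0 * b 2) * h1
      - (4 / 3 * b 1 - 2 / 3 * a 1) * ht'
  · rw [hρ]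
    linear_combination -(b 2 * b 0 - a 2 * b 0 - a 0 * b 2) * h1
      + (4 / 3 * a 1 - 2 / 3 * b 1) * ht'

theorem nabC_cyclic (e : Fin 3 → E3) (s u v w : E3) :
    nabC ζ x ![e 1, e 2, e 0] s u v w = nabC ζ x e s u v w := by
  simp only [nabC, Fin.sum_univ_three, Matrix.cons_val]
  ring

namespace IsAdapted

variable {n : Fin 3 → V3} {e : Fin 3 → E3} {a b : V3}

theorem cyclic (h : IsAdapted ζ x n e a b) :
    IsAdapted ζ x ![n 1, n 2, n 0] ![e 1, e 2, e 0] ![a 1, a 2, a 0] ![b 1, b 2, b 0] where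
  frame := h.frame.cyclic
  apply_eq k := by fin_cases k <;> simp [h.apply_eq]
  norm_eq k := by fin_cases k <;> simp [h.norm_eq]

theorem coord_apply_eq (h : IsAdapted ζ x n e a b) (k : Fin 3) :
    (IsFrame.coord n).comp (ζ x) (e k) = (Pi.single k (a k), Pi.single k (b k)) := by
  rw [ContinuousLinearMap.comp_apply, h.apply_eq, h.frame.coord_smul]

theorem duality (h : IsAdapted ζ x n e a b) (hL : IsLagrangianForm ζ x) :
    ∃ ρ : ℝ, ρ ^ 2 = 3 / 4 ∧
      (a 1 * a 2 - a 1 * b 2 - a 2 * b 1 = ρ * a 0) ∧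
      (b 1 * b 2 - a 1 * b 2 - a 2 * b 1 = ρ * b 0) ∧
      (a 2 * a 0 - a 2 * b 0 - a 0 * b 2 = ρ * a 1) ∧
      (b 2 * b 0 - a 2 * b 0 - a 0 * b 2 = ρ * b 1) ∧
      (a 0 * a 1 - a 0 * b 1 - a 1 * b 0 = ρ * a 2) ∧
      (b 0 * b 1 - a 0 * b 1 - a 1 * b 0 = ρ * b 2) := by
  refine exists_duality h.norm_eq ?_
  have := ((hL.comp (IsFrame.coord n) h.frame.gam_coord
    h.frame.kap_coord).eventually_tri_eq_zero.self_of_nhds).1 (e 0) (e 1) (e 2)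
  simpa only [h.coord_apply_eq] using this

theorem gV_apply (h : IsAdapted ζ x n e a b) (i j : Fin 3) :
    gV (ζ x (e i)) (ζ x (e j)) = if i = j then 1 else 0 := by
  rw [h.apply_eq, h.apply_eq]
  simp only [gV, smul_dotProduct, dotProduct_smul, h.frame.dot, smul_eq_mul]
  by_cases hij : i = j
  · subst hij
    simp only [if_true]
    linear_combination h.norm_eq i
  · simp only [hij, Ne.symm hij, if_false]
    ring

/-- The components of the covariant derivative of the cubic form that enter the Codazzi equation
and the trace identity, for an isotropic Lagrangian. -/
theorem isotropic_aux (h : IsAdapted ζ x n e a b) (hL : IsLagrangianForm ζ x) {lam : ℝ}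
    (hiso : ∀ v, nabC ζ x e v v v v = lam * gV (ζ x v) (ζ x v) ^ 2) {ρ : ℝ}
    (hρ : ρ ^ 2 = 3 / 4)
    (ha0 : a 1 * a 2 - a 1 * b 2 - a 2 * b 1 = ρ * a 0)
    (hb0 : b 1 * b 2 - a 1 * b 2 - a 2 * b 1 = ρ * b 0)
    (ha1 : a 2 * a 0 - a 2 * b 0 - a 0 * b 2 = ρ * a 1)
    (hb1 : b 2 * b 0 - a 2 * b 0 - a 0 * b 2 = ρ * b 1)
    (ha2 : a 0 * a 1 - a 0 * b 1 - a 1 * b 0 = ρ * a 2)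
    (hb2 : b 0 * b 1 - a 0 * b 1 - a 1 * b 0 = ρ * b 2) :
    (nabC ζ x e (e 0) (e 0) (e 1) (e 1) - nabC ζ x e (e 1) (e 0) (e 0) (e 1) =
      -(2 / 3) * (a 0 * b 1 - b 0 * a 1) * (4 / 3 * (a 0 * a 1 + b 0 * b 1)
      - 2 / 3 * (a 0 * b 1 + b 0 * a 1)) - 2 / 3 * ρ * cub ζ x (e 0) (e 1) (e 2)) ∧
    (nabC ζ x e (e 0) (e 0) (e 1) (e 1) + nabC ζ x e (e 1) (e 0) (e 0) (e 1) = 2 / 3 * lam) ∧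
    lam + nabC ζ x e (e 0) (e 0) (e 1) (e 1) + nabC ζ x e (e 0) (e 0) (e 2) (e 2) = 0 := by
  have hg := h.frame.gam_coord
  have hk := h.frame.kap_coord
  have hV := h.frame.gV_coord
  have hC := hL.comp (IsFrame.coord n) hg hk
  obtain ⟨h1, h2⟩ := hC.nabC_diagonal h.norm_eq hρ h.coord_apply_eq ha0 hb0 ha1 hb1 ha2 hb2
  simp only [hL.nabC_comp _ hg hk hV,
    cub_comp _ hg hk hL.eventually_differentiableAt.self_of_nhds] at h1 h2
  rw [hL.nabC_swap_left] at h1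
  refine ⟨h1, ?_, ?_⟩
  · have := hL.nabC_polarize (G := fun v => gV (ζ x v) (ζ x v)) hiso (u := e 0) (v := e 1)
      (by simp [h.gV_apply]) (by simp [h.gV_apply])
      (by rw [map_add, map_smul, gV_add_smul_self]; simp [h.gV_apply]; norm_num)
      (by rw [map_add, map_smul, gV_add_smul_self]; simp [h.gV_apply]; norm_num)
    rw [← this]
  · have := hiso (e 0)
    rw [h.gV_apply] at this
    simp only [Fin.sum_univ_three] at h2
    rw [← h2, this]
    simp

/-- A `J`-isotropic Lagrangian has vanishing isotropic function, and the products of the sines of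
the differences of the angles and their cosines coincide. -/
theorem isotropic (h : IsAdapted ζ x n e a b) (hL : IsLagrangianForm ζ x) {lam : ℝ}
    (hiso : ∀ v, nabC ζ x e v v v v = lam * gV (ζ x v) (ζ x v) ^ 2) :
    lam = 0 ∧
    (a 0 * b 1 - b 0 * a 1) * (2 * (a 0 * a 1 + b 0 * b 1) - (a 0 * b 1 + b 0 * a 1)) =
      (a 1 * b 2 - b 1 * a 2) * (2 * (a 1 * a 2 + b 1 * b 2) - (a 1 * b 2 + b 1 * a 2)) ∧
    (a 1 * b 2 - b 1 * a 2) * (2 * (a 1 * a 2 + b 1 * b 2) - (a 1 * b 2 + b 1 * a 2)) =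
      (a 2 * b 0 - b 2 * a 0) * (2 * (a 2 * a 0 + b 2 * b 0) - (a 2 * b 0 + b 2 * a 0)) := by
  obtain ⟨ρ, hρ, h1, h2, h3, h4, h5, h6⟩ := h.duality hL
  obtain ⟨-, s1, s2⟩ := hL.eventually_tri_eq_zero.self_of_nhds
  -- The same three relations for the frame and its two cyclic permutations; `nabC` does not depend
  -- on the order of the frame.
  have A := h.isotropic_aux hL hiso hρ h1 h2 h3 h4 h5 h6
  have B := h.cyclic.isotropic_aux hL (fun v => (nabC_cyclic e v v v v).trans (hiso v)) hρ
    (by simp only [Matrix.cons_val]; linarith) (by simp only [Matrix.cons_val]; linarith)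
    (by simp only [Matrix.cons_val]; linarith) (by simp only [Matrix.cons_val]; linarith)
    (by simp only [Matrix.cons_val]; linarith) (by simp only [Matrix.cons_val]; linarith)
  have C := h.cyclic.cyclic.isotropic_aux hL (fun v => (nabC_cyclic _ v v v v).trans
    ((nabC_cyclic e v v v v).trans (hiso v))) hρ
    (by simp only [Matrix.cons_val]; linarith) (by simp only [Matrix.cons_val]; linarith)
    (by simp only [Matrix.cons_val]; linarith) (by simp only [Matrix.cons_val]; linarith)
    (by simp only [Matrix.cons_val]; linarith) (by simp only [Matrix.cons_val]; linarith)
  have cyc : ∀ s u v w, nabC ζ x ![e 2, e 0, e 1] s u v w = nabC ζ x e s u v w :=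
    fun s u v w => by simp only [nabC, Fin.sum_univ_three, Matrix.cons_val]; ring
  simp only [nabC_cyclic, Matrix.cons_val, cyc] at B C
  have d1 : cub ζ x (e 1) (e 2) (e 0) = cub ζ x (e 0) (e 1) (e 2) := by rw [s2, s1]
  have d2 : cub ζ x (e 2) (e 0) (e 1) = cub ζ x (e 0) (e 1) (e 2) := by rw [s1, s2]
  have w : ∀ i j, nabC ζ x e (e i) (e j) (e j) (e i) = nabC ζ x e (e i) (e i) (e j) (e j) :=
    fun i j => by rw [hL.nabC_swap_right, hL.nabC_swap_left]
  rw [d1] at B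
  rw [d2] at C
  rw [w 1 0] at A
  rw [w 2 1] at B
  rw [w 0 2] at C
  obtain ⟨A1, A2, A3⟩ := A
  obtain ⟨B1, B2, B3⟩ := B
  obtain ⟨C1, C2, C3⟩ := C
  -- The three trace identities add up to `3 * lam` plus all six mixed components, and the polarized
  -- isotropy conditions evaluate those six to `2 * lam`. With `lam = 0` the six components agree up
  -- to sign, so the three Codazzi differences are equal; they share the same torsion term.
  have hl : lam = 0 := by linarith
  refine ⟨hl, by linarith, by linarith⟩

/-- The covariant derivative of the cubic form on a diagonal element. -/
theorem nabC_self (h : IsAdapted ζ x n e a b) (hL : IsLagrangianForm ζ x) {v t : E3}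
    (ht : ∀ w, gV (Zc ζ x v v - ζ x t) (ζ x w) = 0) :
    nabC ζ x e v v v v = fderiv ℝ (fun y => cub ζ y v v v) x v - 3 * cub ζ x t v v := by
  obtain ⟨-, s1, s2⟩ := hL.eventually_tri_eq_zero.self_of_nhds
  have hlag := hL.lag.self_of_nhds
  have e1 : ∀ k, gV (Zc ζ x v v) (ζ x (e k)) = gV (ζ x t) (ζ x (e k)) := by
    intro k
    have := ht (e k)
    rw [sub_eq_add_neg, ← neg_one_smul ℝ (ζ x t), gV_add_left, gV_smul_left] at this
    linarith
  have hinj : Function.Injective (IsFrame.coord n) := by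
    intro p q hpq
    by_contra hne
    have h0 := gV_self_pos (sub_ne_zero.2 hne)
    rw [← h.frame.gV_coord, map_sub, hpq, sub_self] at h0
    simp [gV] at h0
  -- A tangent vector has no `kap` components, so only the metric part of the unitary expansion
  -- remains. The expansion is taken in frame coordinates and pulled back by injectivity.
  have e2 : ζ x t = ∑ k, gV (ζ x t) (ζ x (e k)) • ζ x (e k) := by
    apply hinj
    have := eq_expansion h.norm_eq (z := fun k => (IsFrame.coord n).comp (ζ x) (e k))
      h.coord_apply_eq (IsFrame.coord n (ζ x t))
    simp only [ContinuousLinearMap.comp_apply, h.frame.gV_coord, h.frame.kap_coord, hlag] at this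
    have hc : ∀ k, IsFrame.coord n (ζ x (e k)) = _ := h.coord_apply_eq
    rw [map_sum]
    simp only [map_smul, hc]
    refine this.trans ?_
    ext i <;> fin_cases i <;> simp [Fin.sum_univ_three]
  have e3 : cub ζ x t v v = ∑ k, gV (ζ x t) (ζ x (e k)) * cub ζ x (e k) v v := by
    have e4 : ∀ s, cub ζ x s v v = kapL (Zc ζ x v v) (ζ x s) := fun s => by
      rw [s1, s2]; rfl
    rw [e4, e2, map_sum]
    simp only [map_smul, smul_eq_mul, e4]
    rw [← e2]
  rw [nabC, e3]
  simp only [e1, Fin.sum_univ_three]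
  ring

end IsAdapted

end NearlyKahler

end

/-! ### Solution of the angle equations: the seven normal forms. -/

noncomputable section

namespace NearlyKahler

open Filter Topology

variable {ζ : E3 → E3 →L[ℝ] V3 × V3} {x : E3}

/-- The first components of the seven normal forms of a `J`-isotropic Lagrangian. -/
def nfA (c : Fin 7) : V3 :=
  ![![0, 0, 0], ![√3 / 2, √3 / 2, √3 / 2], ![√3 / 2, √3 / 2, √3 / 2], ![1 / 2, 1 / 2, √3 / 2],
    ![1, 1, 0], ![1 / 2, 1 / 2, √3 / 2], ![√3 / 2, √3 / 2, 0]] c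

/-- The second components of the seven normal forms of a `J`-isotropic Lagrangian. -/
def nfB (c : Fin 7) : V3 :=
  ![![√3 / 2, √3 / 2, √3 / 2], ![0, 0, 0], ![√3 / 2, √3 / 2, √3 / 2], ![-1 / 2, -1 / 2, √3 / 2],
    ![1 / 2, 1 / 2, √3 / 2], ![1, 1, 0], ![0, √3 / 2, √3 / 2]] c

/-- The form `ζ` has the normal form `c` at `x`. -/
def HasNormalForm (ζ : E3 → E3 →L[ℝ] V3 × V3) (x : E3) (c : Fin 7) : Prop :=
  ∃ n e, IsAdapted ζ x n e (nfA c) (nfB c)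

theorem sqrt_three_sq : (√3 : ℝ) ^ 2 = 3 := Real.sq_sqrt (by norm_num)

theorem eq_or_eq_neg_of_sq {y c : ℝ} (h : y ^ 2 = c ^ 2) :
    ∃ ε : ℝ, (ε = 1 ∨ ε = -1) ∧ ε * y = c := by
  rcases sq_eq_sq_iff_eq_or_eq_neg.1 h with h | h
  · exact ⟨1, Or.inl rfl, by linarith⟩
  · exact ⟨-1, Or.inr rfl, by linarith⟩

/-- The product `a * b * (a - b)` is a multiple of the imaginary part of `(a + ω b) ^ 3`. Where it
vanishes, the number lies on one of three lines, and each line meets the norm ellipse in two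
opposite points. -/
theorem exists_sign_of_cube {a b : ℝ} (hN : 4 / 3 * (a ^ 2 + b ^ 2 - a * b) = 1)
    (h : a * b * (a - b) = 0) : ∃ ε : ℝ, (ε = 1 ∨ ε = -1) ∧
      ((ε * a = 0 ∧ ε * b = √3 / 2) ∨ (ε * a = √3 / 2 ∧ ε * b = 0) ∨
        (ε * a = √3 / 2 ∧ ε * b = √3 / 2)) := by
  have h3 := sqrt_three_sq
  rcases mul_eq_zero.1 h with h | h
  · rcases mul_eq_zero.1 h with h | h
    · obtain ⟨ε, h1, h2⟩ := eq_or_eq_neg_of_sq (y := b) (c := √3 / 2) (by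
        rw [h] at hN; linear_combination 3 / 4 * hN - 1 / 4 * h3)
      exact ⟨ε, h1, Or.inl ⟨by rw [h, mul_zero], h2⟩⟩
    · obtain ⟨ε, h1, h2⟩ := eq_or_eq_neg_of_sq (y := a) (c := √3 / 2) (by
        rw [h] at hN; linear_combination 3 / 4 * hN - 1 / 4 * h3)
      exact ⟨ε, h1, Or.inr (Or.inl ⟨h2, by rw [h, mul_zero]⟩)⟩
  · have hab : a = b := by linarith
    obtain ⟨ε, h1, h2⟩ := eq_or_eq_neg_of_sq (y := a) (c := √3 / 2) (by
      rw [← hab] at hN; linear_combination 3 / 4 * hN - 1 / 4 * h3)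
    exact ⟨ε, h1, Or.inr (Or.inr ⟨h2, hab ▸ h2⟩)⟩

/-- Orthogonality of `a + ω b` and `c + ω d` makes the latter a real multiple of `i` times the
former, and `(2 * b - a) + ω (b - 2 * a)` is `-i√3` times `a + ω b`. -/
theorem eq_mul_of_orthogonal {a b c d : ℝ} (hN : 4 / 3 * (a ^ 2 + b ^ 2 - a * b) = 1)
    (h : 2 * (a * c + b * d) - (a * d + b * c) = 0) :
    c = 2 / 3 * (c * b - d * a) * (2 * b - a) ∧ d = 2 / 3 * (c * b - d * a) * (b - 2 * a) :=
  ⟨by linear_combination (-c) * hN + 2 / 3 * a * h,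
    by linear_combination (-d) * hN + 2 / 3 * b * h⟩

theorem eq_or_eq_neg_of_orthogonal {a b c d : ℝ} (hN : 4 / 3 * (a ^ 2 + b ^ 2 - a * b) = 1)
    (hN' : 4 / 3 * (c ^ 2 + d ^ 2 - c * d) = 1)
    (h : 2 * (a * c + b * d) - (a * d + b * c) = 0) :
    ∃ ε : ℝ, (ε = 1 ∨ ε = -1) ∧ ε * c = √3 / 3 * (2 * b - a) ∧ ε * d = √3 / 3 * (b - 2 * a) := by
  obtain ⟨h1, h2⟩ := eq_mul_of_orthogonal hN h
  set t := 2 / 3 * (c * b - d * a) with ht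
  have h3 := sqrt_three_sq
  have ht2 : t ^ 2 = (√3 / 3) ^ 2 := by
    have : t ^ 2 * (4 / 3 * ((2 * b - a) ^ 2 + (b - 2 * a) ^ 2 - (2 * b - a) * (b - 2 * a))) = 1 := by
      rw [← hN']
      conv_rhs => rw [h1, h2]
      ring
    linear_combination 1 / 3 * this - 1 / 9 * h3 - t ^ 2 * hN
  obtain ⟨ε, he, h4⟩ := eq_or_eq_neg_of_sq ht2
  refine ⟨ε, he, ?_, ?_⟩
  · rw [h1, ← h4]; ring
  · rw [h2, ← h4]; ring

namespace IsAdapted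

variable {n : Fin 3 → V3} {e : Fin 3 → E3} {a b : V3}

theorem flip (h : IsAdapted ζ x n e a b) {ε : Fin 3 → ℝ} (hε : ∀ k, ε k = 1 ∨ ε k = -1) :
    IsAdapted ζ x n (fun k => ε k • e k) (fun k => ε k * a k) (fun k => ε k * b k) where
  frame := h.frame
  apply_eq k := by rw [map_smul, h.apply_eq, Prod.smul_mk, smul_smul, smul_smul]
  norm_eq k := by
    have : ε k ^ 2 = 1 := by rcases hε k with h | h <;> rw [h] <;> norm_num
    linear_combination h.norm_eq k + 4 / 3 * (a k ^ 2 + b k ^ 2 - a k * b k) * this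

/-- A transposition reverses the orientation of the frame and so does the negation of its three
vectors. Negating the `e k` as well keeps the diagonal entries. -/
theorem swap (h : IsAdapted ζ x n e a b) :
    IsAdapted ζ x ![-n 1, -n 0, -n 2] ![-e 1, -e 0, -e 2] ![a 1, a 0, a 2] ![b 1, b 0, b 2] where
  frame :=
    { dot := fun i j => by fin_cases i <;> fin_cases j <;> simp [h.frame.dot]
      cross := by
        have := h.frame.cross
        simp only [Matrix.cons_val]
        rw [← this, map_neg, map_neg, LinearMap.neg_apply, neg_neg, ← cross_anticomm] }
  apply_eq k := by fin_cases k <;> simp [h.apply_eq]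
  norm_eq k := by fin_cases k <;> simp [h.norm_eq]

theorem tri_eq (h : IsAdapted ζ x n e a b) (hL : IsLagrangianForm ζ x) :
    a 2 * (b 0 * b 1 - a 0 * b 1 - a 1 * b 0) = b 2 * (a 0 * a 1 - a 0 * b 1 - a 1 * b 0) := by
  obtain ⟨ρ, -, -, -, -, -, h5, h6⟩ := h.duality hL
  rw [h5, h6]; ring

theorem hasNormalForm (h : IsAdapted ζ x n e a b) {c : Fin 7} (ha : ∀ k, a k = nfA c k)
    (hb : ∀ k, b k = nfB c k) : HasNormalForm ζ x c :=
  ⟨n, e, by rwa [← funext ha, ← funext hb]⟩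

/-- The Codazzi equations for a `J`-isotropic Lagrangian factorize. -/
theorem cube_or_orthogonal (h : IsAdapted ζ x n e a b) (hL : IsLagrangianForm ζ x)
    (hD : (a 0 * b 1 - b 0 * a 1) * (2 * (a 0 * a 1 + b 0 * b 1) - (a 0 * b 1 + b 0 * a 1)) =
      (a 1 * b 2 - b 1 * a 2) * (2 * (a 1 * a 2 + b 1 * b 2) - (a 1 * b 2 + b 1 * a 2))) :
    a 1 * b 1 * (a 1 - b 1) = 0 ∨ 2 * (a 2 * a 0 + b 2 * b 0) - (a 2 * b 0 + b 2 * a 0) = 0 := by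
  obtain ⟨ρ, hρ, -, -, -, -, h5, h6⟩ := h.duality hL
  have e1 : a 2 = 4 / 3 * ρ * (a 0 * a 1 - a 0 * b 1 - a 1 * b 0) := by
    rw [h5]; linear_combination -4 / 3 * a 2 * hρ
  have e2 : b 2 = 4 / 3 * ρ * (b 0 * b 1 - a 0 * b 1 - a 1 * b 0) := by
    rw [h6]; linear_combination -4 / 3 * b 2 * hρ
  have h1 := h.norm_eq 1
  rw [← mul_eq_zero]
  rw [e1, e2] at hD ⊢
  generalize a 0 = a0, b 0 = b0, a 1 = a1, b 1 = b1 at *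
  -- The homogeneous form of `sin 2(θ₀ - θ₁) - sin 2(θ₁ - θ₂) = 2 sin (θ₀ + θ₂ - 2θ₁) cos (θ₀ -
  -- θ₂)`, where the angle sum turns the first factor into `sin 3θ₁` up to sign.
  have key : (4 / 3 * (a1 ^ 2 + b1 ^ 2 - a1 * b1)) *
      ((a0 * b1 - b0 * a1) * (2 * (a0 * a1 + b0 * b1) - (a0 * b1 + b0 * a1)))
      - 4 / 3 * ((a1 * (b0 * b1 - a0 * b1 - a1 * b0) - b1 * (a0 * a1 - a0 * b1 - a1 * b0)) *
        (2 * (a1 * (a0 * a1 - a0 * b1 - a1 * b0) + b1 * (b0 * b1 - a0 * b1 - a1 * b0))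
          - (a1 * (b0 * b1 - a0 * b1 - a1 * b0) + b1 * (a0 * a1 - a0 * b1 - a1 * b0)))) =
      4 * (a1 * b1 * (a1 - b1)) * (2 * ((a0 * a1 - a0 * b1 - a1 * b0) * a0
        + (b0 * b1 - a0 * b1 - a1 * b0) * b0)
        - ((a0 * a1 - a0 * b1 - a1 * b0) * b0 + (b0 * b1 - a0 * b1 - a1 * b0) * a0)) := by
    ring
  rw [h1] at key
  generalize a0 * a1 - a0 * b1 - a1 * b0 = A, b0 * b1 - a0 * b1 - a1 * b0 = B at *
  linear_combination ρ / 3 * hD - ρ / 3 * key + 16 / 27 * ρ * ((a1 * B - b1 * A) * (2 * (a1 * A + b1 * B) - (a1 * B + b1 * A))) * hρ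

/-- Up to signs of the `e k` every entry is one of three points, on lines at angles 0, π/3 and 2π/3.
The product of the three entries is real only if they coincide, giving forms 0, 1, 2, or are
pairwise distinct, giving form 6 up to order. -/
theorem normalForm_of_cubes (h : IsAdapted ζ x n e a b) (hL : IsLagrangianForm ζ x)
    (ht : ∀ k, a k * b k * (a k - b k) = 0) : ∃ c, HasNormalForm ζ x c := by
  choose ε hε h1 using fun k => exists_sign_of_cube (h.norm_eq k) (ht k)
  have h' := h.flip hε
  obtain ⟨a', ha'⟩ : ∃ a' : V3, a' = fun k => ε k * a k := ⟨_, rfl⟩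
  obtain ⟨b', hb'⟩ : ∃ b' : V3, b' = fun k => ε k * b k := ⟨_, rfl⟩
  rw [← ha', ← hb'] at h'
  have h2 : ∀ k, (a' k = 0 ∧ b' k = √3 / 2) ∨ (a' k = √3 / 2 ∧ b' k = 0) ∨
        (a' k = √3 / 2 ∧ b' k = √3 / 2) := by rw [ha', hb']; exact h1
  have ht := h'.tri_eq hL
  have h0 := h2 0
  have h1 := h2 1
  have h2 := h2 2
  clear * - h' ht h0 h1 h2
  have key : ∀ k : Fin 3, k = 0 ∨ k = 1 ∨ k = 2 := by decide
  -- Of the 27 combinations the first alternative removes those violating `ht`. The six orders of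
  -- the distinct case are matched by cyclic permutations, with or without `swap`.
  rcases h0 with ⟨p0, q0⟩ | ⟨p0, q0⟩ | ⟨p0, q0⟩ <;> rcases h1 with ⟨p1, q1⟩ | ⟨p1, q1⟩ | ⟨p1, q1⟩ <;>
    rcases h2 with ⟨p2, q2⟩ | ⟨p2, q2⟩ | ⟨p2, q2⟩ <;>
    (rw [p0, q0, p1, q1, p2, q2] at ht) <;> first
    | (exfalso; norm_num at ht; done)
    | (refine ⟨0, h'.hasNormalForm ?_ ?_⟩ <;> intro k <;>
        rcases key k with rfl | rfl | rfl <;> simp [nfA, nfB, *] <;> done)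
    | (refine ⟨1, h'.hasNormalForm ?_ ?_⟩ <;> intro k <;>
        rcases key k with rfl | rfl | rfl <;> simp [nfA, nfB, *] <;> done)
    | (refine ⟨2, h'.hasNormalForm ?_ ?_⟩ <;> intro k <;>
        rcases key k with rfl | rfl | rfl <;> simp [nfA, nfB, *] <;> done)
    | (refine ⟨6, h'.hasNormalForm ?_ ?_⟩ <;> intro k <;>
        rcases key k with rfl | rfl | rfl <;> simp [nfA, nfB, *] <;> done)
    | (refine ⟨6, h'.cyclic.hasNormalForm ?_ ?_⟩ <;> intro k <;>
        rcases key k with rfl | rfl | rfl <;> simp [nfA, nfB, *] <;> done)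
    | (refine ⟨6, h'.cyclic.cyclic.hasNormalForm ?_ ?_⟩ <;> intro k <;>
        rcases key k with rfl | rfl | rfl <;> simp [nfA, nfB, *] <;> done)
    | (refine ⟨6, h'.swap.hasNormalForm ?_ ?_⟩ <;> intro k <;>
        rcases key k with rfl | rfl | rfl <;> simp [nfA, nfB, *] <;> done)
    | (refine ⟨6, h'.cyclic.swap.hasNormalForm ?_ ?_⟩ <;> intro k <;>
        rcases key k with rfl | rfl | rfl <;> simp [nfA, nfB, *] <;> done)
    | (refine ⟨6, h'.cyclic.cyclic.swap.hasNormalForm ?_ ?_⟩ <;> intro k <;>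
        rcases key k with rfl | rfl | rfl <;> simp [nfA, nfB, *])

/-- Both `z_0` and `z_1` are real multiples of `i z_2`, so reality of `z_0 z_1 z_2` means that `z_2
^ 3` is real. Thus `z_2` is on one of three lines and the other entries are known up to sign: forms
4, 5 and 3. -/
theorem normalForm_of_orthogonal (h : IsAdapted ζ x n e a b) (hL : IsLagrangianForm ζ x)
    (h0 : 2 * (a 2 * a 0 + b 2 * b 0) - (a 2 * b 0 + b 2 * a 0) = 0)
    (h1 : 2 * (a 2 * a 1 + b 2 * b 1) - (a 2 * b 1 + b 2 * a 1) = 0) :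
    ∃ c, HasNormalForm ζ x c := by
  have ht := h.tri_eq hL
  have hn2 := h.norm_eq 2
  have ht2 : a 2 * b 2 * (a 2 - b 2) = 0 := by
    obtain ⟨e1, e2⟩ := eq_mul_of_orthogonal hn2 h0
    obtain ⟨e3, e4⟩ := eq_mul_of_orthogonal hn2 h1
    set t := 2 / 3 * (a 0 * b 2 - b 0 * a 2) with ht_def
    set s := 2 / 3 * (a 1 * b 2 - b 1 * a 2) with hs_def
    have hs : s ≠ 0 := by
      intro hs
      have := h.norm_eq 1
      rw [e3, e4, hs] at this
      norm_num at this
    have ht' : t ≠ 0 := by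
      intro hs
      have := h.norm_eq 0
      rw [e1, e2, hs] at this
      norm_num at this
    rw [e1, e2, e3, e4] at ht
    refine (mul_eq_zero_iff_left (mul_ne_zero hs ht')).1 ?_
    linear_combination 1 / 9 * ht
  have h3 := sqrt_three_sq
  obtain ⟨ε0, he0, c0, d0⟩ := eq_or_eq_neg_of_orthogonal hn2 (h.norm_eq 0) h0
  obtain ⟨ε1, he1, c1, d1⟩ := eq_or_eq_neg_of_orthogonal hn2 (h.norm_eq 1) h1
  obtain ⟨ε2, he2, h2⟩ := exists_sign_of_cube hn2 ht2
  have hsq : ε2 * ε2 = 1 := by rcases he2 with h | h <;> rw [h] <;> norm_num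
  have hpm : ∀ {ε : ℝ}, (ε = 1 ∨ ε = -1) → (-(ε2 * ε) = 1 ∨ -(ε2 * ε) = -1) ∧
      (ε2 * ε = 1 ∨ ε2 * ε = -1) := by
    intro ε h
    rcases he2 with h2 | h2 <;> rcases h with h | h <;> rw [h, h2] <;> norm_num
  have key : ∀ k : Fin 3, k = 0 ∨ k = 1 ∨ k = 2 := by decide
  have hs3 : √3 * √3 = 3 := by rw [← sq]; exact h3
  rcases h2 with ⟨p, q⟩ | ⟨p, q⟩ | ⟨p, q⟩
  · refine ⟨4, (h.flip (ε := ![ε2 * ε0, ε2 * ε1, ε2]) fun k => ?_).hasNormalForm ?_ ?_⟩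
    · rcases key k with rfl | rfl | rfl
      exacts [(hpm he0).2, (hpm he1).2, he2]
    · intro k
      rcases key k with rfl | rfl | rfl <;> simp [nfA]
      · linear_combination ε2 * c0 + √3 / 3 * (2 * q - p) + 1 / 3 * hs3
      · linear_combination ε2 * c1 + √3 / 3 * (2 * q - p) + 1 / 3 * hs3
      · simpa using p
    · intro k
      rcases key k with rfl | rfl | rfl <;> simp [nfB]
      · linear_combination ε2 * d0 + √3 / 3 * (q - 2 * p) + 1 / 6 * hs3
      · linear_combination ε2 * d1 + √3 / 3 * (q - 2 * p) + 1 / 6 * hs3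
      · exact q
  · refine ⟨5, (h.flip (ε := ![-(ε2 * ε0), -(ε2 * ε1), ε2]) fun k => ?_).hasNormalForm ?_ ?_⟩
    · rcases key k with rfl | rfl | rfl
      exacts [(hpm he0).1, (hpm he1).1, he2]
    · intro k
      rcases key k with rfl | rfl | rfl <;> simp [nfA]
      · linear_combination -ε2 * c0 - √3 / 3 * (2 * q - p) + 1 / 6 * hs3
      · linear_combination -ε2 * c1 - √3 / 3 * (2 * q - p) + 1 / 6 * hs3
      · exact p
    · intro k
      rcases key k with rfl | rfl | rfl <;> simp [nfB]
      · linear_combination -ε2 * d0 - √3 / 3 * (q - 2 * p) + 1 / 3 * hs3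
      · linear_combination -ε2 * d1 - √3 / 3 * (q - 2 * p) + 1 / 3 * hs3
      · simpa using q
  · refine ⟨3, (h.flip (ε := ![ε2 * ε0, ε2 * ε1, ε2]) fun k => ?_).hasNormalForm ?_ ?_⟩
    · rcases key k with rfl | rfl | rfl
      exacts [(hpm he0).2, (hpm he1).2, he2]
    · intro k
      rcases key k with rfl | rfl | rfl <;> simp [nfA]
      · linear_combination ε2 * c0 + √3 / 3 * (2 * q - p) + 1 / 6 * hs3
      · linear_combination ε2 * c1 + √3 / 3 * (2 * q - p) + 1 / 6 * hs3
      · exact p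
    · intro k
      rcases key k with rfl | rfl | rfl <;> simp [nfB]
      · linear_combination ε2 * d0 + √3 / 3 * (q - 2 * p) - 1 / 6 * hs3
      · linear_combination ε2 * d1 + √3 / 3 * (q - 2 * p) - 1 / 6 * hs3
      · exact q

/-- If `w` is a real multiple of `i z`, then `w ^ 3` is a real multiple of `i z ^ 3`, so the two
nonzero cubes cannot both be real. -/
theorem orthogonal_ne {a b c d : ℝ} (hN : 4 / 3 * (a ^ 2 + b ^ 2 - a * b) = 1)
    (hN' : 4 / 3 * (c ^ 2 + d ^ 2 - c * d) = 1) (h : a * b * (a - b) = 0)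
    (h' : c * d * (c - d) = 0) : 2 * (a * c + b * d) - (a * d + b * c) ≠ 0 := by
  intro h0
  obtain ⟨e1, e2⟩ := eq_mul_of_orthogonal hN h0
  set t := 2 / 3 * (c * b - d * a) with ht
  have ht0 : t ≠ 0 := by
    intro ht0
    rw [e1, e2, ht0] at hN'
    norm_num at hN'
  have h1 : (2 * b - a) * (b - 2 * a) * (a + b) = 0 := by
    refine (mul_eq_zero_iff_left (pow_ne_zero 3 ht0)).1 ?_
    rw [e1, e2] at h'
    linear_combination h'
  rcases mul_eq_zero.1 h with h | h
  · rcases mul_eq_zero.1 h with rfl | rfl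
    · have : b = 0 := by simpa using h1
      rw [this] at hN; norm_num at hN
    · have : a = 0 := by simpa using h1
      rw [this] at hN; norm_num at hN
  · have hab : a = b := by linarith
    subst hab
    have : a ^ 3 = 0 := by linear_combination -1 / 2 * h1
    have : a = 0 := by simpa using this
    rw [this] at hN; norm_num at hN

/-- A `J`-isotropic Lagrangian has vanishing isotropic function and, at each point, one of the
seven normal forms. -/
theorem exists_normalForm (h : IsAdapted ζ x n e a b) (hL : IsLagrangianForm ζ x) {lam : ℝ}
    (hiso : ∀ v, nabC ζ x e v v v v = lam * gV (ζ x v) (ζ x v) ^ 2) :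
    lam = 0 ∧ ∃ c, HasNormalForm ζ x c := by
  obtain ⟨h0, h1, h2⟩ := h.isotropic hL hiso
  refine ⟨h0, ?_⟩
  have c1 := h.cube_or_orthogonal hL h1
  have c2 := h.cyclic.cube_or_orthogonal hL (by simpa using h2)
  have c0 := h.cyclic.cyclic.cube_or_orthogonal hL (by simpa using (h1.trans h2).symm)
  simp only [Matrix.cons_val] at c0 c2
  have n0 := h.norm_eq 0
  have n1 := h.norm_eq 1
  have n2 := h.norm_eq 2
  have p2 := h.normalForm_of_orthogonal hL
  have p0 := h.cyclic.normalForm_of_orthogonal hL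
  have p1 := h.cyclic.cyclic.normalForm_of_orthogonal hL
  simp only [Matrix.cons_val] at p0 p1
  have s : ∀ a b c d : ℝ, 2 * (a * c + b * d) - (a * d + b * c) =
    2 * (c * a + d * b) - (c * b + d * a) := fun a b c d => by ring
  -- Where the cube of an entry is not real, the other two entries are orthogonal. A single such
  -- index contradicts `orthogonal_ne`; two of them produce an entry orthogonal to both others.
  by_cases t0 : a 0 * b 0 * (a 0 - b 0) = 0
  · by_cases t1 : a 1 * b 1 * (a 1 - b 1) = 0
    · by_cases t2 : a 2 * b 2 * (a 2 - b 2) = 0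
      · refine h.normalForm_of_cubes hL fun k => ?_
        fin_cases k
        exacts [t0, t1, t2]
      · exact absurd (c2.resolve_left t2) (orthogonal_ne n0 n1 t0 t1)
    · have r := c1.resolve_left t1
      by_cases t2 : a 2 * b 2 * (a 2 - b 2) = 0
      · exact absurd r (orthogonal_ne n2 n0 t2 t0)
      · have r' := c2.resolve_left t2
        exact p0 r' ((s _ _ _ _).trans r)
  · have r := c0.resolve_left t0
    by_cases t1 : a 1 * b 1 * (a 1 - b 1) = 0
    · by_cases t2 : a 2 * b 2 * (a 2 - b 2) = 0
      · exact absurd r (orthogonal_ne n1 n2 t1 t2)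
      · have r' := c2.resolve_left t2
        exact p1 r ((s _ _ _ _).trans r')
    · have r' := c1.resolve_left t1
      exact p2 r' ((s _ _ _ _).trans r)

end IsAdapted

end NearlyKahler

end

/-! ### Existence of adapted frames. -/

noncomputable section

namespace NearlyKahler

open Filter Topology

/-- Simultaneous diagonalization of the two components of a Lagrangian subspace of `ℝ³ × ℝ³`. -/
theorem exists_diagonal (A B : E3 →ₗ[ℝ] E3) (hAB : ∀ u v, inner ℝ (A u) (B v) = inner ℝ (B u) (A v))
    (hinj : ∀ u, A u = 0 → B u = 0 → u = 0) :
    ∃ (m : OrthonormalBasis (Fin 3) ℝ E3) (e : Fin 3 → E3) (a b : Fin 3 → ℝ),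
      ∀ k, A (e k) = a k • m k ∧ B (e k) = b k • m k ∧ e k ≠ 0 := by
  -- If `A + r • B` had a kernel for each of `r = 0, 1, 2, 3`, the images under `B` of the kernel
  -- vectors would be nonzero and, by `hAB`, pairwise orthogonal: four independent vectors in `ℝ³`.
  obtain ⟨r, hr⟩ : ∃ r : ℝ, Function.Injective (A + r • B) := by
    by_contra! hno
    have h1 : ∀ r : ℝ, ∃ u, u ≠ 0 ∧ A u = -r • B u := by
      intro r
      have := hno r
      rw [← LinearMap.ker_eq_bot, Submodule.eq_bot_iff] at this
      push Not at this
      obtain ⟨u, hu, hu0⟩ := this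
      refine ⟨u, hu0, ?_⟩
      rw [LinearMap.mem_ker, LinearMap.add_apply, LinearMap.smul_apply] at hu
      rw [neg_smul]
      exact eq_neg_of_add_eq_zero_left hu
    choose u hu0 hu using h1
    have hne : ∀ k : Fin 4, B (u (k : ℕ)) ≠ 0 := fun k hk =>
      hu0 _ (hinj _ (by rw [hu, hk, smul_zero]) hk)
    have horth : Pairwise fun i j : Fin 4 => inner ℝ (B (u (i : ℕ))) (B (u (j : ℕ))) = 0 := by
      intro i j hij
      have := hAB (u (i : ℕ)) (u (j : ℕ))
      rw [hu, hu, inner_smul_left, inner_smul_right] at this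
      have hne : ((j : ℕ) : ℝ) - ((i : ℕ) : ℝ) ≠ 0 := by
        rw [sub_ne_zero]
        exact fun h => hij (Fin.ext (Nat.cast_injective h)).symm
      refine (mul_eq_zero_iff_left hne).1 ?_
      simp only [conj_trivial] at this
      linear_combination this
    have hli := linearIndependent_of_ne_zero_of_inner_eq_zero hne horth
    have := hli.fintype_card_le_finrank
    simp at this
  set e := LinearEquiv.ofInjectiveEndo _ hr with he
  have hsum : ∀ u, A (e.symm u) + r • B (e.symm u) = u := fun u => e.apply_symm_apply u
  -- The Lagrangian condition `hAB` is exactly the symmetry of `B` composed with the inverse of `A +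
  -- r • B`. Its eigenvectors diagonalize both maps.
  have hsymm : (B ∘ₗ e.symm.toLinearMap).IsSymmetric := by
    intro u v
    have h1 := hAB (e.symm u) (e.symm v)
    have h2 : inner ℝ (B (e.symm u)) v = inner ℝ (B (e.symm u)) (A (e.symm v))
        + r * inner ℝ (B (e.symm u)) (B (e.symm v)) := by
      conv_lhs => rw [← hsum v]
      rw [inner_add_right, inner_smul_right]
    have h3 : inner ℝ u (B (e.symm v)) = inner ℝ (A (e.symm u)) (B (e.symm v))
        + r * inner ℝ (B (e.symm u)) (B (e.symm v)) := by
      conv_lhs => rw [← hsum u]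
      rw [inner_add_left, inner_smul_left, conj_trivial]
    simp only [LinearMap.comp_apply, LinearEquiv.coe_coe]
    rw [h2, h3, h1]
  have hn : Module.finrank ℝ E3 = 3 := by simp
  refine ⟨hsymm.eigenvectorBasis hn, fun k => e.symm (hsymm.eigenvectorBasis hn k),
    fun k => 1 - r * hsymm.eigenvalues hn k, hsymm.eigenvalues hn, fun k => ?_⟩
  have hB : B (e.symm (hsymm.eigenvectorBasis hn k)) =
      hsymm.eigenvalues hn k • hsymm.eigenvectorBasis hn k :=
    hsymm.apply_eigenvectorBasis hn k
  refine ⟨?_, hB, ?_⟩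
  · have := hsum (hsymm.eigenvectorBasis hn k)
    rw [hB] at this
    rw [sub_smul, one_smul, mul_smul]
    exact eq_sub_of_add_eq this
  · simpa using (hsymm.eigenvectorBasis hn).orthonormal.ne_zero k

/-- An orthonormal triple becomes a frame if its last vector is multiplied by a sign. -/
theorem exists_sign_isFrame {n : Fin 3 → V3} (h : ∀ i j, n i ⬝ᵥ n j = if i = j then 1 else 0) :
    ∃ ε : ℝ, (ε = 1 ∨ ε = -1) ∧ IsFrame ![n 0, n 1, ε • n 2] := by
  have h1 : Matrix.of n * (Matrix.of n).transpose = 1 := by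
    ext i j
    simpa [Matrix.mul_apply, dotProduct, Matrix.one_apply] using h i j
  have h2 : (Matrix.of n).transpose * Matrix.of n = 1 := mul_eq_one_comm.1 h1
  set c := crossProduct (n 0) (n 1) with hc
  have hcc : c ⬝ᵥ c = 1 := by rw [hc, cross_dot_cross, h, h, h, h]; simp
  have hc0 : n 0 ⬝ᵥ c = 0 := dot_self_cross _ _
  have hc1 : n 1 ⬝ᵥ c = 0 := dot_cross_self _ _
  have hexp : c = (n 2 ⬝ᵥ c) • n 2 := by
    have h3 : (Matrix.of n).transpose.mulVec ((Matrix.of n).mulVec c) = c := by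
      rw [Matrix.mulVec_mulVec, h2, Matrix.one_mulVec]
    have h4 : (Matrix.of n).mulVec c = ![0, 0, n 2 ⬝ᵥ c] := by
      ext k; fin_cases k
      exacts [hc0, hc1, rfl]
    rw [h4] at h3
    conv_lhs => rw [← h3]
    ext k
    simp [Matrix.mulVec, dotProduct, Fin.sum_univ_three, mul_comm]
  have hsq : (n 2 ⬝ᵥ c) ^ 2 = 1 ^ 2 := by
    rw [hexp, smul_dotProduct, dotProduct_smul, h] at hcc
    simp only [if_true, smul_eq_mul, mul_one] at hcc
    rw [sq, hcc, one_pow]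
  refine ⟨n 2 ⬝ᵥ c, sq_eq_sq_iff_eq_or_eq_neg.1 hsq, ?_, ?_⟩
  · intro i j
    have h5 : (n 2 ⬝ᵥ c) * (n 2 ⬝ᵥ c) = 1 := by rw [← sq, hsq, one_pow]
    fin_cases i <;> fin_cases j <;> simp [h, h5]
  · simpa using hexp

variable {ζ : E3 → E3 →L[ℝ] V3 × V3} {x : E3}

theorem exists_isAdapted (hinj : Function.Injective (ζ x))
    (hlag : ∀ u v, kap (ζ x u) (ζ x v) = 0) : ∃ n e a b, IsAdapted ζ x n e a b := by
  let L : V3 ≃ₗ[ℝ] E3 := (WithLp.linearEquiv 2 ℝ V3).symm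
  have hL : ∀ u v : V3, inner ℝ (L u) (L v) = u ⬝ᵥ v := fun u v => by
    simp [L, EuclideanSpace.inner_eq_star_dotProduct, dotProduct_comm]
  obtain ⟨m, e, a, b, h⟩ := exists_diagonal
    (L.toLinearMap ∘ₗ LinearMap.fst ℝ V3 V3 ∘ₗ (ζ x).toLinearMap)
    (L.toLinearMap ∘ₗ LinearMap.snd ℝ V3 V3 ∘ₗ (ζ x).toLinearMap)
    (fun u v => by
      have := hlag u v
      simp only [kap] at this
      simp only [LinearMap.comp_apply, LinearEquiv.coe_coe, hL, LinearMap.fst_apply,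
        LinearMap.snd_apply, ContinuousLinearMap.coe_coe]
      linarith)
    (fun u h1 h2 => by
      have h1 : (ζ x u).1 = 0 := by simpa using h1
      have h2 : (ζ x u).2 = 0 := by simpa using h2
      exact hinj (by rw [map_zero]; exact Prod.ext h1 h2))
  set n : Fin 3 → V3 := fun k => L.symm (m k) with hn
  have hdot : ∀ i j, n i ⬝ᵥ n j = if i = j then 1 else 0 := fun i j => by
    rw [← hL, hn]
    simp only [LinearEquiv.apply_symm_apply]
    exact orthonormal_iff_ite.1 m.orthonormal i j
  have hζ : ∀ k, ζ x (e k) = (a k • n k, b k • n k) := fun k => by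
    obtain ⟨h1, h2, -⟩ := h k
    refine Prod.ext ?_ ?_
    · apply L.injective; simpa [hn] using h1
    · apply L.injective; simpa [hn] using h2
  have hpos : ∀ k, 0 < 4 / 3 * (a k ^ 2 + b k ^ 2 - a k * b k) := fun k => by
    have h1 : ζ x (e k) ≠ 0 := fun h0 => (h k).2.2 (hinj (by rw [h0, map_zero]))
    have h2 := gV_self_pos h1
    rw [hζ] at h2
    simp only [gV, smul_dotProduct, dotProduct_smul, hdot, smul_eq_mul, if_true] at h2
    linarith
  obtain ⟨ε, hε, hF⟩ := exists_sign_isFrame hdot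
  set c : Fin 3 → ℝ := fun k => (√(4 / 3 * (a k ^ 2 + b k ^ 2 - a k * b k)))⁻¹ with hc
  have hc2 : ∀ k, c k ^ 2 * (4 / 3 * (a k ^ 2 + b k ^ 2 - a k * b k)) = 1 := fun k => by
    rw [hc]
    simp only [inv_pow]
    rw [Real.sq_sqrt (hpos k).le, inv_mul_cancel₀ (hpos k).ne']
  have hεε : ε * ε = 1 := by rcases hε with h | h <;> rw [h] <;> norm_num
  -- The scalars `c k` normalize the vectors; the orientation sign moves from the last frame vector
  -- to the last `e`, so that the entries do not see it.
  refine ⟨_, ![c 0 • e 0, c 1 • e 1, (ε * c 2) • e 2], fun k => c k * a k, fun k => c k * b k, hF,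
    fun k => ?_, fun k => ?_⟩
  · fin_cases k
    · simp [hζ, smul_smul]
    · simp [hζ, smul_smul]
    · simp [hζ, smul_smul]
      constructor <;> congr 1 <;> ring
  · linear_combination hc2 k

/-! ### The normal form is locally constant -/

/-- An invariant that distinguishes the seven normal forms. -/
def invariant (ζ : E3 → E3 →L[ℝ] V3 × V3) (y : E3) : ℝ :=
  (Matrix.of fun i : Fin 3 => (ζ y (EuclideanSpace.single i 1)).1
    + (3 : ℝ) • (ζ y (EuclideanSpace.single i 1)).2).det ^ 2 /
  (Matrix.of fun i j : Fin 3 => gV (ζ y (EuclideanSpace.single i 1))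
    (ζ y (EuclideanSpace.single j 1))).det

namespace IsAdapted

variable {n : Fin 3 → V3} {e : Fin 3 → E3} {a b : V3}

theorem eq_sum_single (u : E3) : u = ∑ i, u i • EuclideanSpace.single i (1 : ℝ) := by
  ext j; simp [Finset.sum_apply, Pi.single_apply]

/-- A change of basis of the domain multiplies the squared determinant and the Gram determinant by
the same factor, so the quotient may be computed in the adapted basis. The weight 3 in `invariant`
is chosen so that the seven values differ. -/
theorem invariant_aux (h : IsAdapted ζ x n e a b) :
    (Matrix.of fun i j : Fin 3 => gV (ζ x (EuclideanSpace.single i 1))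
      (ζ x (EuclideanSpace.single j 1))).det ≠ 0 ∧
    invariant ζ x = ((a 0 + 3 * b 0) * (a 1 + 3 * b 1) * (a 2 + 3 * b 2)) ^ 2 := by
  set P : Matrix (Fin 3) (Fin 3) ℝ := Matrix.of fun k i => e k i with hP
  set D : Matrix (Fin 3) (Fin 3) ℝ := Matrix.of fun i : Fin 3 =>
    (ζ x (EuclideanSpace.single i 1)).1 + (3 : ℝ) • (ζ x (EuclideanSpace.single i 1)).2 with hD
  set G : Matrix (Fin 3) (Fin 3) ℝ := Matrix.of fun i j : Fin 3 =>
    gV (ζ x (EuclideanSpace.single i 1)) (ζ x (EuclideanSpace.single j 1)) with hG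
  have hζ : ∀ k, ζ x (e k) = ∑ i, e k i • ζ x (EuclideanSpace.single i 1) := fun k => by
    conv_lhs => rw [eq_sum_single (e k), map_sum]
    simp only [map_smul]
  have h1 : P * D = Matrix.diagonal (fun k => a k + 3 * b k) * Matrix.of n := by
    ext k j
    have := h.apply_eq k
    rw [hζ] at this
    have e1 := congrFun (congrArg Prod.fst this) j
    have e2 := congrFun (congrArg Prod.snd this) j
    simp only [Fin.sum_univ_three, Prod.fst_add, Prod.snd_add, Prod.smul_fst, Prod.smul_snd,
      Pi.add_apply, Pi.smul_apply, smul_eq_mul] at e1 e2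
    rw [Matrix.diagonal_mul, Matrix.mul_apply]
    simp only [hP, hD, Matrix.of_apply, Fin.sum_univ_three, Pi.add_apply, Pi.smul_apply,
      smul_eq_mul]
    linear_combination e1 + 3 * e2
  have h2 : P * G * P.transpose = 1 := by
    ext k l
    have := h.gV_apply k l
    rw [hζ, hζ] at this
    rw [Matrix.one_apply, ← this, Matrix.mul_apply]
    simp only [Matrix.mul_apply, hP, hG, Matrix.of_apply, Matrix.transpose_apply,
      Fin.sum_univ_three, gV, Prod.fst_add, Prod.snd_add, Prod.smul_fst, Prod.smul_snd,
      add_dotProduct, dotProduct_add, smul_dotProduct, dotProduct_smul, smul_eq_mul]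
    ring
  have h3 : Matrix.of n * (Matrix.of n).transpose = 1 := by
    ext i j
    simpa [Matrix.mul_apply, dotProduct, Matrix.one_apply] using h.frame.dot i j
  have d1 := congrArg Matrix.det h1
  have d2 := congrArg Matrix.det h2
  have d3 := congrArg Matrix.det h3
  simp only [Matrix.det_mul, Matrix.det_diagonal, Matrix.det_transpose, Matrix.det_one,
    Fin.prod_univ_three] at d1 d2 d3
  have hG0 : G.det ≠ 0 := by
    intro h0; rw [h0] at d2; simp at d2
  refine ⟨hG0, ?_⟩
  rw [invariant, ← hD, ← hG, div_eq_iff hG0]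
  set q := (a 0 + 3 * b 0) * (a 1 + 3 * b 1) * (a 2 + 3 * b 2)
  have e1 : (P.det * D.det) ^ 2 = q ^ 2 := by
    rw [d1]; linear_combination q ^ 2 * d3
  linear_combination -D.det ^ 2 * d2 + G.det * e1

end IsAdapted

/-- The values of the invariant. -/
def nfVal (c : Fin 7) : ℝ :=
  ![19683 / 64, 27 / 64, 1728, 12, 16875 / 64, 7203 / 64, 243 / 4] c

theorem nfVal_injective : Function.Injective nfVal := by
  intro c d h
  fin_cases c <;> fin_cases d <;> first | rfl | (exfalso; norm_num [nfVal] at h)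

theorem invariant_eq {c : Fin 7} (h : HasNormalForm ζ x c) :
    (Matrix.of fun i j : Fin 3 => gV (ζ x (EuclideanSpace.single i 1))
      (ζ x (EuclideanSpace.single j 1))).det ≠ 0 ∧ invariant ζ x = nfVal c := by
  obtain ⟨n, e, h⟩ := h
  refine ⟨h.invariant_aux.1, h.invariant_aux.2.trans ?_⟩
  have h3 := sqrt_three_sq
  have h6 : (√3 : ℝ) ^ 6 = 27 := by
    calc (√3 : ℝ) ^ 6 = (√3 ^ 2) ^ 3 := by ring
      _ = 27 := by rw [h3]; norm_num
  fin_cases c <;> simp [nfA, nfB, nfVal]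
  · linear_combination 729 / 64 * h6
  · linear_combination 1 / 64 * h6
  · linear_combination 64 * h6
  · linear_combination 4 * h3
  · linear_combination 5625 / 64 * h3
  · linear_combination 2401 / 64 * h3
  · linear_combination 9 / 4 * h6

/-- The invariant is continuous where the Gram determinant does not vanish and takes only seven
values, so near `x` it avoids the other six. -/
theorem eventually_normalForm (hc : ContinuousAt ζ x)
    (h : ∀ᶠ y in 𝓝 x, ∃ c, HasNormalForm ζ y c) {c : Fin 7} (hx : HasNormalForm ζ x c) :
    ∀ᶠ y in 𝓝 x, HasNormalForm ζ y c := by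
  obtain ⟨h1, h2⟩ := invariant_eq hx
  have hcu : ∀ u, ContinuousAt (fun y => ζ y u) x := fun u => hc.clm_apply continuousAt_const
  have hcont : ContinuousAt (invariant ζ) x := by
    refine ContinuousAt.div ?_ ?_ h1
    · refine ContinuousAt.pow ?_ 2
      simp only [Matrix.det_fin_three, Matrix.of_apply, Pi.add_apply, Pi.smul_apply, smul_eq_mul]
      have k1 : ∀ i j, ContinuousAt (fun y => (ζ y (EuclideanSpace.single i 1)).1 j) x :=
        fun i j => (continuous_apply j).continuousAt.comp (hcu _).fst
      have k2 : ∀ i j, ContinuousAt (fun y => (ζ y (EuclideanSpace.single i 1)).2 j) x :=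
        fun i j => (continuous_apply j).continuousAt.comp (hcu _).snd
      fun_prop
    · have k : ∀ u v, ContinuousAt (fun y => gV (ζ y u) (ζ y v)) x := fun u v => by
        have a1 := hcu u
        have a2 := hcu v
        unfold gV dotProduct
        fun_prop
      simp only [Matrix.det_fin_three, Matrix.of_apply]
      fun_prop
  have hne : ∀ d : Fin 7, ∀ᶠ y in 𝓝 x, d ≠ c → invariant ζ y ≠ nfVal d := fun d => by
    by_cases hd : d = c
    · exact Eventually.of_forall fun y hy => absurd hd hy
    · filter_upwards [hcont.eventually_ne (y := nfVal d)
        (by rw [h2]; exact fun h => hd (nfVal_injective h.symm))] with y hy _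
      exact hy
  filter_upwards [h, eventually_all.2 hne] with y ⟨d, hd⟩ hy
  by_cases hdc : d = c
  · exact hdc ▸ hd
  · exact absurd (invariant_eq hd).2 (hy d hdc)

end NearlyKahler

end

noncomputable section

namespace NearlyKahler

open Filter Topology

/-! ### The left trivialization in coordinates -/

/-- The coordinates of the imaginary part of a quaternion. -/
def imV (q : ℍ[ℝ]) : V3 := ![q.imI, q.imJ, q.imK]

/-- The imaginary quaternion with given coordinates. -/
def quat (v : V3) : ℍ[ℝ] := ⟨0, v 0, v 1, v 2⟩

@[simp] theorem quat_re (v : V3) : (quat v).re = 0 := rfl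

@[simp] theorem quat_imI (v : V3) : (quat v).imI = v 0 := rfl

@[simp] theorem quat_imJ (v : V3) : (quat v).imJ = v 1 := rfl

@[simp] theorem quat_imK (v : V3) : (quat v).imK = v 2 := rfl

theorem quat_imV {q : ℍ[ℝ]} (h : q.re = 0) : quat (imV q) = q := by
  ext <;> simp [imV, h]

theorem imV_quat (v : V3) : imV (quat v) = v := by
  ext k; fin_cases k <;> rfl

theorem inner_quat (u v : V3) : inner ℝ (quat u) (quat v) = u ⬝ᵥ v := by
  simp [Quaternion.inner_def, Matrix.vec3_dotProduct]

theorem cross_quat (u v : V3) : cross (quat u) (quat v) = quat (crossProduct u v) := by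
  ext <;> simp [cross, cross_apply] <;> ring

theorem quat_add (u v : V3) : quat (u + v) = quat u + quat v := by ext <;> simp

theorem quat_sub (u v : V3) : quat (u - v) = quat u - quat v := by ext <;> simp

theorem quat_smul (c : ℝ) (v : V3) : quat (c • v) = c • quat v := by ext <;> simp

/-- The imaginary part as a continuous linear map on pairs. -/
def imP : ℍ[ℝ] × ℍ[ℝ] →L[ℝ] V3 × V3 :=
  LinearMap.toContinuousLinearMap
    { toFun := fun Z => (imV Z.1, imV Z.2)
      map_add' := fun Z W => by simp [imV]
      map_smul' := fun c Z => by simp [imV] }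

theorem imP_apply (Z : ℍ[ℝ] × ℍ[ℝ]) : imP Z = (imV Z.1, imV Z.2) := rfl

/-- The inverse of `imP` on pairs of imaginary quaternions, as a continuous linear map. -/
def quatP : V3 × V3 →L[ℝ] ℍ[ℝ] × ℍ[ℝ] :=
  LinearMap.toContinuousLinearMap
    { toFun := fun a => (quat a.1, quat a.2)
      map_add' := fun a b => by simp [quat_add]
      map_smul' := fun c a => by simp [quat_smul] }

theorem quatP_apply (a : V3 × V3) : quatP a = (quat a.1, quat a.2) := rfl

theorem imP_quatP (a : V3 × V3) : imP (quatP a) = a := by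
  rw [quatP_apply, imP_apply, imV_quat, imV_quat]

theorem quatP_imP {Z : ℍ[ℝ] × ℍ[ℝ]} (h1 : Z.1.re = 0) (h2 : Z.2.re = 0) : quatP (imP Z) = Z := by
  rw [imP_apply, quatP_apply, quat_imV h1, quat_imV h2]

theorem leftGamma_quatP (a b : V3 × V3) : leftGamma (quatP a) (quatP b) = quatP (gam a b) := by
  simp only [leftGamma, gam, quatP_apply, cross_quat, quat_add, quat_sub, quat_smul]

theorem gLeft_quatP (a b : V3 × V3) : gLeft (quatP a) (quatP b) = gV a b := by
  simp only [gLeft, gV, quatP_apply, inner_quat]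

/-- The coordinates of a tangent vector in the left trivialization. -/
def trivB : ℍ[ℝ] × ℍ[ℝ] →L[ℝ] ℍ[ℝ] × ℍ[ℝ] →L[ℝ] V3 × V3 :=
  -- Conjugation replaces inversion: on unit quaternions they agree, and the expression becomes
  -- bilinear on the whole space.
  (LinearMap.mk₂ ℝ (fun x Z => imP (star x.1 * Z.1, star x.2 * Z.2))
    (fun x y Z => by simp only [Prod.fst_add, Prod.snd_add, star_add, add_mul, ← map_add]; rfl)
    (fun c x Z => by
      simp only [Prod.smul_fst, Prod.smul_snd, Quaternion.star_smul, smul_mul_assoc, ← map_smul]; rfl)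
    (fun x Z W => by simp only [Prod.fst_add, Prod.snd_add, mul_add, ← map_add]; rfl)
    (fun c x Z => by
      simp only [Prod.smul_fst, Prod.smul_snd, mul_smul_comm, ← map_smul]; rfl)
    ).toContinuousBilinearMap

theorem inv_eq_star_of_norm {p : ℍ[ℝ]} (hp : ‖p‖ = 1) : p⁻¹ = star p := by
  have h : Quaternion.normSq p = 1 := by
    rw [Quaternion.normSq_eq_norm_mul_self, hp, one_mul]
  rw [Quaternion.inv_def, h, inv_one, one_smul]

theorem trivB_apply {x : ℍ[ℝ] × ℍ[ℝ]} (hx : x ∈ S3S3) (Z : ℍ[ℝ] × ℍ[ℝ]) :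
    trivB x Z = imP (leftTriv x Z) := by
  rw [leftTriv, inv_eq_star_of_norm hx.1, inv_eq_star_of_norm hx.2]; rfl

theorem quatP_trivB {x : ℍ[ℝ] × ℍ[ℝ]} (hx : x ∈ S3S3) {Z : ℍ[ℝ] × ℍ[ℝ]}
    (hZ : Z ∈ tangentSpaceAt x) : quatP (trivB x Z) = leftTriv x Z := by
  rw [trivB_apply hx, quatP_imP (leftTriv_re hx hZ).1 (leftTriv_re hx hZ).2]

theorem g_eq_gV {x : ℍ[ℝ] × ℍ[ℝ]} (hx : x ∈ S3S3) {Z W : ℍ[ℝ] × ℍ[ℝ]}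
    (hZ : Z ∈ tangentSpaceAt x) (hW : W ∈ tangentSpaceAt x) :
    g x Z W = gV (trivB x Z) (trivB x W) := by
  rw [g_eq_gLeft hx, ← quatP_trivB hx hZ, ← quatP_trivB hx hW, gLeft_quatP]

theorem leftTriv_J {x : ℍ[ℝ] × ℍ[ℝ]} (hx : x ∈ S3S3) (Z : ℍ[ℝ] × ℍ[ℝ]) :
    leftTriv x (J x Z) = (1 / √3) • ((2 : ℝ) • (leftTriv x Z).2 - (leftTriv x Z).1,
      (leftTriv x Z).2 - (2 : ℝ) • (leftTriv x Z).1) := by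
  have hp : x.1 ≠ 0 := by intro h; have := hx.1; simp [h] at this
  have hq : x.2 ≠ 0 := by intro h; have := hx.2; simp [h] at this
  simp only [leftTriv, J, Prod.smul_mk, mul_smul_comm, mul_sub, mul_add, mul_neg]
  refine Prod.ext ?_ ?_
  · simp only [← mul_assoc, inv_mul_cancel₀ hp, one_mul]
  · simp only [← mul_assoc, inv_mul_cancel₀ hq, one_mul]
    congr 1
    abel

theorem J_mem_tangentSpaceAt {x : ℍ[ℝ] × ℍ[ℝ]} (hx : x ∈ S3S3) {Z : ℍ[ℝ] × ℍ[ℝ]}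
    (hZ : Z ∈ tangentSpaceAt x) : J x Z ∈ tangentSpaceAt x := by
  have hp : x.1 ≠ 0 := by intro h; have := hx.1; simp [h] at this
  have hq : x.2 ≠ 0 := by intro h; have := hx.2; simp [h] at this
  have h1 := leftTriv_re hx hZ
  have h2 : (x.1 * (leftTriv x (J x Z)).1, x.2 * (leftTriv x (J x Z)).2) = J x Z := by
    simp [leftTriv, mul_inv_cancel_left₀ hp, mul_inv_cancel_left₀ hq]
  rw [← h2]
  apply mem_tangentSpaceAt_mul hx <;> rw [leftTriv_J hx] <;> simp [h1.1, h1.2]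

theorem g_J {x : ℍ[ℝ] × ℍ[ℝ]} (hx : x ∈ S3S3) {Z W : ℍ[ℝ] × ℍ[ℝ]}
    (hZ : Z ∈ tangentSpaceAt x) (hW : W ∈ tangentSpaceAt x) :
    g x Z (J x W) = 2 / √3 * kap (trivB x Z) (trivB x W) := by
  have h : trivB x (J x W) = (1 / √3) • ((2 : ℝ) • (trivB x W).2 - (trivB x W).1,
      (trivB x W).2 - (2 : ℝ) • (trivB x W).1) := by
    rw [trivB_apply hx, leftTriv_J hx, trivB_apply hx, map_smul]
    congr 1
    simp only [imP_apply]
    ext k <;> fin_cases k <;> simp [imV]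
  rw [g_eq_gV hx hZ (J_mem_tangentSpaceAt hx hW), h]
  simp only [gV, kap, Prod.smul_fst, Prod.smul_snd, dotProduct_smul, dotProduct_sub,
    smul_eq_mul, dotProduct_comm _ (trivB x Z).2]
  ring

/-- `F` is near `x` a Lagrangian immersion. -/
structure IsLagrangianGerm (F : E3 → ℍ[ℝ] × ℍ[ℝ]) (x : E3) : Prop where
  smooth : ∀ᶠ y in 𝓝 x, ContDiffAt ℝ ∞ F y
  mem : ∀ᶠ y in 𝓝 x, F y ∈ S3S3
  inj : ∀ᶠ y in 𝓝 x, Function.Injective (fderiv ℝ F y)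
  lag : ∀ᶠ y in 𝓝 x, ∀ u v, g (F y) (fderiv ℝ F y u) (J (F y) (fderiv ℝ F y v)) = 0

/-- The differential in the left trivialization. -/
def mcForm (F : E3 → ℍ[ℝ] × ℍ[ℝ]) (y : E3) : E3 →L[ℝ] V3 × V3 := (trivB (F y)).comp (fderiv ℝ F y)

theorem mcForm_apply (F : E3 → ℍ[ℝ] × ℍ[ℝ]) (y v : E3) :
    mcForm F y v = trivB (F y) (fderiv ℝ F y v) := rfl

/-- In the trivialization the Levi-Civita connection is the flat derivative plus `gam`. -/
theorem trivB_covDeriv {F Y : E3 → ℍ[ℝ] × ℍ[ℝ]} {x : E3} (hF : DifferentiableAt ℝ F x)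
    (hS : ∀ᶠ y in 𝓝 x, F y ∈ S3S3) (hT : ∀ᶠ y in 𝓝 x, Y y ∈ tangentSpaceAt (F y))
    (hd : DifferentiableAt ℝ (fun y => trivB (F y) (Y y)) x) (v : E3) :
    covDeriv F Y x v ∈ tangentSpaceAt (F x) ∧
    trivB (F x) (covDeriv F Y x v) = fderiv ℝ (fun y => trivB (F y) (Y y)) x v
      + gam (mcForm F x v) (trivB (F x) (Y x)) := by
  have hx := hS.self_of_nhds
  have e : (fun y => leftTriv (F y) (Y y)) =ᶠ[𝓝 x] fun y => quatP (trivB (F y) (Y y)) := by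
    filter_upwards [hS, hT] with y h1 h2
    exact (quatP_trivB h1 h2).symm
  have h1 : fderiv ℝ (fun y => leftTriv (F y) (Y y)) x v =
      quatP (fderiv ℝ (fun y => trivB (F y) (Y y)) x v) := by
    rw [e.fderiv_eq]
    exact congrArg (· v) (quatP.hasFDerivAt.comp x hd.hasFDerivAt).fderiv
  have h2 : leftGamma (leftTriv (F x) (fderiv ℝ F x v)) (leftTriv (F x) (Y x)) =
      quatP (gam (mcForm F x v) (trivB (F x) (Y x))) := by
    rw [← quatP_trivB hx hT.self_of_nhds, ← quatP_trivB hx (fderiv_mem_tangentSpaceAt hF hS v),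
      leftGamma_quatP, mcForm_apply]
  simp only [covDeriv, h1, h2, ← map_add]
  refine ⟨mem_tangentSpaceAt_mul hx rfl rfl, ?_⟩
  rw [trivB_apply hx, leftTriv_mul hx, imP_quatP]

variable {F : E3 → ℍ[ℝ] × ℍ[ℝ]} {x : E3}

namespace IsLagrangianGerm

theorem eventually_self (h : IsLagrangianGerm F x) : ∀ᶠ y in 𝓝 x, IsLagrangianGerm F y := by
  filter_upwards [eventually_eventually_nhds.2 h.smooth, eventually_eventually_nhds.2 h.mem,
    eventually_eventually_nhds.2 h.inj, eventually_eventually_nhds.2 h.lag] with y h1 h2 h3 h4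
  exact ⟨h1, h2, h3, h4⟩

theorem differentiableAt (h : IsLagrangianGerm F x) : DifferentiableAt ℝ F x :=
  h.smooth.self_of_nhds.differentiableAt (by simp)

theorem fderiv_mem (h : IsLagrangianGerm F x) (v : E3) :
    fderiv ℝ F x v ∈ tangentSpaceAt (F x) :=
  fderiv_mem_tangentSpaceAt h.differentiableAt h.mem v

theorem contDiffAt_mcForm (h : IsLagrangianGerm F x) : ContDiffAt ℝ ∞ (mcForm F) x := by
  have hs := h.smooth.self_of_nhds
  exact (trivB.contDiff.contDiffAt.comp x hs).clm_comp (hs.fderiv_right (m := ∞) (by simp))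

theorem covDeriv_eq (h : IsLagrangianGerm F x) (u v : E3) :
    covDeriv F (fun y => fderiv ℝ F y v) x u ∈ tangentSpaceAt (F x) ∧
    trivB (F x) (covDeriv F (fun y => fderiv ℝ F y v) x u) = Zc (mcForm F) x u v := by
  have hd : DifferentiableAt ℝ (mcForm F) x := h.contDiffAt_mcForm.differentiableAt (by simp)
  obtain ⟨h1, h2⟩ := trivB_covDeriv (Y := fun y => fderiv ℝ F y v) h.differentiableAt h.mem
    (h.eventually_self.mono fun y hy => hy.fderiv_mem v)
    (differentiableAt_clm_apply hd v) u
  refine ⟨h1, h2.trans ?_⟩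
  rw [Zc, ← fderiv_clm_apply_const hd]
  rfl

/-- The Maurer-Cartan equation is the torsion freeness of the ambient connection, and `kap` is the
fundamental form by `g_J`. -/
theorem isLagrangianForm (h : IsLagrangianGerm F x) : IsLagrangianForm (mcForm F) x where
  smooth := h.eventually_self.mono fun y hy => hy.contDiffAt_mcForm
  mc := by
    filter_upwards [h.eventually_self] with y hy u v
    rw [← (hy.covDeriv_eq u v).2, ← (hy.covDeriv_eq v u).2,
      covDeriv_torsionFree (hy.smooth.self_of_nhds.of_le (by norm_cast)) hy.mem.self_of_nhds]
  lag := by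
    filter_upwards [h.eventually_self] with y hy u v
    have h1 := hy.lag.self_of_nhds u v
    rw [g_J hy.mem.self_of_nhds (hy.fderiv_mem u) (hy.fderiv_mem v)] at h1
    exact (mul_eq_zero_iff_left (by simp)).1 h1

theorem injective_mcForm (h : IsLagrangianGerm F x) : Function.Injective (mcForm F x) := by
  rw [injective_iff_map_eq_zero]
  intro v hv
  have hx := h.mem.self_of_nhds
  have h1 := quatP_trivB hx (h.fderiv_mem v)
  rw [← mcForm_apply, hv, map_zero] at h1
  have hp : (F x).1 ≠ 0 := by intro h; have := hx.1; simp [h] at this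
  have hq : (F x).2 ≠ 0 := by intro h; have := hx.2; simp [h] at this
  have h2 := congrArg Prod.fst h1
  have h3 := congrArg Prod.snd h1
  simp only [leftTriv, Prod.fst_zero, Prod.snd_zero, zero_eq_mul, inv_eq_zero, hp, hq,
    false_or] at h2 h3
  exact (injective_iff_map_eq_zero _).1 h.inj.self_of_nhds v (Prod.ext h2 h3)

theorem exists_isAdapted (h : IsLagrangianGerm F x) :
    ∃ n e a b, IsAdapted (mcForm F) x n e a b :=
  NearlyKahler.exists_isAdapted h.injective_mcForm h.isLagrangianForm.lag.self_of_nhds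

theorem g_fderiv (h : IsLagrangianGerm F x) {Z : ℍ[ℝ] × ℍ[ℝ]} (hZ : Z ∈ tangentSpaceAt (F x))
    (v : E3) : g (F x) Z (fderiv ℝ F x v) = gV (trivB (F x) Z) (mcForm F x v) :=
  g_eq_gV h.mem.self_of_nhds hZ (h.fderiv_mem v)

theorem gram_eq (h : IsLagrangianGerm F x) : gram F x =
    Matrix.of fun i j : Fin 3 => gV (mcForm F x (EuclideanSpace.single i 1))
      (mcForm F x (EuclideanSpace.single j 1)) := by
  ext i j
  exact h.g_fderiv (h.fderiv_mem _) _

theorem det_gram_ne_zero (h : IsLagrangianGerm F x) : (gram F x).det ≠ 0 := by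
  obtain ⟨n, e, a, b, h'⟩ := h.exists_isAdapted
  rw [h.gram_eq]
  exact h'.invariant_aux.1

theorem gV_sub_tangentCoord (h : IsLagrangianGerm F x) {Z : ℍ[ℝ] × ℍ[ℝ]}
    (hZ : Z ∈ tangentSpaceAt (F x)) (w : E3) :
    gV (trivB (F x) Z - mcForm F x (tangentCoord F x Z)) (mcForm F x w) = 0 := by
  set t := tangentCoord F x Z with ht
  have hsum : ∀ u, mcForm F x u = ∑ i, u i • mcForm F x (EuclideanSpace.single i 1) := fun u => by
    conv_lhs => rw [IsAdapted.eq_sum_single u, map_sum]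
    simp only [map_smul]
  have h1 : (gram F x).mulVec (fun i => t i) = fun j => g (F x) Z (partialF F x j) := by
    rw [ht, tangentCoord]
    simp only [Matrix.mulVec_mulVec]
    rw [Matrix.mul_nonsing_inv _ (isUnit_iff_ne_zero.2 h.det_gram_ne_zero), Matrix.one_mulVec]
  have h2 : ∀ j, gV (mcForm F x t) (mcForm F x (EuclideanSpace.single j 1)) =
      gV (trivB (F x) Z) (mcForm F x (EuclideanSpace.single j 1)) := fun j => by
    have := congrFun h1 j
    rw [partialF, h.g_fderiv hZ] at this
    rw [← this, hsum t, h.gram_eq]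
    simp only [Matrix.mulVec, dotProduct, Fin.sum_univ_three, Matrix.of_apply, gV_add_left,
      gV_smul_left, gV_comm (mcForm F x (EuclideanSpace.single j 1))]
    ring
  have h3 : ∀ Y Y' X, gV (Y - Y') X = gV Y X - gV Y' X := fun Y Y' X => by
    rw [sub_eq_add_neg, ← neg_one_smul ℝ, gV_add_left, gV_smul_left]; ring
  rw [gV_comm, hsum w]
  simp only [Fin.sum_univ_three, gV_add_left, gV_smul_left]
  simp only [gV_comm _ (trivB (F x) Z - _), h3, h2]
  ring

theorem g_fderiv_J (h : IsLagrangianGerm F x) {Z : ℍ[ℝ] × ℍ[ℝ]} (hZ : Z ∈ tangentSpaceAt (F x))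
    (v : E3) : g (F x) Z (J (F x) (fderiv ℝ F x v)) = 2 / √3 * kap (trivB (F x) Z) (mcForm F x v) :=
  g_J h.mem.self_of_nhds hZ (h.fderiv_mem v)

theorem normalPart_mem (h : IsLagrangianGerm F x) {Z : ℍ[ℝ] × ℍ[ℝ]}
    (hZ : Z ∈ tangentSpaceAt (F x)) : normalPart F x Z ∈ tangentSpaceAt (F x) :=
  Submodule.sub_mem _ hZ (h.fderiv_mem _)

theorem trivB_normalPart (Z : ℍ[ℝ] × ℍ[ℝ]) :
    trivB (F x) (normalPart F x Z) = trivB (F x) Z - mcForm F x (tangentCoord F x Z) := by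
  rw [normalPart, map_sub, mcForm_apply]

theorem kap_normalPart (h : IsLagrangianGerm F x) (Z : ℍ[ℝ] × ℍ[ℝ]) (v : E3) :
    kap (trivB (F x) (normalPart F x Z)) (mcForm F x v) = kap (trivB (F x) Z) (mcForm F x v) := by
  rw [trivB_normalPart, sub_eq_add_neg, ← neg_one_smul ℝ, kap_add_left, kap_smul_left,
    h.isLagrangianForm.lag.self_of_nhds, mul_zero, add_zero]

/-- Cramer's rule writes the inverse Gram matrix as adjugate over determinant, so the coordinates
are polynomials in differentiable functions divided by a nonvanishing one. -/
theorem differentiableAt_tangentCoord (h : IsLagrangianGerm F x) (u v : E3) :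
    DifferentiableAt ℝ
      (fun y => tangentCoord F y (covDeriv F (fun z => fderiv ℝ F z v) y u)) x := by
  have hL := h.isLagrangianForm
  have hd : DifferentiableAt ℝ (mcForm F) x := h.contDiffAt_mcForm.differentiableAt (by simp)
  have hZ := IsLagrangianForm.differentiableAt_Zc (hL.eventually_contDiffAt.self_of_nhds) u v
  have hζ := fun w => differentiableAt_clm_apply hd w
  have hg : ∀ {Y W : E3 → V3 × V3}, DifferentiableAt ℝ Y x → DifferentiableAt ℝ W x →
      DifferentiableAt ℝ (fun y => gV (Y y) (W y)) x := by
    intro Y W hY hW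
    have k : ∀ {A B : E3 → V3}, DifferentiableAt ℝ A x → DifferentiableAt ℝ B x →
        DifferentiableAt ℝ (fun y => A y ⬝ᵥ B y) x := by
      intro A B hA hB
      rw [differentiableAt_pi] at hA hB
      simp only [Matrix.vec3_dotProduct]
      exact (((hA 0).mul (hB 0)).add ((hA 1).mul (hB 1))).add ((hA 2).mul (hB 2))
    exact (((k hY.fst hW.fst).add (k hY.snd hW.snd)).const_mul _).sub
      (((k hY.fst hW.snd).add (k hW.fst hY.snd)).const_mul _)
  set G : E3 → Matrix (Fin 3) (Fin 3) ℝ := fun y =>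
    Matrix.of fun i j : Fin 3 => gV (mcForm F y (EuclideanSpace.single i 1))
      (mcForm F y (EuclideanSpace.single j 1)) with hG
  have hGd : ∀ i j, DifferentiableAt ℝ (fun y => G y i j) x := fun i j => hg (hζ _) (hζ _)
  have hdet : DifferentiableAt ℝ (fun y => (G y).det) x := by
    simp only [Matrix.det_fin_three]
    have := hGd
    fun_prop
  have hadj : ∀ i j, DifferentiableAt ℝ (fun y => (G y).adjugate i j) x := fun i j => by
    have := hGd
    simp only [Matrix.adjugate_fin_three]
    fin_cases i <;> fin_cases j <;> simp <;> fun_prop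
  have hdet0 : (G x).det ≠ 0 := by
    have := h.det_gram_ne_zero
    rwa [h.gram_eq] at this
  have e : (fun y => tangentCoord F y (covDeriv F (fun z => fderiv ℝ F z v) y u)) =ᶠ[𝓝 x]
      fun y => WithLp.toLp 2 (fun i => ∑ j, (G y).det⁻¹ * (G y).adjugate i j *
        gV (Zc (mcForm F) y u v) (mcForm F y (EuclideanSpace.single j 1))) := by
    filter_upwards [h.eventually_self] with y hy
    rw [tangentCoord, hy.gram_eq]
    congr 1
    ext i
    simp only [Matrix.mulVec, dotProduct]
    refine Finset.sum_congr rfl fun j _ => ?_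
    rw [partialF, hy.g_fderiv (hy.covDeriv_eq u v).1, (hy.covDeriv_eq u v).2, Matrix.inv_def,
      Matrix.smul_apply, Ring.inverse_eq_inv', smul_eq_mul]
  refine DifferentiableAt.congr_of_eventuallyEq ?_ e
  rw [differentiableAt_euclidean]
  intro i
  simp only [Fin.sum_univ_three]
  have k := fun j => ((hdet.inv hdet0).mul (hadj i j)).mul (hg hZ (hζ (EuclideanSpace.single j 1)))
  exact ((k 0).add (k 1)).add (k 2)

/-- The cubic form of the covariant derivative of the second fundamental form. -/
theorem g_nablaSecondFF (h : IsLagrangianGerm F x) (v : E3) :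
    ∃ t : E3, (∀ w, gV (Zc (mcForm F) x v v - mcForm F x t) (mcForm F x w) = 0) ∧
      g (F x) (nablaSecondFF F x v v v) (J (F x) (fderiv ℝ F x v)) =
        2 / √3 * (fderiv ℝ (fun y => cub (mcForm F) y v v v) x v
          - 3 * cub (mcForm F) x t v v) := by
  have hL := h.isLagrangianForm
  have hd : DifferentiableAt ℝ (mcForm F) x := h.contDiffAt_mcForm.differentiableAt (by simp)
  have hZd := IsLagrangianForm.differentiableAt_Zc (hL.eventually_contDiffAt.self_of_nhds) v v
  have htd := h.differentiableAt_tangentCoord v v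
  obtain ⟨-, s1, s2⟩ := hL.eventually_tri_eq_zero.self_of_nhds
  obtain ⟨T, hT⟩ : ∃ T : E3 → E3, T = fun y =>
    tangentCoord F y (covDeriv F (fun z => fderiv ℝ F z v) y v) := ⟨_, rfl⟩
  rw [← hT] at htd
  have hTx : indConn F x v v = T x := by rw [hT]; rfl
  have hζT : DifferentiableAt ℝ (fun y => mcForm F y (T y)) x := hd.clm_apply htd
  have hη : ∀ {y}, IsLagrangianGerm F y → secondFF F y v v ∈ tangentSpaceAt (F y) ∧
      trivB (F y) (secondFF F y v v) = Zc (mcForm F) y v v - mcForm F y (T y) := by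
    intro y hy
    refine ⟨hy.normalPart_mem (hy.covDeriv_eq v v).1, ?_⟩
    rw [secondFF, trivB_normalPart, (hy.covDeriv_eq v v).2, hT]
  have e1 : (fun y => trivB (F y) (secondFF F y v v)) =ᶠ[𝓝 x]
      fun y => Zc (mcForm F) y v v - mcForm F y (T y) :=
    h.eventually_self.mono fun y hy => (hη hy).2
  obtain ⟨c1, c2⟩ := trivB_covDeriv (Y := fun y => secondFF F y v v) h.differentiableAt h.mem
    (h.eventually_self.mono fun y hy => (hη hy).1)
    ((hZd.sub hζT).congr_of_eventuallyEq e1) v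
  rw [e1.fderiv_eq, fderiv_fun_sub hZd hζT, (hη h).2] at c2
  have k1 : ∀ s w, trivB (F x) (secondFF F x s w) = Zc (mcForm F) x s w
      - mcForm F x (tangentCoord F x (covDeriv F (fun z => fderiv ℝ F z w) x s)) := fun s w => by
    rw [secondFF, trivB_normalPart, (h.covDeriv_eq s w).2]
  have m1 : ∀ s w, secondFF F x s w ∈ tangentSpaceAt (F x) := fun s w =>
    h.normalPart_mem (h.covDeriv_eq s w).1
  have lag0 := hL.lag.self_of_nhds
  refine ⟨T x, fun w => ?_, ?_⟩
  · have := h.gV_sub_tangentCoord (h.covDeriv_eq v v).1 w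
    rw [(h.covDeriv_eq v v).2] at this
    rw [hT]
    exact this
  have ksub : ∀ Y Y' X, kap (Y - Y') X = kap Y X - kap Y' X := fun Y Y' X => by
    rw [sub_eq_add_neg, ← neg_one_smul ℝ, kap_add_left, kap_smul_left]; ring
  have hmem : nablaSecondFF F x v v v ∈ tangentSpaceAt (F x) :=
    Submodule.sub_mem _ (Submodule.sub_mem _ (h.normalPart_mem c1) (m1 _ _)) (m1 _ _)
  rw [h.g_fderiv_J hmem]
  congr 1
  rw [nablaSecondFF, map_sub, map_sub, ksub, ksub, h.kap_normalPart, c2, k1, k1, ksub, ksub, lag0,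
    lag0, sub_zero, sub_zero, hTx, kap_add_left, sub_apply, ksub]
  have hDζ : fderiv ℝ (mcForm F) x v v = Zc (mcForm F) x v v
      - gam (mcForm F x v) (mcForm F x v) := by rw [Zc, add_sub_cancel_right]
  -- The pairing of the tangential field `T` with `v` vanishes identically; its derivative gives one
  -- of the three terms `cub T v v`. The other two are the corrections `h(∇_v v, v)` and `h(v, ∇_v
  -- v)`.
  have f1 : kap (fderiv ℝ (fun y => mcForm F y (T y)) x v) (mcForm F x v)
      + kap (mcForm F x (T x)) (fderiv ℝ (mcForm F) x v v) = 0 := by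
    have hz : (fun y => kap (mcForm F y (T y)) (mcForm F y v)) =ᶠ[𝓝 x] fun _ => (0 : ℝ) :=
      hL.lag.mono fun y hy => hy _ _
    have := fderiv_kap hζT (differentiableAt_clm_apply hd v) v
    rw [hz.fderiv_eq, fderiv_clm_apply_const hd] at this
    rw [← this]; simp
  have f2 : fderiv ℝ (fun y => cub (mcForm F) y v v v) x v =
      kap (fderiv ℝ (fun y => Zc (mcForm F) y v v) x v) (mcForm F x v)
      + kap (Zc (mcForm F) x v v) (fderiv ℝ (mcForm F) x v v) := by
    rw [← fderiv_clm_apply_const hd]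
    exact fderiv_kap hZd (differentiableAt_clm_apply hd v) v
  -- This is `tri z η z = 0`; it cancels the terms with `gam`.
  have f3 : ∀ η z, kap η (gam z z) + kap (gam z η) z = 0 := fun η z => by
    have h1 := tri_swap_right z η z
    simp only [tri] at h1
    have h2 := tri_swap_left z η z
    simp only [tri] at h2
    simp only [kap, gam, cross_apply, Matrix.vec3_dotProduct, Pi.add_apply,
      Pi.sub_apply, Pi.smul_apply, smul_eq_mul, Matrix.cons_val]
    ring
  have f4 := f3 (Zc (mcForm F) x v v - mcForm F x (T x)) (mcForm F x v)
  rw [ksub] at f4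
  rw [hDζ] at f1 f2
  have kc : ∀ Y X X', kap Y (X - X') = kap Y X - kap Y X' := fun Y X X' => by
    rw [kap_comm, ksub, kap_comm X, kap_comm X']; ring
  rw [kc] at f1 f2
  have f5 : kap (Zc (mcForm F) x v v) (Zc (mcForm F) x v v) = 0 := by
    have := kap_comm (Zc (mcForm F) x v v) (Zc (mcForm F) x v v); linarith
  have f6 : kap (Zc (mcForm F) x v v) (mcForm F x (T x)) = cub (mcForm F) x (T x) v v := by
    rw [s1, s2]; rfl
  rw [kap_comm] at f6
  have f7 : kap (Zc (mcForm F) x v (T x)) (mcForm F x v) = cub (mcForm F) x (T x) v v := by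
    rw [s1]; rfl
  have f8 : kap (Zc (mcForm F) x (T x) v) (mcForm F x v) = cub (mcForm F) x (T x) v v := rfl
  rw [f7, f8]
  linarith

end IsLagrangianGerm

end NearlyKahler

end

noncomputable section

namespace NearlyKahler

open Filter Topology

/-! ### Lagrangian immersions of manifolds -/

theorem g_comm (x Z W : ℍ[ℝ] × ℍ[ℝ]) : g x Z W = g x W Z := by
  simp only [g, stdInner, real_inner_comm]

/-- The normal form depends only on the image of the linear map, not on its parametrization. -/
theorem HasNormalForm.of_comp {ζ ζ' : E3 → E3 →L[ℝ] V3 × V3} {x x' : E3} {c : Fin 7}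
    (h : HasNormalForm ζ x c) {L : E3 →L[ℝ] E3} (hL : Function.Surjective L)
    (heq : ∀ v, ζ' x' v = ζ x (L v)) : HasNormalForm ζ' x' c := by
  obtain ⟨n, e, h⟩ := h
  choose e' he' using fun k => hL (e k)
  exact ⟨n, e', h.frame, fun k => by rw [heq, he', h.apply_eq], h.norm_eq⟩

variable {M : Type*} [TopologicalSpace M] [ChartedSpace E3 M] [IsManifold (𝓡 3) ∞ M]
  {f : M → ℍ[ℝ] × ℍ[ℝ]}

namespace IsLagrangianImmersion

theorem fderiv_localExpr_eq (hf : IsLagrangianImmersion f) (p : M) {y : E3}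
    (hy : y ∈ (extChartAt (𝓡 3) p).target) : ContDiffAt ℝ ∞ (localExpr f p) y ∧
    ∃ L : E3 ≃L[ℝ] E3, ∀ v, fderiv ℝ (localExpr f p) y v =
      diff f ((extChartAt (𝓡 3) p).symm y) (L v) := by
  have ho : (extChartAt (𝓡 3) p).target ∈ 𝓝 y := (isOpen_extChartAt_target p).mem_nhds hy
  have h1 : ContMDiffAt (𝓡 3) (𝓡 3) ∞ (extChartAt (𝓡 3) p).symm y :=
    (contMDiffOn_extChartAt_symm (n := ∞) p).contMDiffAt ho
  have h2 : ContMDiffAt (𝓡 3) 𝓘(ℝ, ℍ[ℝ] × ℍ[ℝ]) ∞ (localExpr f p) y :=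
    (hf.smooth _).comp y h1
  refine ⟨h2.contDiffAt, ?_⟩
  have h3 := isInvertible_mfderivWithin_extChartAt_symm (I := 𝓡 3) hy
  rw [ModelWithCorners.range_eq_univ, mfderivWithin_univ] at h3
  obtain ⟨L, hL⟩ := h3
  refine ⟨L, fun v => ?_⟩
  have h4 := mfderiv_comp_apply y ((hf.smooth ((extChartAt (𝓡 3) p).symm y)).mdifferentiableAt
    (by simp)) (h1.mdifferentiableAt (by simp)) v
  rw [← hL] at h4
  rw [← mfderiv_eq_fderiv]
  exact h4

theorem isLagrangianGerm (hf : IsLagrangianImmersion f) (p : M) {y : E3}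
    (hy : y ∈ (extChartAt (𝓡 3) p).target) : IsLagrangianGerm (localExpr f p) y := by
  have ho : ∀ᶠ z in 𝓝 y, z ∈ (extChartAt (𝓡 3) p).target :=
    (isOpen_extChartAt_target p).mem_nhds hy
  refine ⟨ho.mono fun z hz => (hf.fderiv_localExpr_eq p hz).1, ho.mono fun z hz => hf.maps_to _,
    ho.mono fun z hz => ?_, ho.mono fun z hz u v => ?_⟩
  · obtain ⟨L, hL⟩ := (hf.fderiv_localExpr_eq p hz).2
    intro u v huv
    rw [hL, hL] at huv
    exact L.injective (hf.immersion _ huv)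
  · obtain ⟨L, hL⟩ := (hf.fderiv_localExpr_eq p hz).2
    rw [hL, hL, g_comm]
    have : J (f ((extChartAt (𝓡 3) p).symm z)) (diff f ((extChartAt (𝓡 3) p).symm z) (L v)) ∈
        normalSpace f ((extChartAt (𝓡 3) p).symm z) := by
      rw [← (hf.lagrangian _).1]
      exact ⟨_, ⟨_, rfl⟩, rfl⟩
    exact this.2 _

theorem exists_normalForm_self (hf : IsLagrangianImmersion f) {lam : M → ℝ}
    (hlam : IsJIsotropic f lam) (p : M) : lam p = 0 ∧
    ∃ c, HasNormalForm (mcForm (localExpr f p)) (extChartAt (𝓡 3) p p) c := by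
  have h := hf.isLagrangianGerm p (mem_extChartAt_target (I := 𝓡 3) p)
  obtain ⟨n, e, a, b, ha⟩ := h.exists_isAdapted
  have hFx : localExpr f p (extChartAt (𝓡 3) p p) = f p := by simp [localExpr]
  have hD := fderiv_localExpr ((hf.smooth p).mdifferentiableAt (by simp))
  have h3 : (√3 : ℝ) ≠ 0 := by simp
  -- The factor `√3 / 2` compensates `g (·, J ·) = 2 / √3 * kap`.
  obtain ⟨h1, h2⟩ := ha.exists_normalForm h.isLagrangianForm (lam := √3 / 2 * lam p) fun v => by
    obtain ⟨t, ht, h1⟩ := h.g_nablaSecondFF v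
    rw [ha.nabC_self h.isLagrangianForm ht]
    have h2 := hlam p v
    rw [nablaH, ← hD, ← hFx, h1, h.g_fderiv (h.fderiv_mem v)] at h2
    rw [← mcForm_apply] at h2
    rw [mul_assoc, ← h2]
    field_simp
  exact ⟨by simpa using h1, h2⟩

/-- Isotropy is stated at each point in its own preferred chart. This transfers its consequences to
all points of one fixed chart, where derivatives can be taken. -/
theorem hasNormalForm_localExpr (hf : IsLagrangianImmersion f) (p : M) {y : E3}
    (hy : y ∈ (extChartAt (𝓡 3) p).target) {p' : M} (hp' : (extChartAt (𝓡 3) p).symm y = p')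
    {c : Fin 7} (hc : HasNormalForm (mcForm (localExpr f p')) (extChartAt (𝓡 3) p' p') c) :
    HasNormalForm (mcForm (localExpr f p)) y c := by
  obtain ⟨-, L, hL⟩ := hf.fderiv_localExpr_eq p hy
  refine hc.of_comp (L := (L : E3 →L[ℝ] E3)) L.surjective fun v => ?_
  have hD := fderiv_localExpr ((hf.smooth p').mdifferentiableAt (by simp))
  have hFx : localExpr f p' (extChartAt (𝓡 3) p' p') = f p' := by simp [localExpr]
  rw [mcForm_apply, mcForm_apply, hL, hp', hD, hFx, ← hp']
  rfl

theorem exists_normalForm (hf : IsLagrangianImmersion f) {lam : M → ℝ}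
    (hlam : IsJIsotropic f lam) (p : M) {y : E3} (hy : y ∈ (extChartAt (𝓡 3) p).target) :
    ∃ c, HasNormalForm (mcForm (localExpr f p)) y c := by
  obtain ⟨-, c, hc⟩ := hf.exists_normalForm_self hlam ((extChartAt (𝓡 3) p).symm y)
  exact ⟨c, hf.hasNormalForm_localExpr p hy rfl hc⟩

/-- The normal form is locally constant. -/
theorem eventually_normalForm (hf : IsLagrangianImmersion f) {lam : M → ℝ}
    (hlam : IsJIsotropic f lam) (p : M) : ∃ c, ∀ᶠ y in 𝓝 (extChartAt (𝓡 3) p p),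
      HasNormalForm (mcForm (localExpr f p)) y c := by
  have hy := mem_extChartAt_target (I := 𝓡 3) p
  obtain ⟨c, hc⟩ := hf.exists_normalForm hlam p hy
  refine ⟨c, NearlyKahler.eventually_normalForm
    (hf.isLagrangianGerm p hy).contDiffAt_mcForm.continuousAt ?_ hc⟩
  filter_upwards [(isOpen_extChartAt_target (I := 𝓡 3) p).mem_nhds hy] with y hy
  exact hf.exists_normalForm hlam p hy

end IsLagrangianImmersion

end NearlyKahler

end

noncomputable section

namespace NearlyKahler

open Filter Topology

/-! ### Construction of local congruences -/

variable {M : Type*} [TopologicalSpace M] [ChartedSpace E3 M] [IsManifold (𝓡 3) ∞ M]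
  {f : M → ℍ[ℝ] × ℍ[ℝ]}

/-- By the inverse function theorem `G` is a local diffeomorphism; composing with the charts of both
manifolds gives the reparametrization. -/
theorem locallyCongruentAt_of_eventually {D : Type*} [TopologicalSpace D] [ChartedSpace E3 D]
    [IsManifold (𝓡 3) ∞ D] {p : M} {ψ : D → ℍ[ℝ] × ℍ[ℝ]} {G : E3 → D}
    (hG : ∀ᶠ y in 𝓝 (extChartAt (𝓡 3) p p), ContMDiffAt (𝓡 3) (𝓡 3) ∞ G y)
    (hinj : Function.Injective (mfderiv (𝓡 3) (𝓡 3) G (extChartAt (𝓡 3) p p)))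
    {a b c : ℍ[ℝ]} (ha : ‖a‖ = 1) (hb : ‖b‖ = 1) (hc : ‖c‖ = 1)
    (h : ∀ᶠ y in 𝓝 (extChartAt (𝓡 3) p p), localExpr f p y = nkIsometry a b c (ψ (G y))) :
    LocallyCongruentAt f p ψ := by
  set y₀ := extChartAt (𝓡 3) p p with hy₀
  set H : E3 → E3 := chartAt E3 (G y₀) ∘ G with hH
  have hsrc : ∀ᶠ y in 𝓝 y₀, G y ∈ (chartAt E3 (G y₀)).source :=
    hG.self_of_nhds.continuousAt.eventually_mem
      ((chartAt E3 (G y₀)).open_source.mem_nhds (mem_chart_source E3 (G y₀)))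
  have hHs : ∀ᶠ y in 𝓝 y₀, ContDiffAt ℝ ∞ H y := by
    filter_upwards [hsrc, hG] with y h1 h2
    exact (ContMDiffAt.comp y (contMDiffAt_extChartAt' (I := 𝓡 3) (n := ∞) h1) h2).contDiffAt
  have hinjH : Function.Injective (fderiv ℝ H y₀) := by
    have h1 := mem_chart_source E3 (G y₀)
    have h2 := mfderiv_comp y₀ ((contMDiffAt_extChartAt' (I := 𝓡 3) (n := ∞) h1).mdifferentiableAt
      (by simp)) (hG.self_of_nhds.mdifferentiableAt (by simp))
    have h3 : (mfderiv (𝓡 3) 𝓘(ℝ, E3) (extChartAt (𝓡 3) (G y₀)) (G y₀)).IsInvertible :=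
      isInvertible_mfderiv_extChartAt (mem_extChartAt_source (G y₀))
    rw [← mfderiv_eq_fderiv]
    change Function.Injective (mfderiv 𝓘(ℝ, E3) 𝓘(ℝ, E3) (extChartAt (𝓡 3) (G y₀) ∘ G) y₀)
    rw [h2]
    exact h3.injective.comp hinj
  obtain ⟨L, hL⟩ : ∃ L : E3 ≃L[ℝ] E3, (L : E3 →L[ℝ] E3) = fderiv ℝ H y₀ :=
    ⟨(LinearEquiv.ofInjectiveEndo _ hinjH).toContinuousLinearEquiv, by ext1 v; rfl⟩
  have hfd : ContinuousAt (fderiv ℝ H) y₀ :=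
    (hHs.self_of_nhds.fderiv_right (m := ∞) (by simp)).continuousAt
  -- Invertibility of the derivative is open, so the inverse is smooth on a whole neighbourhood and
  -- not only at the image of `y₀`.
  have hLe : ∀ᶠ y in 𝓝 y₀, fderiv ℝ H y ∈ Set.range ((↑) : (E3 ≃L[ℝ] E3) → E3 →L[ℝ] E3) :=
    hfd.eventually_mem (hL ▸ L.nhds)
  obtain ⟨N, hN, hNo, hyN⟩ := eventually_nhds_iff.1 (hG.and (hsrc.and (hHs.and (hLe.and h))))
  have hfd0 : HasFDerivAt H (L : E3 →L[ℝ] E3) y₀ :=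
    hL ▸ (hHs.self_of_nhds.differentiableAt (by simp)).hasFDerivAt
  set h0 := hHs.self_of_nhds.toOpenPartialHomeomorph H hfd0 (by simp) with hh0
  have hcoe : ∀ y, h0 y = H y := fun y => by
    rw [hh0, ContDiffAt.toOpenPartialHomeomorph_coe]
  have hy0 : y₀ ∈ h0.source := ContDiffAt.mem_toOpenPartialHomeomorph_source _ hfd0 (by simp)
  set h1 := h0.restrOpen N hNo with hh1
  have h1src : ∀ {y}, y ∈ h1.source ↔ y ∈ h0.source ∧ y ∈ N := by
    intro y; rw [hh1, OpenPartialHomeomorph.restrOpen_source]; rfl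
  have h1coe : ∀ y, h1 y = H y := hcoe
  have h1smooth : ContDiffOn ℝ ∞ h1 h1.source := fun y hy =>
    ((hN y (h1src.1 hy).2).2.2.1.congr_of_eventuallyEq
      (Eventually.of_forall h1coe)).contDiffWithinAt
  have h1symm : ContDiffOn ℝ ∞ h1.symm h1.target := fun z hz => by
    have hy := h1src.1 (h1.map_target hz)
    obtain ⟨L', hL'⟩ := (hN _ hy.2).2.2.2.1
    have hs := (hN _ hy.2).2.2.1
    refine (h1.contDiffAt_symm hz (f₀' := L') ?_ ?_).contDiffWithinAt
    · rw [hL']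
      exact (hs.differentiableAt (by simp)).hasFDerivAt.congr_of_eventuallyEq
        (Eventually.of_forall h1coe)
    · exact hs.congr_of_eventuallyEq (Eventually.of_forall h1coe)
  set Θ : OpenPartialHomeomorph M D := ((chartAt E3 p).trans h1).trans (chartAt E3 (G y₀)).symm
    with hΘ
  have hΘsrc : ∀ {x}, x ∈ Θ.source → x ∈ (chartAt E3 p).source ∧ chartAt E3 p x ∈ h1.source := by
    intro x hx
    have h2 : x ∈ ((chartAt E3 p).trans h1).source := by
      rw [hΘ, OpenPartialHomeomorph.trans_source] at hx
      exact hx.1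
    rwa [OpenPartialHomeomorph.trans_source] at h2
  have hΘcoe : ∀ x, Θ x = (chartAt E3 (G y₀)).symm (h1 (chartAt E3 p x)) := fun x => rfl
  have hΘG : ∀ {x}, x ∈ Θ.source → Θ x = G (chartAt E3 p x) := by
    intro x hx
    rw [hΘcoe, h1coe]
    exact (chartAt E3 (G y₀)).left_inv (hN _ (h1src.1 (hΘsrc hx).2).2).2.1
  refine ⟨a, b, c, ha, hb, hc, Θ, ?_, ?_, ?_, ?_⟩
  · rw [hΘ, OpenPartialHomeomorph.trans_source, OpenPartialHomeomorph.trans_source]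
    refine ⟨⟨mem_chart_source E3 p, h1src.2 ⟨hy0, hyN⟩⟩, ?_⟩
    change h1 y₀ ∈ (chartAt E3 (G y₀)).target
    rw [h1coe]
    exact mem_chart_target E3 (G y₀)
  · have k1 : ContMDiffOn (𝓡 3) (𝓡 3) ∞ (h1 ∘ chartAt E3 p) Θ.source :=
      h1smooth.contMDiffOn.comp (contMDiffOn_chart.mono fun x hx => (hΘsrc hx).1)
        fun x hx => (hΘsrc hx).2
    refine (contMDiffOn_chart_symm (x := G y₀)).comp k1 fun x hx => ?_
    rw [hΘ, OpenPartialHomeomorph.trans_source] at hx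
    exact hx.2
  · have hT : Θ.target = (chartAt E3 (G y₀)).source ∩ (chartAt E3 (G y₀)) ⁻¹'
        ((chartAt E3 p).trans h1).target := by
      rw [hΘ, OpenPartialHomeomorph.trans_target]; rfl
    have k1 : ContMDiffOn (𝓡 3) (𝓡 3) ∞ (h1.symm ∘ chartAt E3 (G y₀)) Θ.target := by
      refine h1symm.contMDiffOn.comp (contMDiffOn_chart.mono fun x hx => ?_) fun x hx => ?_
      · rw [hT] at hx; exact hx.1
      · rw [hT] at hx
        have := hx.2
        rw [Set.mem_preimage, OpenPartialHomeomorph.trans_target] at this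
        exact this.1
    refine (contMDiffOn_chart_symm (x := p)).comp k1 fun x hx => ?_
    rw [hT] at hx
    have := hx.2
    rw [Set.mem_preimage, OpenPartialHomeomorph.trans_target] at this
    exact this.2
  · intro x hx
    rw [hΘG hx, ← (hN _ (h1src.1 (hΘsrc hx).2).2).2.2.2.2]
    change f x = f ((chartAt E3 p).symm (chartAt E3 p x))
    rw [(chartAt E3 p).left_inv (hΘsrc hx).1]

/-- The chart of the sphere at `G y` is stereographic projection from the antipode, which is the
restriction of a map smooth near `G y` in the ambient space. -/
theorem contMDiffAt_of_coe_sphere {G : E3 → S3} {y : E3}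
    (h : ContDiffAt ℝ ∞ (fun z => (G z : ℍ[ℝ])) y) : ContMDiffAt (𝓡 3) (𝓡 3) ∞ G y := by
  rw [contMDiffAt_iff_target]
  refine ⟨Topology.IsInducing.subtypeVal.continuousAt_iff.2 h.continuousAt, ?_⟩
  apply ContDiffAt.contMDiffAt
  set v : S3 := -(G y) with hv
  let U : _ ≃ₗᵢ[ℝ] EuclideanSpace ℝ (Fin 3) :=
    (OrthonormalBasis.fromOrthogonalSpanSingleton (𝕜 := ℝ) 3
      (ne_zero_of_mem_unit_sphere v)).repr
  have hn : ‖(G y : ℍ[ℝ])‖ = 1 := by simp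
  have h1 : ContDiffAt ℝ ∞ (stereoToFun (v : ℍ[ℝ])) (G y) := by
    refine (contDiffOn_stereoToFun (n := ∞)).contDiffAt (IsOpen.mem_nhds ?_ ?_)
    · exact isOpen_ne_fun (by fun_prop) (by fun_prop)
    · simp only [Set.mem_ofPred_eq, hv, innerSL_apply_apply, ne_eq]
      have : inner ℝ ((-(G y) : S3) : ℍ[ℝ]) (G y : ℍ[ℝ]) = -1 := by
        change inner ℝ (-(G y : ℍ[ℝ])) (G y : ℍ[ℝ]) = -1
        rw [inner_neg_left, real_inner_self_eq_norm_sq, hn]; norm_num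
      rw [this]; norm_num
  have h2 : ContDiffAt ℝ ∞ (fun z => stereoToFun (v : ℍ[ℝ]) (G z : ℍ[ℝ])) y :=
    ContDiffAt.comp (g := stereoToFun (v : ℍ[ℝ])) (f := fun z => (G z : ℍ[ℝ])) y h1 h
  exact U.contDiff.contDiffAt.comp (g := U) y h2

theorem injective_mfderiv_of_coe_sphere {G : E3 → S3} {y : E3}
    (h : ContDiffAt ℝ ∞ (fun z => (G z : ℍ[ℝ])) y)
    (hinj : Function.Injective (fderiv ℝ (fun z => (G z : ℍ[ℝ])) y)) :
    Function.Injective (mfderiv (𝓡 3) (𝓡 3) G y) := by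
  have h1 := (contMDiffAt_of_coe_sphere h).mdifferentiableAt (by simp)
  have h2 := (contMDiff_coe_sphere (E := ℍ[ℝ]) (n := 3) (m := ∞) (G y)).mdifferentiableAt (by simp)
  have h3 := mfderiv_comp y h2 h1
  have h4 : mfderiv (𝓡 3) 𝓘(ℝ, ℍ[ℝ]) (((↑) : S3 → ℍ[ℝ]) ∘ G) y =
    fderiv ℝ (fun z => (G z : ℍ[ℝ])) y := mfderiv_eq_fderiv
  rw [h4] at h3
  rw [h3] at hinj
  exact Function.Injective.of_comp hinj

/-- A local congruence with a map on `S³` from a local parametrization by unit quaternions. -/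
theorem locallyCongruentAt_sphere {p : M} {ψ : S3 → ℍ[ℝ] × ℍ[ℝ]} {u : E3 → ℍ[ℝ]}
    (hu : ∀ᶠ y in 𝓝 (extChartAt (𝓡 3) p p), ContDiffAt ℝ ∞ u y)
    (hu1 : ∀ᶠ y in 𝓝 (extChartAt (𝓡 3) p p), ‖u y‖ = 1)
    (hinj : Function.Injective (fderiv ℝ u (extChartAt (𝓡 3) p p)))
    {a b c : ℍ[ℝ]} (ha : ‖a‖ = 1) (hb : ‖b‖ = 1) (hc : ‖c‖ = 1)
    (h : ∀ᶠ y in 𝓝 (extChartAt (𝓡 3) p p), ∀ U : S3, (U : ℍ[ℝ]) = u y →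
      localExpr f p y = nkIsometry a b c (ψ U)) :
    LocallyCongruentAt f p ψ := by
  classical
  set G : E3 → S3 := fun y => if hy : ‖u y‖ = 1 then ⟨u y, by simpa using hy⟩
    else ⟨u (extChartAt (𝓡 3) p p), by simpa using hu1.self_of_nhds⟩ with hG
  have hGu : ∀ {y}, ‖u y‖ = 1 → (G y : ℍ[ℝ]) = u y := fun hy => by simp [hG, hy]
  have hev : ∀ᶠ y in 𝓝 (extChartAt (𝓡 3) p p), (fun z => (G z : ℍ[ℝ])) =ᶠ[𝓝 y] u := by
    filter_upwards [eventually_eventually_nhds.2 hu1] with y hy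
    exact hy.mono fun z hz => hGu hz
  have hs : ∀ᶠ y in 𝓝 (extChartAt (𝓡 3) p p), ContDiffAt ℝ ∞ (fun z => (G z : ℍ[ℝ])) y := by
    filter_upwards [hev, hu] with y h1 h2
    exact h2.congr_of_eventuallyEq h1
  refine locallyCongruentAt_of_eventually (G := G) (hs.mono fun y hy => contMDiffAt_of_coe_sphere hy)
    (injective_mfderiv_of_coe_sphere hs.self_of_nhds ?_) ha hb hc ?_
  · rw [hev.self_of_nhds.fderiv_eq]; exact hinj
  · filter_upwards [h, hu1] with y h1 h2
    exact h1 _ (hGu h2)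

/-- A local congruence with a map on `ℝ³` from a local parametrization. -/
theorem locallyCongruentAt_euclidean {p : M} {ψ : E3 → ℍ[ℝ] × ℍ[ℝ]} {u : E3 → E3}
    (hu : ∀ᶠ y in 𝓝 (extChartAt (𝓡 3) p p), ContDiffAt ℝ ∞ u y)
    (hinj : Function.Injective (fderiv ℝ u (extChartAt (𝓡 3) p p)))
    {a b c : ℍ[ℝ]} (ha : ‖a‖ = 1) (hb : ‖b‖ = 1) (hc : ‖c‖ = 1)
    (h : ∀ᶠ y in 𝓝 (extChartAt (𝓡 3) p p), localExpr f p y = nkIsometry a b c (ψ (u y))) :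
    LocallyCongruentAt f p ψ :=
  locallyCongruentAt_of_eventually (hu.mono fun _ hy => hy.contMDiffAt)
    (by rw [mfderiv_eq_fderiv]; exact hinj) ha hb hc h

end NearlyKahler

end

noncomputable section

namespace NearlyKahler

open Filter Topology

/-! ### Logarithmic derivatives of maps to the unit quaternions -/

theorem star_mul_self_of_norm {u : ℍ[ℝ]} (h : ‖u‖ = 1) : star u * u = 1 := by
  rw [← inv_eq_star_of_norm h, inv_mul_cancel₀]
  rintro rfl; simp at h

theorem mul_star_self_of_norm {u : ℍ[ℝ]} (h : ‖u‖ = 1) : u * star u = 1 := by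
  rw [← inv_eq_star_of_norm h, mul_inv_cancel₀]
  rintro rfl; simp at h

theorem star_quat (v : V3) : star (quat v) = -quat v := by
  ext <;> simp

/-- The imaginary part as a continuous linear map. -/
def imL : ℍ[ℝ] →L[ℝ] V3 :=
  LinearMap.toContinuousLinearMap
    { toFun := imV
      map_add' := fun Z W => by simp [imV]
      map_smul' := fun c Z => by simp [imV] }

/-- The embedding of `ℝ³` as imaginary quaternions as a continuous linear map. -/
def quatL : V3 →L[ℝ] ℍ[ℝ] :=
  LinearMap.toContinuousLinearMap
    { toFun := quat
      map_add' := quat_add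
      map_smul' := quat_smul }

theorem quatL_apply (v : V3) : quatL v = quat v := rfl

theorem imL_apply (q : ℍ[ℝ]) : imL q = imV q := rfl

/-- Quaternion conjugation as a continuous linear map. -/
def starQ : ℍ[ℝ] →L[ℝ] ℍ[ℝ] :=
  LinearMap.toContinuousLinearMap
    { toFun := star
      map_add' := fun Z W => star_add Z W
      map_smul' := fun c Z => Quaternion.star_smul c Z }

theorem starQ_apply (q : ℍ[ℝ]) : starQ q = star q := rfl

/-- The rotation `v ↦ w̄ v w`. -/
def rotL (w : ℍ[ℝ]) : V3 →L[ℝ] V3 :=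
  imL.comp (((ContinuousLinearMap.mul ℝ ℍ[ℝ]).flip w).comp
    ((ContinuousLinearMap.mul ℝ ℍ[ℝ] (star w)).comp quatL))

theorem rotL_apply (w : ℍ[ℝ]) (v : V3) : rotL w v = imV (star w * quat v * w) := rfl

theorem quat_rotL (w : ℍ[ℝ]) (v : V3) : quat (rotL w v) = star w * quat v * w := by
  rw [rotL_apply, quat_imV]
  simp only [Quaternion.re_mul, Quaternion.imI_mul, Quaternion.imJ_mul, Quaternion.imK_mul,
    Quaternion.re_star, Quaternion.imI_star, Quaternion.imJ_star, Quaternion.imK_star,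
    quat_re, quat_imI, quat_imJ, quat_imK]
  ring

theorem quat_injective : Function.Injective quat := fun u v h => by
  rw [← imV_quat u, h, imV_quat]

theorem inner_mul_unit {w : ℍ[ℝ]} (hw : ‖w‖ = 1) (a b : ℍ[ℝ]) :
    inner ℝ (a * w) (b * w) = inner ℝ a b := by
  have h := inner_unit_mul (p := star w) (by simpa using hw) (star a) (star b)
  rw [← star_mul, ← star_mul] at h
  have hs : ∀ a b : ℍ[ℝ], inner ℝ (star a) (star b) = inner ℝ a b := fun a b => by
    simp [Quaternion.inner_def]
  rwa [hs, hs] at h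

theorem rotL_dot {w : ℍ[ℝ]} (hw : ‖w‖ = 1) (u v : V3) : rotL w u ⬝ᵥ rotL w v = u ⬝ᵥ v := by
  have hw' : ‖star w‖ = 1 := by simpa using hw
  rw [← inner_quat, quat_rotL, quat_rotL, inner_mul_unit hw, inner_unit_mul hw', inner_quat]

theorem rotL_star_rotL {w : ℍ[ℝ]} (hw : ‖w‖ = 1) (v : V3) : rotL (star w) (rotL w v) = v := by
  apply quat_injective
  rw [quat_rotL, quat_rotL, star_star]
  have h := mul_star_self_of_norm hw
  calc w * (star w * quat v * w) * star w = (w * star w) * quat v * (w * star w) := by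
        simp only [mul_assoc]
    _ = quat v := by rw [h, one_mul, mul_one]

theorem rotL_injective {w : ℍ[ℝ]} (hw : ‖w‖ = 1) : Function.Injective (rotL w) := fun u v h => by
  rw [← rotL_star_rotL hw u, h, rotL_star_rotL hw]

/-- The rotation by `π`. -/
theorem rotL_quat {n : V3} (hn : n ⬝ᵥ n = 1) (v : V3) : rotL (quat n) v = (2 * (n ⬝ᵥ v)) • n - v := by
  rw [Matrix.vec3_dotProduct] at hn
  ext k
  fin_cases k <;> simp [rotL_apply, imV, Matrix.vec3_dotProduct]
  · linear_combination -v 0 * hn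
  · linear_combination -v 1 * hn
  · linear_combination -v 2 * hn

/-- `u` is near `x` a smooth map to the unit quaternions with logarithmic derivative `α`. -/
structure HasLog (u : E3 → ℍ[ℝ]) (α : E3 → E3 →L[ℝ] V3) (x : E3) : Prop where
  norm_eq : ∀ᶠ y in 𝓝 x, ‖u y‖ = 1
  smooth : ∀ᶠ y in 𝓝 x, ContDiffAt ℝ ∞ u y
  fderiv_eq : ∀ᶠ y in 𝓝 x, ∀ v, fderiv ℝ u y v = u y * quat (α y v)

theorem eventuallyEq_const_of_fderiv {V : Type*} [NormedAddCommGroup V] [NormedSpace ℝ V]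
    {k : E3 → V} {x : E3} (hd : ∀ᶠ y in 𝓝 x, DifferentiableAt ℝ k y)
    (h0 : ∀ᶠ y in 𝓝 x, fderiv ℝ k y = 0) : ∀ᶠ y in 𝓝 x, k y = k x := by
  obtain ⟨r, hr, hB⟩ := Metric.eventually_nhds_iff_ball.1 (hd.and h0)
  filter_upwards [Metric.ball_mem_nhds x hr] with y hy
  exact (convex_ball x r).is_const_of_fderivWithin_eq_zero (𝕜 := ℝ)
    (fun z hz => (hB z hz).1.differentiableWithinAt)
    (fun z hz => by rw [fderivWithin_of_isOpen Metric.isOpen_ball hz, (hB z hz).2])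
    hy (Metric.mem_ball_self hr)

theorem fderiv_mul_apply {u w : E3 → ℍ[ℝ]} {A B : E3 →L[ℝ] ℍ[ℝ]} {y : E3}
    (hu : HasFDerivAt u A y) (hw : HasFDerivAt w B y) (v : E3) :
    fderiv ℝ (fun z => u z * w z) y v = u y * B v + A v * w y := by
  have h : HasFDerivAt (fun z => u z * w z) _ y := hu.mul' hw
  rw [h.fderiv]
  simp

variable {u w : E3 → ℍ[ℝ]} {α η : E3 → E3 →L[ℝ] V3} {x : E3}

namespace HasLog

theorem congr (h : HasLog u α x) (he : ∀ᶠ y in 𝓝 x, ∀ v, α y v = η y v) : HasLog u η x where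
  norm_eq := h.norm_eq
  smooth := h.smooth
  fderiv_eq := by
    filter_upwards [h.fderiv_eq, he] with y h1 h2 v
    rw [h1, h2]

theorem eventually_differentiableAt (h : HasLog u α x) :
    ∀ᶠ y in 𝓝 x, DifferentiableAt ℝ u y :=
  h.smooth.mono fun _ hy => hy.differentiableAt (by simp)

theorem eventually_self (h : HasLog u α x) : ∀ᶠ y in 𝓝 x, HasLog u α y := by
  filter_upwards [eventually_eventually_nhds.2 h.norm_eq, eventually_eventually_nhds.2 h.smooth,
    eventually_eventually_nhds.2 h.fderiv_eq] with y h1 h2 h3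
  exact ⟨h1, h2, h3⟩

theorem eq_form (h : HasLog u α x) : α =ᶠ[𝓝 x] fun y =>
    imL.comp ((ContinuousLinearMap.mul ℝ ℍ[ℝ] (starQ (u y))).comp (fderiv ℝ u y)) := by
  filter_upwards [h.norm_eq, h.fderiv_eq] with y h1 h2
  ext1 v
  simp only [ContinuousLinearMap.comp_apply, h2, ContinuousLinearMap.mul_apply', starQ_apply,
    imL_apply]
  rw [← mul_assoc, star_mul_self_of_norm h1, one_mul, imV_quat]

theorem eventually_contDiffAt (h : HasLog u α x) : ∀ᶠ y in 𝓝 x, ContDiffAt ℝ ∞ α y := by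
  filter_upwards [h.smooth, h.eq_form.eventually_nhds] with y h1 h2
  refine ContDiffAt.congr_of_eventuallyEq ?_ h2
  exact contDiffAt_const.clm_comp
    (((ContinuousLinearMap.mul ℝ ℍ[ℝ]).contDiff.contDiffAt.comp y
      (starQ.contDiff.contDiffAt.comp y h1)).clm_comp (h1.fderiv_right (m := ∞) (by simp)))

theorem contDiffAt_apply (h : HasLog u α x) (v : E3) : ContDiffAt ℝ ∞ (fun y => α y v) x :=
  h.eventually_contDiffAt.self_of_nhds.clm_apply contDiffAt_const

/-- The Maurer-Cartan equation. -/
theorem maurerCartan (h : HasLog u α x) (s t : E3) :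
    fderiv ℝ (fun y => α y t) x s - fderiv ℝ (fun y => α y s) x t =
      (-2 : ℝ) • crossProduct (α x s) (α x t) := by
  have hs := h.smooth.self_of_nhds
  have hd : DifferentiableAt ℝ u x := hs.differentiableAt (by simp)
  have hdu : DifferentiableAt ℝ (fderiv ℝ u) x :=
    (hs.fderiv_right (m := ∞) (by simp)).differentiableAt (by simp)
  have hsym : fderiv ℝ (fderiv ℝ u) x s t = fderiv ℝ (fderiv ℝ u) x t s :=
    (hs.of_le (m := 2) (by norm_cast)).isSymmSndFDerivAt (by simp) s t
  have key : ∀ s t, fderiv ℝ (fderiv ℝ u) x s t = u x * (quat (α x s) * quat (α x t)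
      + quat (fderiv ℝ (fun y => α y t) x s)) := by
    intro s t
    have hα : DifferentiableAt ℝ (fun y => α y t) x :=
      (h.contDiffAt_apply t).differentiableAt (by simp)
    have e : (fun y => fderiv ℝ u y t) =ᶠ[𝓝 x] fun y => u y * quatL (α y t) :=
      h.fderiv_eq.mono fun y hy => hy t
    have h1 := e.fderiv_eq (𝕜 := ℝ)
    have h2 : fderiv ℝ (fun y => fderiv ℝ u y t) x s = fderiv ℝ (fderiv ℝ u) x s t := by
      rw [fderiv_clm_apply hdu (differentiableAt_const t)]; simp
    have h3 : HasFDerivAt (fun y => quatL (α y t)) (quatL.comp (fderiv ℝ (fun y => α y t) x)) x :=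
      quatL.hasFDerivAt.comp x hα.hasFDerivAt
    rw [← h2, h1, fderiv_mul_apply hd.hasFDerivAt h3]
    simp [h.fderiv_eq.self_of_nhds, quatL_apply, mul_add, mul_assoc, add_comm]
  rw [key s t, key t s] at hsym
  have hu : u x ≠ 0 := by
    intro h0; have := h.norm_eq.self_of_nhds; simp [h0] at this
  have h4 := mul_left_cancel₀ hu hsym
  apply quat_injective
  rw [quat_sub, quat_smul, ← cross_quat, cross, smul_smul, eq_sub_of_add_eq' h4]
  norm_num
  abel

/-- The derivative of `u * star w` vanishes, because the common logarithmic derivative is imaginary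
and its conjugate has the opposite sign. -/
theorem exists_eq_mul (h : HasLog u α x) (h' : HasLog w α x) :
    ∃ c : ℍ[ℝ], ‖c‖ = 1 ∧ ∀ᶠ y in 𝓝 x, u y = c * w y := by
  refine ⟨u x * star (w x), by simp [h.norm_eq.self_of_nhds, h'.norm_eq.self_of_nhds], ?_⟩
  have hst : ∀ {y}, DifferentiableAt ℝ w y →
      HasFDerivAt (fun z => starQ (w z)) (starQ.comp (fderiv ℝ w y)) y := fun hy =>
    starQ.hasFDerivAt.comp _ hy.hasFDerivAt
  have := eventuallyEq_const_of_fderiv (k := fun y => u y * starQ (w y)) (x := x) ?_ ?_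
  · filter_upwards [this, h'.norm_eq] with y h1 h2
    simp only [starQ_apply] at h1
    rw [← h1, mul_assoc, star_mul_self_of_norm h2, mul_one]
  · filter_upwards [h.eventually_differentiableAt, h'.eventually_differentiableAt] with y h1 h2
    exact h1.mul (hst h2).differentiableAt
  · filter_upwards [h.eventually_differentiableAt, h'.eventually_differentiableAt, h.fderiv_eq,
      h'.fderiv_eq] with y h1 h2 h3 h4
    ext1 v
    rw [fderiv_mul_apply h1.hasFDerivAt (hst h2)]
    simp [h3, h4, starQ_apply, star_quat, mul_assoc]

theorem const {c : ℍ[ℝ]} (hc : ‖c‖ = 1) : HasLog (fun _ => c) (fun _ => 0) x where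
  norm_eq := Eventually.of_forall fun _ => hc
  smooth := Eventually.of_forall fun _ => contDiffAt_const
  fderiv_eq := Eventually.of_forall fun y v => by
    simp only [fderiv_fun_const, Pi.zero_apply, zero_apply]
    rw [show quat 0 = 0 from map_zero quatL, mul_zero]

theorem mul (h : HasLog u α x) (h' : HasLog w η x) :
    HasLog (fun y => u y * w y) (fun y => (rotL (w y)).comp (α y) + η y) x where
  norm_eq := by
    filter_upwards [h.norm_eq, h'.norm_eq] with y h1 h2
    rw [norm_mul, h1, h2, one_mul]
  smooth := by
    filter_upwards [h.smooth, h'.smooth] with y h1 h2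
    exact h1.mul h2
  fderiv_eq := by
    filter_upwards [h.eventually_differentiableAt, h'.eventually_differentiableAt, h.fderiv_eq,
      h'.fderiv_eq, h'.norm_eq] with y h1 h2 h3 h4 h5 v
    rw [fderiv_mul_apply h1.hasFDerivAt h2.hasFDerivAt]
    simp only [add_apply, ContinuousLinearMap.comp_apply, quat_add, quat_rotL, h3, h4, mul_add]
    have h6 := mul_star_self_of_norm h5
    calc u y * (w y * quat (η y v)) + u y * quat (α y v) * w y
        = u y * (1 * quat (α y v) * w y) + u y * w y * quat (η y v) := by
          rw [one_mul, mul_assoc, mul_assoc, add_comm]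
      _ = _ := by rw [← h6]; simp only [mul_assoc]

theorem mul_const (h : HasLog u α x) {c : ℍ[ℝ]} (hc : ‖c‖ = 1) :
    HasLog (fun y => u y * c) (fun y => (rotL c).comp (α y)) x :=
  (h.mul (const hc)).congr (Eventually.of_forall fun y v => by simp)

theorem star (h : HasLog u α x) :
    HasLog (fun y => star (u y)) (fun y => -(rotL (star (u y))).comp (α y)) x where
  norm_eq := h.norm_eq.mono fun y hy => by simpa using hy
  smooth := h.smooth.mono fun y hy => starQ.contDiff.contDiffAt.comp y hy
  fderiv_eq := by
    filter_upwards [h.eventually_differentiableAt, h.fderiv_eq, h.norm_eq] with y h1 h2 h3 v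
    have h4 : HasFDerivAt (fun z => Star.star (u z)) (starQ.comp (fderiv ℝ u y)) y :=
      starQ.hasFDerivAt.comp y h1.hasFDerivAt
    rw [h4.fderiv]
    have h5 : quat (-(rotL (Star.star (u y))) (α y v)) =
        -(u y * quat (α y v) * Star.star (u y)) := by
      rw [← neg_one_smul ℝ, quat_smul, quat_rotL, star_star, neg_one_smul]
    simp only [ContinuousLinearMap.comp_apply, h2, starQ_apply, star_mul, star_quat,
      neg_apply]
    rw [h5]
    have h6 := star_mul_self_of_norm h3
    calc -quat (α y v) * Star.star (u y) = -(1 * quat (α y v) * Star.star (u y)) := by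
          rw [one_mul, neg_mul]
      _ = _ := by rw [← h6]; simp only [mul_assoc, mul_neg]

theorem injective_fderiv (h : HasLog u α x) (hi : Function.Injective (α x)) :
    Function.Injective (fderiv ℝ u x) := by
  intro v v' hv
  rw [h.fderiv_eq.self_of_nhds, h.fderiv_eq.self_of_nhds] at hv
  have hu : u x ≠ 0 := by
    intro h0; have := h.norm_eq.self_of_nhds; simp [h0] at this
  exact hi (quat_injective (mul_left_cancel₀ hu hv))

end HasLog

namespace IsLagrangianGerm

variable {F : E3 → ℍ[ℝ] × ℍ[ℝ]}

theorem hasLog_fst (h : IsLagrangianGerm F x) : HasLog (fun y => (F y).1)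
    (fun y => (ContinuousLinearMap.fst ℝ V3 V3).comp (mcForm F y)) x where
  norm_eq := h.mem.mono fun y hy => hy.1
  smooth := h.smooth.mono fun y hy => hy.fst
  fderiv_eq := by
    filter_upwards [h.eventually_self] with y hy v
    have h1 := quatP_trivB hy.mem.self_of_nhds (hy.fderiv_mem v)
    have h2 : quat (mcForm F y v).1 = (F y).1⁻¹ * (fderiv ℝ F y v).1 := congrArg Prod.fst h1
    have hp : (F y).1 ≠ 0 := by
      intro h0; have := hy.mem.self_of_nhds.1; simp [h0] at this
    rw [fderiv.fst hy.differentiableAt]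
    simp only [ContinuousLinearMap.comp_apply, ContinuousLinearMap.coe_fst', h2]
    rw [mul_inv_cancel_left₀ hp]

theorem hasLog_snd (h : IsLagrangianGerm F x) : HasLog (fun y => (F y).2)
    (fun y => (ContinuousLinearMap.snd ℝ V3 V3).comp (mcForm F y)) x where
  norm_eq := h.mem.mono fun y hy => hy.2
  smooth := h.smooth.mono fun y hy => hy.snd
  fderiv_eq := by
    filter_upwards [h.eventually_self] with y hy v
    have h1 := quatP_trivB hy.mem.self_of_nhds (hy.fderiv_mem v)
    have h2 : quat (mcForm F y v).2 = (F y).2⁻¹ * (fderiv ℝ F y v).2 := congrArg Prod.snd h1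
    have hp : (F y).2 ≠ 0 := by
      intro h0; have := hy.mem.self_of_nhds.2; simp [h0] at this
    rw [fderiv.snd hy.differentiableAt]
    simp only [ContinuousLinearMap.comp_apply, ContinuousLinearMap.coe_snd', h2]
    rw [mul_inv_cancel_left₀ hp]

end IsLagrangianGerm

end NearlyKahler

end

noncomputable section

namespace NearlyKahler

open Filter Topology

/-! ### Forms that differ by a rotation by `π` -/

/-- The dot product as a continuous bilinear map. -/
def dotL : V3 →L[ℝ] V3 →L[ℝ] ℝ :=
  (LinearMap.mk₂ ℝ (fun u v : V3 => u ⬝ᵥ v) add_dotProduct smul_dotProduct dotProduct_add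
    (fun c u v => dotProduct_smul c u v)).toContinuousBilinearMap

theorem dotL_apply (u v : V3) : dotL u v = u ⬝ᵥ v := rfl

section Derivative

variable {E : Type*} [NormedAddCommGroup E] [NormedSpace ℝ E] {x : E}

theorem differentiableAt_dot {f k : E → V3} (hf : DifferentiableAt ℝ f x)
    (hk : DifferentiableAt ℝ k x) : DifferentiableAt ℝ (fun y => f y ⬝ᵥ k y) x :=
  (dotL.hasFDerivAt_of_bilinear hf.hasFDerivAt hk.hasFDerivAt).differentiableAt

theorem fderiv_dot {f k : E → V3} (hf : DifferentiableAt ℝ f x) (hk : DifferentiableAt ℝ k x)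
    (v : E) : fderiv ℝ (fun y => f y ⬝ᵥ k y) x v =
      f x ⬝ᵥ fderiv ℝ k x v + fderiv ℝ f x v ⬝ᵥ k x := by
  have := (dotL.hasFDerivAt_of_bilinear hf.hasFDerivAt hk.hasFDerivAt).fderiv
  simp only [dotL_apply] at this
  rw [this]
  simp [dotL_apply]

theorem contDiffAt_dot {f k : E → V3} (hf : ContDiffAt ℝ ∞ f x) (hk : ContDiffAt ℝ ∞ k x) :
    ContDiffAt ℝ ∞ (fun y => f y ⬝ᵥ k y) x :=
  (dotL.contDiff.contDiffAt.comp x hf).clm_apply hk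

theorem fderiv_smul_apply {c : E → ℝ} {f : E → V3} (hc : DifferentiableAt ℝ c x)
    (hf : DifferentiableAt ℝ f x) (v : E) : fderiv ℝ (fun y => c y • f y) x v =
      c x • fderiv ℝ f x v + fderiv ℝ c x v • f x := by
  have h := (hc.hasFDerivAt.smul hf.hasFDerivAt).fderiv
  change fderiv ℝ (fun y => c y • f y) x = _ at h
  rw [h]
  simp

end Derivative

theorem cross_reflect {n : V3} (hn : n ⬝ᵥ n = 1) (u v : V3) :
    crossProduct ((2 * (n ⬝ᵥ u)) • n - u) ((2 * (n ⬝ᵥ v)) • n - v) =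
      (2 * (n ⬝ᵥ crossProduct u v)) • n - crossProduct u v := by
  rw [Matrix.vec3_dotProduct] at hn
  simp only [cross_apply, Matrix.vec3_dotProduct, Pi.sub_apply, Pi.smul_apply, smul_eq_mul]
  ext k
  fin_cases k <;> simp
  · linear_combination (2 * (u 2 * v 1 - u 1 * v 2)) * hn
  · linear_combination (2 * (u 0 * v 2 - u 2 * v 0)) * hn
  · linear_combination (2 * (u 1 * v 0 - u 0 * v 1)) * hn

theorem dot_cross_cross {n : V3} (hn : n ⬝ᵥ n = 1) (u v : V3) :
    n ⬝ᵥ crossProduct (crossProduct n u) (crossProduct n v) = n ⬝ᵥ crossProduct u v := by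
  rw [Matrix.vec3_dotProduct] at hn
  simp only [cross_apply, Matrix.vec3_dotProduct, Matrix.cons_val]
  linear_combination (n 0 * (u 1 * v 2 - u 2 * v 1) - n 1 * (u 0 * v 2 - u 2 * v 0)
    + n 2 * (u 0 * v 1 - u 1 * v 0)) * hn

theorem qi_eq_quat : qi = quat ![1, 0, 0] := by ext <;> simp [qi]

theorem qj_eq_quat : qj = quat ![0, 1, 0] := by ext <;> simp [qj]

/-- A unit imaginary quaternion is conjugate to `i`. -/
theorem exists_conj_qi {n : V3} (hn : n ⬝ᵥ n = 1) :
    ∃ w : ℍ[ℝ], ‖w‖ = 1 ∧ quat n = w * qi * star w := by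
  have hnn : quat n * quat n = -1 := by
    rw [Matrix.vec3_dotProduct] at hn
    ext <;> simp <;> linarith
  have hii : qi * qi = -1 := by ext <;> simp [qi_eq_quat]
  suffices ∃ z : ℍ[ℝ], z ≠ 0 ∧ quat n * z = z * qi by
    obtain ⟨z, hz, h⟩ := this
    have hz' : ‖z‖ ≠ 0 := norm_ne_zero_iff.2 hz
    refine ⟨‖z‖⁻¹ • z, by rw [norm_smul, norm_inv, norm_norm, inv_mul_cancel₀ hz'], ?_⟩
    have h1 : ‖‖z‖⁻¹ • z‖ = 1 := by rw [norm_smul, norm_inv, norm_norm, inv_mul_cancel₀ hz']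
    have h2 := mul_star_self_of_norm h1
    rw [smul_mul_assoc, ← h, ← mul_smul_comm, mul_assoc, h2, mul_one]
  -- Since `n² = i² = -1`, the sum `n + i` intertwines `n` and `i`. If it is zero, then `n = -i` and
  -- `j` does so.
  by_cases h : quat n + qi = 0
  · refine ⟨qj, fun h0 => by simpa [qj_eq_quat] using congrArg QuaternionAlgebra.imJ h0, ?_⟩
    rw [eq_neg_of_add_eq_zero_left h]
    ext <;> simp [qi_eq_quat, qj_eq_quat]
  · exact ⟨_, h, by rw [mul_add, add_mul, hnn, hii, add_comm]⟩

variable {p q : E3 → ℍ[ℝ]} {a b : E3 → E3 →L[ℝ] V3} {x : E3}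

theorem surjective_of_injective {L : E3 →L[ℝ] V3} (h : Function.Injective L) :
    Function.Surjective L :=
  (LinearMap.injective_iff_surjective_of_finrank_eq_finrank (f := L.toLinearMap) (by simp)).1 h

/-- A unit vector field `n` such that `a` and `b = 2⟨a, n⟩n - a` satisfy the Maurer-Cartan
equation is constant to first order. -/
theorem fderiv_eq_zero_of_reflection (hp : HasLog p a x) (hq : HasLog q b x)
    (hinj : ∀ᶠ y in 𝓝 x, Function.Injective (a y)) {n : E3 → V3}
    (hn : ∀ᶠ y in 𝓝 x, ContDiffAt ℝ ∞ n y) (hn1 : ∀ᶠ y in 𝓝 x, n y ⬝ᵥ n y = 1)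
    (h : ∀ᶠ y in 𝓝 x, ∀ v, b y v = (2 * (n y ⬝ᵥ a y v)) • n y - a y v) :
    fderiv ℝ n x = 0 := by
  set τ : E3 → E3 → ℝ := fun v y => n y ⬝ᵥ a y v with hτ
  have hda : ∀ᶠ y in 𝓝 x, ∀ v, DifferentiableAt ℝ (fun y => a y v) y := by
    filter_upwards [hp.eventually_self] with y hy v
    exact (hy.contDiffAt_apply v).differentiableAt (by simp)
  have hdn : ∀ᶠ y in 𝓝 x, DifferentiableAt ℝ n y := hn.mono fun y hy => hy.differentiableAt (by simp)
  have hdτ : ∀ᶠ y in 𝓝 x, ∀ v, DifferentiableAt ℝ (τ v) y := by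
    filter_upwards [hda, hdn] with y h1 h2 v
    exact differentiableAt_dot h2 (h1 v)
  have hnn : ∀ᶠ y in 𝓝 x, ∀ s, n y ⬝ᵥ fderiv ℝ n y s = 0 := by
    filter_upwards [hdn, hn1.eventually_nhds] with y h1 h2 s
    have h3 := fderiv_dot h1 h1 s
    have h4 : (fun y => n y ⬝ᵥ n y) =ᶠ[𝓝 y] fun _ => (1 : ℝ) := h2
    rw [h4.fderiv_eq, dotProduct_comm (fderiv ℝ n y s)] at h3
    simp at h3
    linarith
  have hfirst : ∀ᶠ y in 𝓝 x, ∀ s t,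
      (fderiv ℝ (τ t) y s - fderiv ℝ (τ s) y t = -2 * (n y ⬝ᵥ crossProduct (a y s) (a y t))) ∧
      τ t y • fderiv ℝ n y s = τ s y • fderiv ℝ n y t := by
    filter_upwards [hp.eventually_self, hq.eventually_self, hda, hdn, hdτ, hnn, hn1,
      h.eventually_nhds] with y hp hq hda hdn hdτ hnn hn1 h s t
    have hb : ∀ s t, fderiv ℝ (fun y => b y t) y s =
        (2 : ℝ) • (τ t y • fderiv ℝ n y s + fderiv ℝ (τ t) y s • n y)
          - fderiv ℝ (fun y => a y t) y s := by
      intro s t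
      have e : (fun y => b y t) =ᶠ[𝓝 y] fun y => (2 : ℝ) • (τ t y • n y) - a y t :=
        h.mono fun z hz => (hz t).trans (by rw [mul_smul])
      have h1 : DifferentiableAt ℝ (fun y => τ t y • n y) y := (hdτ t).smul hdn
      have h2 : DifferentiableAt ℝ (fun y => (2 : ℝ) • (τ t y • n y)) y := h1.const_smul (2 : ℝ)
      rw [e.fderiv_eq, fderiv_fun_sub h2 (hda t), sub_apply,
        fderiv_fun_const_smul h1, smul_apply, fderiv_smul_apply (hdτ t) hdn]
    have h1 := hp.maurerCartan s t
    have h2 := hq.maurerCartan s t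
    rw [hb, hb, h.self_of_nhds, h.self_of_nhds, cross_reflect hn1] at h2
    set κ := fderiv ℝ (τ t) y s - fderiv ℝ (τ s) y t with hκ
    set W := τ t y • fderiv ℝ n y s - τ s y • fderiv ℝ n y t with hW
    set ν := n y ⬝ᵥ crossProduct (a y s) (a y t) with hν
    -- Comparing the two Maurer-Cartan equations. As `n` is a unit field, `W` is also orthogonal to
    -- `n`, hence both sides vanish: `dτ = -2 ⟨n, a × a⟩` and `dn` is proportional to `τ`.
    have h3 : W = (-2 * ν - κ) • n y := by
      have h4 : (2 : ℝ) • W + (2 * κ) • n y - (fderiv ℝ (fun y => a y t) y s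
          - fderiv ℝ (fun y => a y s) y t) =
          (-2 : ℝ) • ((2 * ν) • n y - crossProduct (a y s) (a y t)) := by
        rw [← h2, hW, hκ]; module
      rw [h1] at h4
      have h5 : (2 : ℝ) • W = (2 : ℝ) • ((-2 * ν - κ) • n y) := by
        have h6 := eq_add_of_sub_eq h4
        rw [eq_sub_of_add_eq h6]; module
      exact smul_right_injective _ (two_ne_zero (α := ℝ)) h5
    have h4 : n y ⬝ᵥ W = 0 := by
      rw [hW, dotProduct_sub, dotProduct_smul, dotProduct_smul, hnn, hnn]; simp
    have h5 : -2 * ν - κ = 0 := by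
      rw [h3, dotProduct_smul, hn1] at h4
      simpa using h4
    refine ⟨by linarith, ?_⟩
    rw [h5, zero_smul] at h3
    exact sub_eq_zero.1 h3
  have hfd : DifferentiableAt ℝ (fderiv ℝ n) x :=
    (hn.self_of_nhds.fderiv_right (m := ∞) (by simp)).differentiableAt (by simp)
  have hfdv : ∀ v, DifferentiableAt ℝ (fun y => fderiv ℝ n y v) x := fun v =>
    hfd.clm_apply (differentiableAt_const v)
  have hsym : ∀ s t, fderiv ℝ (fun y => fderiv ℝ n y s) x t =
      fderiv ℝ (fun y => fderiv ℝ n y t) x s := by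
    intro s t
    have h1 : ∀ v w, fderiv ℝ (fun y => fderiv ℝ n y v) x w = fderiv ℝ (fderiv ℝ n) x w v :=
      fun v w => by rw [fderiv_clm_apply hfd (differentiableAt_const v)]; simp
    rw [h1, h1]
    exact (hn.self_of_nhds.of_le (m := 2) (by norm_cast)).isSymmSndFDerivAt (by simp) t s
  have hsurj := surjective_of_injective hinj.self_of_nhds
  obtain ⟨r, hr⟩ := hsurj (n x)
  have hτr : τ r x = 1 := by simp only [hτ, hr, hn1.self_of_nhds]
  have hf := hfirst.self_of_nhds
  have hN : ∀ s, fderiv ℝ n x s = τ s x • fderiv ℝ n x r := fun s => by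
    rw [← (hf s r).2, hτr, one_smul]
  -- Write `dn = τ ⊗ N` with `N` the derivative along `r`, where `τ r = 1`. On the kernel of `τ`,
  -- the symmetry of the second derivative of `n` leaves `dτ(s, t) N = 0`.
  have hsecond : ∀ s t, τ s x = 0 → τ t x = 0 →
      fderiv ℝ (fun y => fderiv ℝ n y s) x t = fderiv ℝ (τ s) x t • fderiv ℝ n x r := by
    intro s t hs ht
    have e : (fun y => τ r y • fderiv ℝ n y s) =ᶠ[𝓝 x] fun y => τ s y • fderiv ℝ n y r :=
      hfirst.mono fun y hy => (hy s r).2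
    have h1 := fderiv_smul_apply (hdτ.self_of_nhds r) (hfdv s) t
    rw [e.fderiv_eq, fderiv_smul_apply (hdτ.self_of_nhds s) (hfdv r) t, hs, hτr, hN s, hs] at h1
    simpa using h1.symm
  -- The form `τ` is a contact form: `dτ` is a nonzero multiple of the area form on its kernel,
  -- which consists of the preimages of the vectors `n × u`. Hence `N = 0`.
  have hzero : ∀ u₁ u₂ : V3, (n x ⬝ᵥ crossProduct u₁ u₂) • fderiv ℝ n x r = 0 := by
    intro u₁ u₂
    obtain ⟨s, hs⟩ := hsurj (crossProduct (n x) u₁)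
    obtain ⟨t, ht⟩ := hsurj (crossProduct (n x) u₂)
    have hs0 : τ s x = 0 := by simp only [hτ, hs, dot_self_cross]
    have ht0 : τ t x = 0 := by simp only [hτ, ht, dot_self_cross]
    have h1 := hsym s t
    rw [hsecond s t hs0 ht0, hsecond t s ht0 hs0] at h1
    have h2 := (hf s t).1
    rw [hs, ht, dot_cross_cross hn1.self_of_nhds] at h2
    have h3 : n x ⬝ᵥ crossProduct u₁ u₂ =
        -(1 / 2) * (fderiv ℝ (τ t) x s - fderiv ℝ (τ s) x t) := by rw [h2]; ring
    rw [h3, mul_smul, sub_smul, h1, sub_self, smul_zero]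
  have hNr : fderiv ℝ n x r = 0 := by
    have h0 := hzero ![0, 1, 0] ![0, 0, 1]
    have h1 := hzero ![0, 0, 1] ![1, 0, 0]
    have h2 := hzero ![1, 0, 0] ![0, 1, 0]
    simp [cross_apply, Matrix.vecHead, Matrix.vecTail] at h0 h1 h2
    by_contra hne
    have k0 := h0.resolve_right hne
    have k1 := h1.resolve_right hne
    have k2 := h2.resolve_right hne
    have := hn1.self_of_nhds
    rw [Matrix.vec3_dotProduct, k0, k1, k2] at this
    norm_num at this
  ext1 s
  rw [hN s, hNr, smul_zero, zero_apply]

/-- A rotation by π about a constant axis `n` is conjugation by the quaternion `n`, so `p * n` has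
the logarithmic derivative of `q`; finally `n` is conjugate to `i`. -/
theorem exists_eq_mul_conj (hp : HasLog p a x) (hq : HasLog q b x)
    (hinj : ∀ᶠ y in 𝓝 x, Function.Injective (a y))
    (h : ∀ᶠ y in 𝓝 x, ∃ n : V3, n ⬝ᵥ n = 1 ∧ ∀ v, b y v = (2 * (n ⬝ᵥ a y v)) • n - a y v) :
    ∃ c w : ℍ[ℝ], ‖c‖ = 1 ∧ ‖w‖ = 1 ∧ ∀ᶠ y in 𝓝 x, q y = c * p y * (w * qi * star w) := by
  obtain ⟨n₀, hn₀, hb₀⟩ := h.self_of_nhds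
  obtain ⟨v₀, hv₀⟩ := surjective_of_injective hinj.self_of_nhds n₀
  -- The axes are given only pointwise and up to sign. The field `a v₀ + b v₀ = 2⟨n, a v₀⟩ n` is
  -- smooth, points along the axis and is nonzero near `x`, so its normalization is a smooth choice.
  set m : E3 → V3 := fun y => a y v₀ + b y v₀ with hm
  have hms : ∀ᶠ y in 𝓝 x, ContDiffAt ℝ ∞ m y := by
    filter_upwards [hp.eventually_self, hq.eventually_self] with y h1 h2
    exact (h1.contDiffAt_apply v₀).add (h2.contDiffAt_apply v₀)
  have hmx : m x ⬝ᵥ m x ≠ 0 := by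
    simp only [hm, hb₀, hv₀, hn₀]
    norm_num [hn₀]
  have hm0 : ∀ᶠ y in 𝓝 x, m y ⬝ᵥ m y ≠ 0 :=
    (contDiffAt_dot hms.self_of_nhds hms.self_of_nhds).continuousAt.eventually_ne hmx
  set n : E3 → V3 := fun y => (√(m y ⬝ᵥ m y))⁻¹ • m y with hn
  have hpos : ∀ {v : V3}, v ⬝ᵥ v ≠ 0 → 0 < v ⬝ᵥ v := fun {v} hv =>
    lt_of_le_of_ne (by simpa using dotProduct_star_self_nonneg v) (Ne.symm hv)
  have hsq : ∀ {v : V3}, v ⬝ᵥ v ≠ 0 → (√(v ⬝ᵥ v))⁻¹ * (√(v ⬝ᵥ v))⁻¹ = (v ⬝ᵥ v)⁻¹ := fun {v} hv => by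
    rw [← mul_inv, Real.mul_self_sqrt (hpos hv).le]
  have hns : ∀ᶠ y in 𝓝 x, ContDiffAt ℝ ∞ n y := by
    filter_upwards [hms, hm0] with y h1 h2
    exact (((contDiffAt_dot h1 h1).sqrt h2).inv (Real.sqrt_pos.2 (hpos h2)).ne').smul h1
  have hn1 : ∀ᶠ y in 𝓝 x, n y ⬝ᵥ n y = 1 := by
    filter_upwards [hm0] with y h1
    simp only [hn, smul_dotProduct, dotProduct_smul, smul_eq_mul]
    rw [← mul_assoc, hsq h1, inv_mul_cancel₀ h1]
  have hrefl : ∀ᶠ y in 𝓝 x, ∀ v, b y v = (2 * (n y ⬝ᵥ a y v)) • n y - a y v := by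
    filter_upwards [h, hm0] with y ⟨k, hk, hb⟩ h1 v
    have hmk : m y = (2 * (k ⬝ᵥ a y v₀)) • k := by simp only [hm, hb]; abel
    set c := 2 * (k ⬝ᵥ a y v₀) with hc
    have hmm : m y ⬝ᵥ m y = c ^ 2 := by
      rw [hmk, smul_dotProduct, dotProduct_smul, hk]; simp [sq]
    have hc0 : c ^ 2 ≠ 0 := hmm ▸ h1
    rw [hb]
    simp only [hn, smul_dotProduct, smul_eq_mul, smul_smul]
    have e : 2 * ((√(m y ⬝ᵥ m y))⁻¹ * m y ⬝ᵥ a y v) * (√(m y ⬝ᵥ m y))⁻¹ =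
        2 * ((√(m y ⬝ᵥ m y))⁻¹ * (√(m y ⬝ᵥ m y))⁻¹) * (m y ⬝ᵥ a y v) := by ring
    rw [e, hsq h1, hmm, hmk, smul_dotProduct, smul_smul, smul_eq_mul]
    have hc1 : c ≠ 0 := fun h0 => hc0 (by rw [h0]; norm_num)
    congr 2
    field_simp
  have hfd : ∀ᶠ y in 𝓝 x, fderiv ℝ n y = 0 := by
    filter_upwards [hp.eventually_self, hq.eventually_self, hinj.eventually_nhds,
      hns.eventually_nhds, hn1.eventually_nhds, hrefl.eventually_nhds] with y h1 h2 h3 h4 h5 h6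
    exact fderiv_eq_zero_of_reflection h1 h2 h3 h4 h5 h6
  have hconst := eventuallyEq_const_of_fderiv
    (hns.mono fun y hy => hy.differentiableAt (by simp)) hfd
  have hnx := hn1.self_of_nhds
  have hnorm : ‖quat (n x)‖ = 1 := by
    have : ‖quat (n x)‖ ^ 2 = 1 := by rw [← real_inner_self_eq_norm_sq, inner_quat, hnx]
    exact (pow_eq_one_iff_of_nonneg (norm_nonneg _) two_ne_zero).1 this
  obtain ⟨c, hc, hqp⟩ := hq.exists_eq_mul ((hp.mul_const hnorm).congr (η := b) (by
    filter_upwards [hrefl, hconst] with y h1 h2 v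
    rw [ContinuousLinearMap.comp_apply, rotL_quat hnx, h1, h2]))
  obtain ⟨w, hw, hnw⟩ := exists_conj_qi hnx
  refine ⟨c, w, hc, hw, ?_⟩
  filter_upwards [hqp] with y hy
  rw [hy, hnw, mul_assoc c]

end NearlyKahler

end

noncomputable section

namespace NearlyKahler

open Filter Topology

/-! ### The first six normal forms -/

namespace IsAdapted

variable {ζ : E3 → E3 →L[ℝ] V3 × V3} {x : E3} {n : Fin 3 → V3} {e : Fin 3 → E3} {a b : V3}

theorem exists_coeff (h : IsAdapted ζ x n e a b) (v : E3) : ∃ c : V3, v = ∑ k, c k • e k := by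
  have hli : LinearIndependent ℝ e := by
    rw [Fintype.linearIndependent_iff]
    intro c hc j
    have h1 : gV (ζ x (∑ k, c k • e k)) (ζ x (e j)) = c j := by
      rw [Fin.sum_univ_three, map_add, map_add, map_smul, map_smul, map_smul, gV_add_left,
        gV_add_left, gV_smul_left, gV_smul_left, gV_smul_left, h.gV_apply, h.gV_apply, h.gV_apply]
      fin_cases j <;> simp
    rw [← h1, hc, map_zero]
    simp [gV]
  have hs := hli.span_eq_top_of_card_eq_finrank (by simp)
  have hv : v ∈ Submodule.span ℝ (Set.range e) := hs ▸ Submodule.mem_top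
  obtain ⟨c, hc⟩ := (Submodule.mem_span_range_iff_exists_fun ℝ).1 hv
  exact ⟨c, hc.symm⟩

theorem exists_expansion (h : IsAdapted ζ x n e a b) (v : E3) : ∃ c : V3, v = ∑ k, c k • e k ∧
    (ζ x v).1 = (c 0 * a 0) • n 0 + (c 1 * a 1) • n 1 + (c 2 * a 2) • n 2 ∧
    (ζ x v).2 = (c 0 * b 0) • n 0 + (c 1 * b 1) • n 1 + (c 2 * b 2) • n 2 := by
  obtain ⟨c, hc⟩ := h.exists_coeff v
  refine ⟨c, hc, ?_, ?_⟩
  · conv_lhs => rw [hc]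
    simp [Fin.sum_univ_three, h.apply_eq, smul_smul]
  · conv_lhs => rw [hc]
    simp [Fin.sum_univ_three, h.apply_eq, smul_smul]

theorem injective_fst (h : IsAdapted ζ x n e a b) (ha : ∀ k, a k ≠ 0) :
    Function.Injective ((ContinuousLinearMap.fst ℝ V3 V3).comp (ζ x)) := by
  rw [injective_iff_map_eq_zero]
  intro v hv
  obtain ⟨c, hc, h1, -⟩ := h.exists_expansion v
  have hv' : (ζ x v).1 = 0 := hv
  have h2 : ∀ k, c k = 0 := fun k => by
    have := congrArg (n k ⬝ᵥ ·) h1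
    simp only [hv', dotProduct_zero, dotProduct_add, dotProduct_smul, h.frame.dot,
      smul_eq_mul] at this
    have h3 : c k * a k = 0 := by rw [this]; fin_cases k <;> simp
    exact (mul_eq_zero.1 h3).resolve_right (ha k)
  rw [hc]; simp [h2]

theorem injective_snd (h : IsAdapted ζ x n e a b) (hb : ∀ k, b k ≠ 0) :
    Function.Injective ((ContinuousLinearMap.snd ℝ V3 V3).comp (ζ x)) := by
  rw [injective_iff_map_eq_zero]
  intro v hv
  obtain ⟨c, hc, -, h1⟩ := h.exists_expansion v
  have hv' : (ζ x v).2 = 0 := hv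
  have h2 : ∀ k, c k = 0 := fun k => by
    have := congrArg (n k ⬝ᵥ ·) h1
    simp only [hv', dotProduct_zero, dotProduct_add, dotProduct_smul, h.frame.dot,
      smul_eq_mul] at this
    have h3 : c k * b k = 0 := by rw [this]; fin_cases k <;> simp
    exact (mul_eq_zero.1 h3).resolve_right (hb k)
  rw [hc]; simp [h2]

end IsAdapted

theorem nfA_ne_zero {c : Fin 7} (h : c = 1 ∨ c = 2 ∨ c = 3 ∨ c = 5) (k : Fin 3) : nfA c k ≠ 0 := by
  rcases h with rfl | rfl | rfl | rfl <;> fin_cases k <;> simp [nfA]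

theorem nfB_ne_zero {c : Fin 7} (h : c = 0 ∨ c = 2 ∨ c = 3 ∨ c = 4) (k : Fin 3) : nfB c k ≠ 0 := by
  rcases h with rfl | rfl | rfl | rfl <;> fin_cases k <;> simp [nfB]

variable {ζ : E3 → E3 →L[ℝ] V3 × V3} {x : E3}

theorem HasNormalForm.injective_fst {c : Fin 7} (h : HasNormalForm ζ x c)
    (hc : c = 1 ∨ c = 2 ∨ c = 3 ∨ c = 5) :
    Function.Injective ((ContinuousLinearMap.fst ℝ V3 V3).comp (ζ x)) := by
  obtain ⟨n, e, h⟩ := h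
  exact h.injective_fst (nfA_ne_zero hc)

theorem HasNormalForm.injective_snd {c : Fin 7} (h : HasNormalForm ζ x c)
    (hc : c = 0 ∨ c = 2 ∨ c = 3 ∨ c = 4) :
    Function.Injective ((ContinuousLinearMap.snd ℝ V3 V3).comp (ζ x)) := by
  obtain ⟨n, e, h⟩ := h
  exact h.injective_snd (nfB_ne_zero hc)

theorem HasNormalForm.eq_zero_fst (h : HasNormalForm ζ x 0) (v : E3) : (ζ x v).1 = 0 := by
  obtain ⟨n, e, h⟩ := h
  obtain ⟨c, -, h1, -⟩ := h.exists_expansion v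
  rw [h1]; simp [nfA]

theorem HasNormalForm.eq_zero_snd (h : HasNormalForm ζ x 1) (v : E3) : (ζ x v).2 = 0 := by
  obtain ⟨n, e, h⟩ := h
  obtain ⟨c, -, -, h1⟩ := h.exists_expansion v
  rw [h1]; simp [nfB]

theorem HasNormalForm.eq_fst (h : HasNormalForm ζ x 2) (v : E3) : (ζ x v).2 = (ζ x v).1 := by
  obtain ⟨n, e, h⟩ := h
  obtain ⟨c, -, h1, h2⟩ := h.exists_expansion v
  rw [h1, h2]; simp [nfA, nfB]

theorem HasNormalForm.eq_reflect (h : HasNormalForm ζ x 3) : ∃ m : V3, m ⬝ᵥ m = 1 ∧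
    ∀ v, (ζ x v).2 = (2 * (m ⬝ᵥ (ζ x v).1)) • m - (ζ x v).1 := by
  obtain ⟨n, e, h⟩ := h
  refine ⟨n 2, by rw [h.frame.dot]; simp, fun v => ?_⟩
  obtain ⟨c, -, h1, h2⟩ := h.exists_expansion v
  rw [h1, h2]
  simp [nfA, nfB, dotProduct_add, dotProduct_smul, h.frame.dot]
  module

theorem HasNormalForm.fst_eq_reflect (h : HasNormalForm ζ x 4) : ∃ m : V3, m ⬝ᵥ m = 1 ∧
    ∀ v, (ζ x v).1 = (2 : ℝ) • (ζ x v).2 - (2 * (m ⬝ᵥ (ζ x v).2)) • m := by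
  obtain ⟨n, e, h⟩ := h
  refine ⟨n 2, by rw [h.frame.dot]; simp, fun v => ?_⟩
  obtain ⟨c, -, h1, h2⟩ := h.exists_expansion v
  rw [h1, h2]
  simp [nfA, nfB, dotProduct_add, dotProduct_smul, h.frame.dot]
  module

theorem HasNormalForm.snd_eq_reflect (h : HasNormalForm ζ x 5) : ∃ m : V3, m ⬝ᵥ m = 1 ∧
    ∀ v, (ζ x v).2 = (2 : ℝ) • (ζ x v).1 - (2 * (m ⬝ᵥ (ζ x v).1)) • m := by
  obtain ⟨n, e, h⟩ := h
  refine ⟨n 2, by rw [h.frame.dot]; simp, fun v => ?_⟩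
  obtain ⟨c, -, h1, h2⟩ := h.exists_expansion v
  rw [h1, h2]
  simp [nfA, nfB, dotProduct_add, dotProduct_smul, h.frame.dot]
  module

/-- The case in which a quotient of the two components of a Lagrangian immersion is a totally
geodesic sphere of imaginary quaternions. -/
theorem exists_eq_conj_of_reflect {p q : E3 → ℍ[ℝ]} {a b : E3 → E3 →L[ℝ] V3}
    (hp : HasLog p a x) (hq : HasLog q b x) (hinj : ∀ᶠ y in 𝓝 x, Function.Injective (b y))
    (h : ∀ᶠ y in 𝓝 x, ∃ m : V3, m ⬝ᵥ m = 1 ∧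
      ∀ v, a y v = (2 : ℝ) • b y v - (2 * (m ⬝ᵥ b y v)) • m) :
    ∃ (u : E3 → ℍ[ℝ]) (c w : ℍ[ℝ]), ‖c‖ = 1 ∧ ‖w‖ = 1 ∧ (∀ᶠ y in 𝓝 x, ContDiffAt ℝ ∞ u y) ∧
      (∀ᶠ y in 𝓝 x, ‖u y‖ = 1) ∧ Function.Injective (fderiv ℝ u x) ∧
      ∀ᶠ y in 𝓝 x, p y = c * (u y * qi * star (u y)) ∧ q y = w * star (u y) := by
  have h1 := hq.star
  have h2 := hp.mul h1
  have hR : ∀ᶠ y in 𝓝 x, ‖star (q y)‖ = 1 := hq.norm_eq.mono fun y hy => by simpa using hy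
  -- Here `a - b` is minus the rotation of `b` by π about `m`. Hence the logarithmic derivatives of
  -- `star q` and `p * star q` differ by such a rotation, about the axis `m` transported by `star
  -- q`.
  obtain ⟨c, w, hc, hw, hcw⟩ := exists_eq_mul_conj h1 h2 (by
      filter_upwards [hinj, hR] with y h3 h4
      exact neg_injective.comp ((rotL_injective h4).comp h3)) (by
      filter_upwards [h, hR] with y ⟨m, hm, h3⟩ h4
      refine ⟨rotL (star (q y)) m, by rw [rotL_dot h4, hm], fun v => ?_⟩
      simp only [add_apply, neg_apply, ContinuousLinearMap.comp_apply, h3, map_sub, map_smul,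
        dotProduct_neg, rotL_dot h4]
      module)
  have h5 := h1.mul_const hw
  refine ⟨fun y => star (q y) * w, c, w, hc, hw, h5.smooth, h5.norm_eq, h5.injective_fderiv ?_, ?_⟩
  · exact (rotL_injective hw).comp
      (neg_injective.comp ((rotL_injective hR.self_of_nhds).comp hinj.self_of_nhds))
  · filter_upwards [hcw, hq.norm_eq] with y h6 h7
    have h8 := star_mul_self_of_norm h7
    refine ⟨?_, ?_⟩
    · calc p y = p y * (star (q y) * q y) := by rw [h8, mul_one]
        _ = (p y * star (q y)) * q y := by rw [mul_assoc]
        _ = _ := by rw [h6]; simp only [star_mul, star_star, mul_assoc]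
    · rw [star_mul, star_star, ← mul_assoc, mul_star_self_of_norm hw, one_mul]

section

variable {M : Type*} [TopologicalSpace M] [ChartedSpace E3 M] [IsManifold (𝓡 3) ∞ M]
  {f : M → ℍ[ℝ] × ℍ[ℝ]} {p : M}

theorem IsLagrangianGerm.locallyGivenBy
    (h : IsLagrangianGerm (localExpr f p) (extChartAt (𝓡 3) p p)) {c : Fin 7} (hc6 : c ≠ 6)
    (hc : ∀ᶠ y in 𝓝 (extChartAt (𝓡 3) p p), HasNormalForm (mcForm (localExpr f p)) y c) :
    LocallyGivenBy f p (Fin.castSucc c) := by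
  have hp := h.hasLog_fst
  have hq := h.hasLog_snd
  fin_cases c
  · obtain ⟨c, hcn, hcp⟩ := hp.exists_eq_mul ((HasLog.const (c := 1) (by simp)).congr
      (hc.mono fun y hy v => (hy.eq_zero_fst v).symm))
    refine locallyCongruentAt_sphere (ψ := f1) hq.smooth hq.norm_eq
      (hq.injective_fderiv (hc.self_of_nhds.injective_snd (by simp)))
      (a := c) (b := 1) (c := 1) hcn (by simp) (by simp) ?_
    filter_upwards [hcp] with y hy U hU
    simp [nkIsometry, f1, hU, Prod.ext_iff, hy]
  · obtain ⟨c, hcn, hcp⟩ := hq.exists_eq_mul ((HasLog.const (c := 1) (by simp)).congr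
      (hc.mono fun y hy v => (hy.eq_zero_snd v).symm))
    refine locallyCongruentAt_sphere (ψ := f2) hp.smooth hp.norm_eq
      (hp.injective_fderiv (hc.self_of_nhds.injective_fst (by simp)))
      (a := 1) (b := c) (c := 1) (by simp) hcn (by simp) ?_
    filter_upwards [hcp] with y hy U hU
    simp [nkIsometry, f2, hU, Prod.ext_iff, hy]
  · obtain ⟨c, hcn, hcp⟩ := hq.exists_eq_mul (hp.congr (hc.mono fun y hy v => (hy.eq_fst v).symm))
    refine locallyCongruentAt_sphere (ψ := f3) hp.smooth hp.norm_eq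
      (hp.injective_fderiv (hc.self_of_nhds.injective_fst (by simp)))
      (a := 1) (b := c) (c := 1) (by simp) hcn (by simp) ?_
    filter_upwards [hcp] with y hy U hU
    simp [nkIsometry, f3, hU, Prod.ext_iff, hy]
  · obtain ⟨c, w, hcn, hw, hcp⟩ := exists_eq_mul_conj hp hq
      (hc.mono fun y hy => hy.injective_fst (by simp)) (hc.mono fun y hy => hy.eq_reflect)
    have h5 := hp.mul_const hw
    refine locallyCongruentAt_sphere (ψ := f4) h5.smooth h5.norm_eq (h5.injective_fderiv
      ((rotL_injective hw).comp (hc.self_of_nhds.injective_fst (by simp))))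
      (a := 1) (b := c) (c := w) (by simp) hcn hw ?_
    filter_upwards [hcp] with y hy U hU
    simp only [nkIsometry, f4, hU, Prod.ext_iff, hy, inv_eq_star_of_norm hw]
    refine ⟨?_, by simp only [mul_assoc]⟩
    rw [one_mul, mul_assoc, mul_star_self_of_norm hw, mul_one]
  · obtain ⟨u, c, w, hcn, hw, hu, hu1, hui, he⟩ := exists_eq_conj_of_reflect hp hq
      (hc.mono fun y hy => hy.injective_snd (by simp)) (hc.mono fun y hy => hy.fst_eq_reflect)
    refine locallyCongruentAt_sphere (ψ := f5) hu hu1 hui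
      (a := c) (b := w) (c := 1) hcn hw (by simp) ?_
    filter_upwards [he, hu1] with y hy hn U hU
    simp [nkIsometry, f5, hU, Prod.ext_iff, hy, inv_eq_star_of_norm hn]
  · obtain ⟨u, c, w, hcn, hw, hu, hu1, hui, he⟩ := exists_eq_conj_of_reflect hq hp
      (hc.mono fun y hy => hy.injective_fst (by simp)) (hc.mono fun y hy => hy.snd_eq_reflect)
    refine locallyCongruentAt_sphere (ψ := f6) hu hu1 hui
      (a := w) (b := c) (c := 1) hw hcn (by simp) ?_
    filter_upwards [he, hu1] with y hy hn U hU
    simp [nkIsometry, f6, hU, Prod.ext_iff, hy, inv_eq_star_of_norm hn]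
  · exact absurd rfl hc6

end

end NearlyKahler

end

noncomputable section

namespace NearlyKahler

open Filter Topology

/-! ### Adapted frames and their lifts to the unit quaternions -/

section Lift

variable {x : E3}

theorem HasLog.of_norm {u : E3 → ℍ[ℝ]} (hs : ∀ᶠ y in 𝓝 x, ContDiffAt ℝ ∞ u y)
    (hn : ∀ᶠ y in 𝓝 x, ‖u y‖ = 1) : HasLog u (fun y =>
      imL.comp ((ContinuousLinearMap.mul ℝ ℍ[ℝ] (starQ (u y))).comp (fderiv ℝ u y))) x where
  norm_eq := hn
  smooth := hs
  fderiv_eq := by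
    filter_upwards [hs, hn.eventually_nhds] with y h1 h2 v
    have hd : DifferentiableAt ℝ u y := h1.differentiableAt (by simp)
    have h3 := h2.self_of_nhds
    have h4 : inner ℝ (u y) (fderiv ℝ u y v) = 0 := by
      have e : (fun z => inner ℝ (u z) (u z)) =ᶠ[𝓝 y] fun _ => (1 : ℝ) :=
        h2.mono fun z hz => by simp [hz]
      have h5 := fderiv_inner_apply ℝ hd hd v
      rw [e.fderiv_eq, real_inner_comm (u y) (fderiv ℝ u y v)] at h5
      simp at h5
      linarith
    have h5 : (Star.star (u y) * fderiv ℝ u y v).re = 0 := by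
      rw [Quaternion.inner_def] at h4
      simp only [Quaternion.re_mul, Quaternion.re_star, Quaternion.imI_star, Quaternion.imJ_star,
        Quaternion.imK_star] at h4 ⊢
      linarith
    simp only [ContinuousLinearMap.comp_apply, ContinuousLinearMap.mul_apply', starQ_apply,
      imL_apply]
    rw [quat_imV h5, ← mul_assoc, mul_star_self_of_norm h3, one_mul]

/-- An oriented orthonormal frame as a function of the standard frame. -/
def frameLift (n : Fin 3 → V3) (q : ℍ[ℝ]) : ℍ[ℝ] :=
  q - ∑ k, quat (n k) * q * quat (Pi.single k 1)

theorem IsFrame.quat_mul_self {n : Fin 3 → V3} (h : IsFrame n) (k : Fin 3) :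
    quat (n k) * quat (n k) = -1 := by
  have hn := h.dot k k
  rw [Matrix.vec3_dotProduct] at hn
  simp at hn
  ext <;> simp <;> linarith

theorem quat_mul_quat (u v : V3) : quat u * quat v = quat (crossProduct u v) - ↑(u ⬝ᵥ v) := by
  ext <;> simp [cross_apply, Matrix.vec3_dotProduct] <;> ring

theorem isFrame_single : IsFrame (fun k : Fin 3 => (Pi.single k 1 : V3)) where
  dot i j := by simp [Pi.single_apply, eq_comm]
  cross := by
    ext k; fin_cases k <;> simp [cross_apply]

/-- Up to sign each of `n` and the standard frame generates a copy of the quaternion group. The map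
`frameLift n` averages over this group, so its values intertwine the two frames. -/
theorem frameLift_spec {n : Fin 3 → V3} (h : IsFrame n) (q : ℍ[ℝ]) (k : Fin 3) :
    quat (n k) * frameLift n q = frameLift n q * quat (Pi.single k 1) := by
  have key : ∀ {n : Fin 3 → V3}, IsFrame n →
      quat (n 0) * quat (n 1) = quat (n 2) ∧ quat (n 1) * quat (n 2) = quat (n 0) ∧
      quat (n 2) * quat (n 0) = quat (n 1) ∧ quat (n 1) * quat (n 0) = -quat (n 2) ∧
      quat (n 2) * quat (n 1) = -quat (n 0) ∧ quat (n 0) * quat (n 2) = -quat (n 1) := by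
    intro n h
    have hneg : ∀ v, quat (-v) = -quat v := fun v => map_neg quatL v
    simp only [quat_mul_quat, h.dot, h.cross, h.cross12, h.cross20,
      ← cross_anticomm (n 0) (n 1), ← cross_anticomm (n 1) (n 2), ← cross_anticomm (n 2) (n 0), hneg]
    simp
  obtain ⟨a1, a2, a3, a4, a5, a6⟩ := key h
  obtain ⟨b1, b2, b3, b4, b5, b6⟩ := key isFrame_single
  have a0 := h.quat_mul_self
  have b0 := isFrame_single.quat_mul_self
  simp only [frameLift, Fin.sum_univ_three, mul_sub, mul_add, sub_mul, add_mul, ← mul_assoc]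
  fin_cases k
  · simp only [Fin.zero_eta, a0, a1, a6, mul_assoc, b0, b3, b4]
    noncomm_ring
  · simp only [Fin.mk_one, a0, a4, a2, mul_assoc, b0, b1, b5]
    noncomm_ring
  · simp only [Fin.reduceFinMk, a0, a3, a5, mul_assoc, b0, b6, b2]
    noncomm_ring

/-- As a linear map of `q`, the lift has trace 4: the four diagonal entries added below sum to 4,
whatever `n` is. -/
theorem exists_frameLift_ne_zero (n : Fin 3 → V3) : ∃ q, frameLift n q ≠ 0 := by
  by_contra! h
  have h0 := congrArg QuaternionAlgebra.re (h 1)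
  have h1 := congrArg QuaternionAlgebra.imI (h (quat (Pi.single 0 1)))
  have h2 := congrArg QuaternionAlgebra.imJ (h (quat (Pi.single 1 1)))
  have h3 := congrArg QuaternionAlgebra.imK (h (quat (Pi.single 2 1)))
  simp [frameLift, Fin.sum_univ_three] at h0 h1 h2 h3
  linarith

/-- A smooth oriented orthonormal frame lifts to a map to the unit quaternions. -/
theorem exists_lift {N : Fin 3 → E3 → V3} (hs : ∀ᶠ y in 𝓝 x, ∀ k, ContDiffAt ℝ ∞ (N k) y)
    (hf : ∀ᶠ y in 𝓝 x, IsFrame fun k => N k y) :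
    ∃ (u : E3 → ℍ[ℝ]) (ξ : E3 → E3 →L[ℝ] V3), HasLog u ξ x ∧
      ∀ᶠ y in 𝓝 x, ∀ k, rotL (u y) (N k y) = Pi.single k 1 := by
  obtain ⟨q, hq⟩ := exists_frameLift_ne_zero fun k => N k x
  set U : E3 → ℍ[ℝ] := fun y => frameLift (fun k => N k y) q with hU
  have hUs : ∀ᶠ y in 𝓝 x, ContDiffAt ℝ ∞ U y := by
    filter_upwards [hs] with y hy
    have h1 : ∀ k, ContDiffAt ℝ ∞ (fun z => quat (N k z)) y := fun k =>
      quatL.contDiff.contDiffAt.comp y (hy k)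
    exact contDiffAt_const.sub (ContDiffAt.sum fun k _ =>
      ((h1 k).mul contDiffAt_const).mul contDiffAt_const)
  have hU0 : ∀ᶠ y in 𝓝 x, U y ≠ 0 := hUs.self_of_nhds.continuousAt.eventually_ne hq
  have hn : ∀ᶠ y in 𝓝 x, ‖‖U y‖⁻¹ • U y‖ = 1 := hU0.mono fun y hy => by
    rw [norm_smul, norm_inv, norm_norm, inv_mul_cancel₀ (norm_ne_zero_iff.2 hy)]
  refine ⟨fun y => ‖U y‖⁻¹ • U y, _, HasLog.of_norm ?_ hn, ?_⟩
  · filter_upwards [hUs, hU0] with y h1 h2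
    exact ((h1.norm ℝ h2).inv (norm_ne_zero_iff.2 h2)).smul h1
  · filter_upwards [hf, hn] with y h1 h2 k
    apply quat_injective
    rw [quat_rotL, mul_assoc, mul_smul_comm, frameLift_spec h1, ← smul_mul_assoc, ← mul_assoc,
      star_mul_self_of_norm h2, one_mul]

end Lift

section Frame

/-- The cross product as a continuous bilinear map. -/
def crossL : V3 →L[ℝ] V3 →L[ℝ] V3 := (crossProduct (R := ℝ)).toContinuousBilinearMap

theorem contDiffAt_cross {f k : E3 → V3} {x : E3} (hf : ContDiffAt ℝ ∞ f x)
    (hk : ContDiffAt ℝ ∞ k x) : ContDiffAt ℝ ∞ (fun y => crossProduct (f y) (k y)) x :=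
  (crossL.contDiff.contDiffAt.comp x hf).clm_apply hk

/-- The unit vector in the direction of `v`. -/
def unitV (v : V3) : V3 := (√(v ⬝ᵥ v))⁻¹ • v

theorem contDiffAt_unitV {f : E3 → V3} {x : E3} (hf : ContDiffAt ℝ ∞ f x)
    (h : f x ⬝ᵥ f x ≠ 0) : ContDiffAt ℝ ∞ (fun y => unitV (f y)) x := by
  have h0 : 0 ≤ f x ⬝ᵥ f x := by
    rw [Matrix.vec3_dotProduct]; nlinarith [sq_nonneg (f x 0), sq_nonneg (f x 1), sq_nonneg (f x 2)]
  exact (((contDiffAt_dot hf hf).sqrt h).inv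
    (Real.sqrt_ne_zero'.2 (lt_of_le_of_ne h0 h.symm))).smul hf

theorem unitV_smul {n : V3} (hn : n ⬝ᵥ n = 1) {r : ℝ} (hr : (r • n) ⬝ᵥ (r • n) ≠ 0) :
    ∃ ε : ℝ, ε * ε = 1 ∧ unitV (r • n) = ε • n := by
  simp only [dotProduct_smul, smul_dotProduct, hn, smul_eq_mul, mul_one] at hr
  have h1 : √(r * r) ≠ 0 := Real.sqrt_ne_zero'.2 (lt_of_le_of_ne (mul_self_nonneg r) hr.symm)
  have h2 : √(r * r) * √(r * r) = r * r := Real.mul_self_sqrt (mul_self_nonneg r)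
  refine ⟨(√(r * r))⁻¹ * r, ?_, ?_⟩
  · field_simp
    rw [sq, sq, h2, div_self hr]
  · simp only [unitV, dotProduct_smul, smul_dotProduct, hn, smul_eq_mul, mul_one, smul_smul]

variable {ζ : E3 → E3 →L[ℝ] V3 × V3} {x : E3}

/-- The linear coordinates `S` absorb the common factor `√3 / 2` of form 6. -/
theorem HasNormalForm.exists_expansion (h : HasNormalForm ζ x 6) :
    ∃ (n : Fin 3 → V3) (S : E3 → V3), IsFrame n ∧ Function.Injective S ∧ Function.Surjective S ∧
      ∀ v, (ζ x v).1 = S v 0 • n 0 + S v 1 • n 1 ∧ (ζ x v).2 = S v 1 • n 1 + S v 2 • n 2 := by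
  obtain ⟨n, e, h⟩ := h
  have key : ∀ v : E3, ∃ c : V3, v = ∑ k, c k • e k ∧
      (ζ x v).1 = (√3 / 2 * c 0) • n 0 + (√3 / 2 * c 1) • n 1 ∧
      (ζ x v).2 = (√3 / 2 * c 1) • n 1 + (√3 / 2 * c 2) • n 2 := fun v => by
    obtain ⟨c, h0, h1, h2⟩ := h.exists_expansion v
    refine ⟨c, h0, ?_, ?_⟩
    · rw [h1]; simp [nfA, mul_comm]
    · rw [h2]; simp [nfB, mul_comm]
  have h3 : (√3 / 2 : ℝ) ≠ 0 := by positivity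
  choose c hc h1 h2 using key
  refine ⟨n, fun v => (√3 / 2) • c v, h.frame, fun v w hvw => ?_, fun d => ?_, fun v => ?_⟩
  · rw [hc v, hc w, smul_right_injective _ h3 hvw]
  · set v : E3 := ∑ k, ((√3 / 2)⁻¹ * d k) • e k with hv
    refine ⟨v, ?_⟩
    have h4 : (ζ x v).1 = d 0 • n 0 + d 1 • n 1 ∧ (ζ x v).2 = d 1 • n 1 + d 2 • n 2 := by
      have h5 : √3 / 2 * (2 / √3) = (1 : ℝ) := by field_simp
      simp [hv, Fin.sum_univ_three, h.apply_eq, nfA, nfB, smul_smul]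
      field_simp
      simp
    rw [h1, h2] at h4
    have ha := fun k => congrArg (n k ⬝ᵥ ·) h4.1
    have hb := fun k => congrArg (n k ⬝ᵥ ·) h4.2
    simp only [dotProduct_add, dotProduct_smul, h.frame.dot, smul_eq_mul] at ha hb
    ext k
    fin_cases k
    · simpa using ha 0
    · simpa using ha 1
    · simpa using hb 2
  · simp [h1, h2]

/-- A smooth adapted frame. -/
theorem exists_smooth_frame (hζ : ∀ᶠ y in 𝓝 x, ContDiffAt ℝ ∞ ζ y)
    (h : ∀ᶠ y in 𝓝 x, HasNormalForm ζ y 6) :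
    ∃ N : Fin 3 → E3 → V3, (∀ᶠ y in 𝓝 x, ∀ k, ContDiffAt ℝ ∞ (N k) y) ∧
      ∀ᶠ y in 𝓝 x, IsFrame (fun k => N k y) ∧ ∃ S : E3 → V3, Function.Injective S ∧
      ∀ v, (ζ y v).1 = S v 0 • N 0 y + S v 1 • N 1 y ∧
        (ζ y v).2 = S v 1 • N 1 y + S v 2 • N 2 y := by
  obtain ⟨n, S, hn, -, hS, hx⟩ := h.self_of_nhds.exists_expansion
  choose v hv using fun k : Fin 3 => hS (Pi.single k 1)
  -- The first components span the plane orthogonal to `n 2` and the second ones the plane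
  -- orthogonal to `n 0`, so these cross products give two of the axes smoothly.
  set C : E3 → V3 := fun y => crossProduct (ζ y (v 0)).1 (ζ y (v 1)).1 with hC
  set B : E3 → V3 := fun y => crossProduct (ζ y (v 1)).2 (ζ y (v 2)).2 with hB
  have hCx : C x = n 2 := by simp [hC, hx, hv, hn.cross]
  have hBx : B x = n 0 := by simp [hB, hx, hv, hn.cross12]
  have hCs : ∀ᶠ y in 𝓝 x, ContDiffAt ℝ ∞ C y := by
    filter_upwards [hζ] with y hy
    have h1 : ∀ k, ContDiffAt ℝ ∞ (fun z => (ζ z (v k)).1) y := fun k =>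
      (hy.clm_apply contDiffAt_const).fst
    exact contDiffAt_cross (h1 0) (h1 1)
  have hBs : ∀ᶠ y in 𝓝 x, ContDiffAt ℝ ∞ B y := by
    filter_upwards [hζ] with y hy
    have h1 : ∀ k, ContDiffAt ℝ ∞ (fun z => (ζ z (v k)).2) y := fun k =>
      (hy.clm_apply contDiffAt_const).snd
    exact contDiffAt_cross (h1 1) (h1 2)
  have hC0 : ∀ᶠ y in 𝓝 x, C y ⬝ᵥ C y ≠ 0 :=
    (contDiffAt_dot hCs.self_of_nhds hCs.self_of_nhds).continuousAt.eventually_ne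
      (by simp [hCx, hn.dot])
  have hB0 : ∀ᶠ y in 𝓝 x, B y ⬝ᵥ B y ≠ 0 :=
    (contDiffAt_dot hBs.self_of_nhds hBs.self_of_nhds).continuousAt.eventually_ne
      (by simp [hBx, hn.dot])
  refine ⟨![fun y => unitV (B y), fun y => crossProduct (unitV (C y)) (unitV (B y)),
    fun y => unitV (C y)], ?_, ?_⟩
  · filter_upwards [hCs, hBs, hC0, hB0] with y h1 h2 h3 h4 k
    have h5 := contDiffAt_unitV h1 h3
    have h6 := contDiffAt_unitV h2 h4
    fin_cases k
    · exact h6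
    · exact contDiffAt_cross h5 h6
    · exact h5
  · filter_upwards [h, hC0, hB0] with y hy h1 h2
    obtain ⟨m, T, hm, hT, -, hy⟩ := hy.exists_expansion
    have hCm : C y = (T (v 0) 0 * T (v 1) 1 - T (v 0) 1 * T (v 1) 0) • m 2 := by
      simp only [hC, hy, map_add, map_smul, LinearMap.add_apply, LinearMap.smul_apply,
        cross_self, hm.cross, ← cross_anticomm (m 0) (m 1)]
      module
    have hBm : B y = (T (v 1) 1 * T (v 2) 2 - T (v 1) 2 * T (v 2) 1) • m 0 := by
      simp only [hB, hy, map_add, map_smul, LinearMap.add_apply, LinearMap.smul_apply,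
        cross_self, hm.cross12, ← cross_anticomm (m 1) (m 2)]
      module
    rw [hCm] at h1
    rw [hBm] at h2
    obtain ⟨c, hc, hcm⟩ := unitV_smul (by rw [hm.dot]; simp) h1
    obtain ⟨b, hb, hbm⟩ := unitV_smul (by rw [hm.dot]; simp) h2
    have h3 : crossProduct (c • m 2) (b • m 0) = (c * b) • m 1 := by
      rw [map_smul, map_smul, LinearMap.smul_apply, hm.cross20, smul_smul, mul_comm]
    rw [← hCm] at hcm
    rw [← hBm] at hbm
    -- At nearby points the smooth frame agrees with the pointwise one up to signs `b`, `c * b`,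
    -- `c`. Their product is 1, so the orientation is kept, and the coordinates change by the same
    -- signs.
    have e : (fun k => (![fun y => unitV (B y), fun y => crossProduct (unitV (C y)) (unitV (B y)),
        fun y => unitV (C y)] : Fin 3 → E3 → V3) k y) = ![b • m 0, (c * b) • m 1, c • m 2] := by
      funext k
      fin_cases k
      · exact hbm
      · change crossProduct (unitV (C y)) (unitV (B y)) = (c * b) • m 1
        rw [hcm, hbm, h3]
      · exact hcm
    refine ⟨?_, fun w => ![b * T w 0, c * b * T w 1, c * T w 2], ?_, fun w => ?_⟩
    · rw [e]
      refine ⟨fun i j => ?_, ?_⟩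
      swap
      · simp only [Matrix.cons_val]
        rw [map_smul, map_smul, LinearMap.smul_apply, hm.cross, smul_smul]
        congr 1
        linear_combination c * hb
      fin_cases i <;> fin_cases j <;> simp [hm.dot]
      · exact hb
      · linear_combination b * b * hc + hb
      · exact hc
    · intro w w' hw
      apply hT
      have e0 := congrFun hw 0
      have e1 := congrFun hw 1
      have e2 := congrFun hw 2
      simp only [Matrix.cons_val] at e0 e1 e2
      ext k
      fin_cases k
      · have : T w 0 = T w' 0 := by
          linear_combination b * e0 + (T w' 0 - T w 0) * hb
        exact this
      · have : T w 1 = T w' 1 := by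
          linear_combination c * b * e1 + (T w' 1 - T w 1) * (b * b * hc + hb)
        exact this
      · have : T w 2 = T w' 2 := by
          linear_combination c * e2 + (T w' 2 - T w 2) * hc
        exact this
    · simp only [Matrix.cons_val, hy, hcm, hbm, h3, smul_smul]
      have r0 : b * T w 0 * b = T w 0 := by linear_combination T w 0 * hb
      have r1 : c * b * T w 1 * (c * b) = T w 1 := by
        linear_combination T w 1 * (b * b * hc + hb)
      have r2 : c * T w 2 * c = T w 2 := by linear_combination T w 2 * hc
      rw [r0, r1, r2]
      exact ⟨rfl, rfl⟩

end Frame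

end NearlyKahler

end

noncomputable section

namespace NearlyKahler

open Filter Topology

/-! ### The structure equations of the seventh normal form -/

/-- Componentwise multiplication by `d`. -/
def diagL (d : V3) : V3 →L[ℝ] V3 :=
  LinearMap.toContinuousLinearMap
    { toFun := fun v => d * v
      map_add' := mul_add d
      map_smul' := fun c v => mul_smul_comm c d v }

theorem diagL_apply (d v : V3) (k : Fin 3) : diagL d v k = d k * v k := rfl

/-- Three maps to the unit quaternions with logarithmic derivatives `ξ`, `ξ + (σ₀, σ₁, 0)` and
`ξ + (0, σ₁, σ₂)` for a coframe `σ`. -/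
structure IsCoframe (u P Q : E3 → ℍ[ℝ]) (ξ σ : E3 → E3 →L[ℝ] V3) (x : E3) : Prop where
  log : HasLog u ξ x
  log_fst : HasLog P (fun y => ξ y + (diagL ![1, 1, 0]).comp (σ y)) x
  log_snd : HasLog Q (fun y => ξ y + (diagL ![0, 1, 1]).comp (σ y)) x
  smooth : ∀ᶠ y in 𝓝 x, ContDiffAt ℝ ∞ σ y
  inj : ∀ᶠ y in 𝓝 x, Function.Injective (σ y)

theorem IsLagrangianGerm.exists_isCoframe {F : E3 → ℍ[ℝ] × ℍ[ℝ]} {x : E3}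
    (h : IsLagrangianGerm F x) (h6 : ∀ᶠ y in 𝓝 x, HasNormalForm (mcForm F) y 6) :
    ∃ u ξ σ, IsCoframe u (fun y => (F y).1 * u y) (fun y => (F y).2 * u y) ξ σ x := by
  obtain ⟨N, hN, hNF⟩ := exists_smooth_frame
    (h.eventually_self.mono fun y hy => hy.contDiffAt_mcForm) h6
  obtain ⟨u, ξ, hu, hr⟩ := exists_lift hN (hNF.mono fun y hy => hy.1)
  have hP := h.hasLog_fst.mul hu
  have hQ := h.hasLog_snd.mul hu
  set α : E3 → E3 →L[ℝ] V3 := fun y =>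
    (rotL (u y)).comp ((ContinuousLinearMap.fst ℝ V3 V3).comp (mcForm F y)) with hα
  set β : E3 → E3 →L[ℝ] V3 := fun y =>
    (rotL (u y)).comp ((ContinuousLinearMap.snd ℝ V3 V3).comp (mcForm F y)) with hβ
  -- In the rotated frame `α = (S₀, S₁, 0)` and `β = (0, S₁, S₂)`, so adding the last coordinate of
  -- `β` to `α` recovers the coframe.
  set σ : E3 → E3 →L[ℝ] V3 := fun y => α y + (diagL ![0, 0, 1]).comp (β y) with hσ
  have key : ∀ᶠ y in 𝓝 x, ∃ S : E3 → V3, Function.Injective S ∧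
      ∀ v, α y v = ![S v 0, S v 1, 0] ∧ β y v = ![0, S v 1, S v 2] ∧ σ y v = S v := by
    filter_upwards [hNF, hr] with y ⟨_, S, hS, h1⟩ h2
    have h3 : ∀ v, α y v = ![S v 0, S v 1, 0] ∧ β y v = ![0, S v 1, S v 2] := fun v => by
      have ha : α y v = rotL (u y) (mcForm F y v).1 := rfl
      have hb : β y v = rotL (u y) (mcForm F y v).2 := rfl
      rw [ha, hb, (h1 v).1, (h1 v).2, map_add, map_add, map_smul, map_smul, map_smul, h2, h2, h2]
      constructor <;> ext k <;> fin_cases k <;> simp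
    refine ⟨S, hS, fun v => ⟨(h3 v).1, (h3 v).2, ?_⟩⟩
    change α y v + diagL ![0, 0, 1] (β y v) = S v
    rw [(h3 v).1, (h3 v).2]
    ext k
    fin_cases k <;> simp [diagL_apply]
  refine ⟨u, ξ, σ, hu, hP.congr ?_, hQ.congr ?_, ?_, ?_⟩
  · filter_upwards [key] with y ⟨S, _, hS⟩ v
    change α y v + ξ y v = ξ y v + diagL ![1, 1, 0] (σ y v)
    rw [(hS v).1, (hS v).2.2, add_comm]
    congr 1
    ext k
    fin_cases k <;> simp [diagL_apply]
  · filter_upwards [key] with y ⟨S, _, hS⟩ v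
    change β y v + ξ y v = ξ y v + diagL ![0, 1, 1] (σ y v)
    rw [(hS v).2.1, (hS v).2.2, add_comm]
    congr 1
    ext k
    fin_cases k <;> simp [diagL_apply]
  · filter_upwards [hP.eventually_contDiffAt, hQ.eventually_contDiffAt, hu.eventually_contDiffAt]
      with y h1 h2 h3
    have h4 : ContDiffAt ℝ ∞ α y := by simpa using h1.sub h3
    have h5 : ContDiffAt ℝ ∞ β y := by simpa using h2.sub h3
    exact h4.add (contDiffAt_const.clm_comp h5)
  · filter_upwards [key] with y ⟨S, hS, h1⟩ v w hvw
    rw [(h1 v).2.2, (h1 w).2.2] at hvw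
    exact hS hvw

namespace IsCoframe

variable {u P Q : E3 → ℍ[ℝ]} {ξ σ : E3 → E3 →L[ℝ] V3} {x : E3}

theorem eventually_self (h : IsCoframe u P Q ξ σ x) : ∀ᶠ y in 𝓝 x, IsCoframe u P Q ξ σ y := by
  filter_upwards [h.log.eventually_self, h.log_fst.eventually_self, h.log_snd.eventually_self,
    h.smooth.eventually_nhds, h.inj.eventually_nhds] with y h1 h2 h3 h4 h5
  exact ⟨h1, h2, h3, h4, h5⟩

/-- The exterior derivative of the coframe. -/
def extD (σ : E3 → E3 →L[ℝ] V3) (x s t : E3) : V3 :=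
  fderiv ℝ (fun y => σ y t) x s - fderiv ℝ (fun y => σ y s) x t

theorem differentiableAt_apply (h : IsCoframe u P Q ξ σ x) (v : E3) :
    DifferentiableAt ℝ (fun y => σ y v) x :=
  (h.smooth.self_of_nhds.clm_apply contDiffAt_const).differentiableAt (by simp)

theorem extD_fst (h : IsCoframe u P Q ξ σ x) (d : V3) (s t : E3) :
    extD (fun y => ξ y + (diagL d).comp (σ y)) x s t = extD ξ x s t + diagL d (extD σ x s t) := by
  have h1 : ∀ v w, fderiv ℝ (fun y => (ξ y + (diagL d).comp (σ y)) v) x w =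
      fderiv ℝ (fun y => ξ y v) x w + diagL d (fderiv ℝ (fun y => σ y v) x w) := by
    intro v w
    have h2 : DifferentiableAt ℝ (fun y => ξ y v) x :=
      (h.log.contDiffAt_apply v).differentiableAt (by simp)
    have h3 : HasFDerivAt (fun y => diagL d (σ y v)) _ x :=
      (diagL d).hasFDerivAt.comp x (h.differentiableAt_apply v).hasFDerivAt
    change fderiv ℝ (fun y => ξ y v + diagL d (σ y v)) x w = _
    rw [fderiv_fun_add h2 h3.differentiableAt, h3.fderiv]
    rfl
  simp only [extD, h1, map_sub]
  abel

/-- The structure equations. -/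
theorem structure_eq (h : IsCoframe u P Q ξ σ x) : ∃ r : ℝ,
    (∀ v, ξ x v = ![r * σ x v 0, -(1 + r) * σ x v 1, r * σ x v 2]) ∧
    (∀ s t, extD σ x s t = (-2 * r) • crossProduct (σ x s) (σ x t)) := by
  have hu := fun s t => h.log.maurerCartan s t
  have hP := fun s t => (h.extD_fst ![1, 1, 0] s t).symm.trans (h.log_fst.maurerCartan s t)
  have hQ := fun s t => (h.extD_fst ![0, 1, 1] s t).symm.trans (h.log_snd.maurerCartan s t)
  have hu' : ∀ s t, extD ξ x s t = _ := hu
  simp only [hu', add_apply, ContinuousLinearMap.comp_apply] at hP hQ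
  have p0 := fun s t => congrFun (hP s t) 0
  have p1 := fun s t => congrFun (hP s t) 1
  have p2 := fun s t => congrFun (hP s t) 2
  have q0 := fun s t => congrFun (hQ s t) 0
  have q1 := fun s t => congrFun (hQ s t) 1
  have q2 := fun s t => congrFun (hQ s t) 2
  simp [diagL_apply, cross_apply] at p0 p1 p2 q0 q1 q2
  choose e he using fun k : Fin 3 => surjective_of_injective h.inj.self_of_nhds (Pi.single k 1)
  have hspan : ∀ v, v = σ x v 0 • e 0 + σ x v 1 • e 1 + σ x v 2 • e 2 := fun v => by
    apply h.inj.self_of_nhds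
    simp only [map_add, map_smul, he]
    ext k
    fin_cases k <;> simp
  set r := ξ x (e 0) 0 with hr
  -- The last component for `P` and the first for `Q` contain no derivative of `σ`, and the middle
  -- components for `P` and `Q` contain the same one. The resulting linear equations for the nine
  -- entries of `ξ` leave a single parameter `r`.
  have hvals : ξ x (e 0) = ![r, 0, 0] ∧ ξ x (e 1) = ![0, -(1 + r), 0] ∧ ξ x (e 2) = ![0, 0, r] := by
    have a1 := p2 (e 0) (e 1)
    have a2 := p2 (e 1) (e 2)
    have a3 := p2 (e 0) (e 2)
    have b1 := q0 (e 0) (e 1)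
    have b2 := q0 (e 1) (e 2)
    have b3 := q0 (e 0) (e 2)
    have c1 := p1 (e 0) (e 1)
    have c2 := p1 (e 1) (e 2)
    have c3 := p1 (e 0) (e 2)
    have d1 := q1 (e 0) (e 1)
    have d2 := q1 (e 1) (e 2)
    have d3 := q1 (e 0) (e 2)
    simp [he] at a1 a2 a3 b1 b2 b3 c1 c2 c3 d1 d2 d3
    refine ⟨?_, ?_, ?_⟩ <;> ext k <;> fin_cases k <;> simp <;> linarith
  have hξ : ∀ v, ξ x v = ![r * σ x v 0, -(1 + r) * σ x v 1, r * σ x v 2] := fun v => by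
    conv_lhs => rw [hspan v]
    rw [map_add, map_add, map_smul, map_smul, map_smul, hvals.1, hvals.2.1, hvals.2.2]
    ext k
    fin_cases k <;> simp <;> ring
  refine ⟨r, hξ, fun s t => ?_⟩
  ext k
  fin_cases k
  · have := p0 s t
    simp [hξ] at this
    simp [cross_apply]
    linarith
  · have := p1 s t
    simp [hξ] at this
    simp [cross_apply]
    linarith
  · have := q2 s t
    simp [hξ] at this
    simp [cross_apply]
    linarith

/-- The parameter in the structure equations. -/
def param (ξ σ : E3 → E3 →L[ℝ] V3) (e : E3) (y : E3) : ℝ := ξ y e 0 / σ y e 0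

theorem differentiableAt_comp (h : IsCoframe u P Q ξ σ x) (v : E3) (k : Fin 3) :
    DifferentiableAt ℝ (fun y => ξ y v k) x ∧ DifferentiableAt ℝ (fun y => σ y v k) x :=
  ⟨differentiableAt_pi.1 ((h.log.contDiffAt_apply v).differentiableAt (by simp)) k,
    differentiableAt_pi.1 (h.differentiableAt_apply v) k⟩

theorem differentiableAt_param (h : IsCoframe u P Q ξ σ x) {e : E3} (he : σ x e 0 ≠ 0) :
    DifferentiableAt ℝ (param ξ σ e) x := by
  have h1 : param ξ σ e = fun y => ξ y e 0 * (σ y e 0)⁻¹ := funext fun y => div_eq_mul_inv _ _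
  rw [h1]
  exact (h.differentiableAt_comp e 0).1.mul ((h.differentiableAt_comp e 0).2.inv he)

theorem eq_param (h : IsCoframe u P Q ξ σ x) {e : E3} (he : σ x e 0 ≠ 0) :
    (∀ v, ξ x v = ![param ξ σ e x * σ x v 0, -(1 + param ξ σ e x) * σ x v 1,
      param ξ σ e x * σ x v 2]) ∧
    ∀ s t, extD σ x s t = (-2 * param ξ σ e x) • crossProduct (σ x s) (σ x t) := by
  obtain ⟨r, hr, hr'⟩ := h.structure_eq
  have : param ξ σ e x = r := by
    rw [param, hr]
    simp [he]
  rw [this]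
  exact ⟨hr, hr'⟩

theorem extD_apply {α : E3 → E3 →L[ℝ] V3} (h : ∀ v, DifferentiableAt ℝ (fun y => α y v) x)
    (s t : E3) (k : Fin 3) : extD α x s t k =
      fderiv ℝ (fun y => α y t k) x s - fderiv ℝ (fun y => α y s k) x t := by
  have h1 : ∀ v w, fderiv ℝ (fun y => α y v k) x w = fderiv ℝ (fun y => α y v) x w k :=
    fun v w => by
      rw [((ContinuousLinearMap.proj (R := ℝ) (φ := fun _ : Fin 3 => ℝ) k).hasFDerivAt.comp x
        (h v).hasFDerivAt).fderiv (f := fun y => α y v k)]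
      rfl
  rw [h1, h1]
  rfl

/-- Differentiate `ξ₀ = r σ₀` and evaluate on the vectors dual to `σ₁`, `σ₂`, where the `dr` term
drops out. The Maurer-Cartan equation gives `2 r (1 + r)` and the structure equation `-2 r ^ 2`,
hence `r (2 r + 1) = 0`. -/
theorem param_eq (h : IsCoframe u P Q ξ σ x) {e : E3} (he : σ x e 0 ≠ 0) :
    param ξ σ e x = 0 ∨ param ξ σ e x = -1 / 2 := by
  choose b hb using fun k : Fin 3 => surjective_of_injective h.inj.self_of_nhds (Pi.single k 1)
  have he' : ∀ᶠ y in 𝓝 x, σ y e 0 ≠ 0 := (h.differentiableAt_comp e 0).2.continuousAt.eventually_ne he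
  have hd := h.differentiableAt_param he
  have hξ : ∀ v w, fderiv ℝ (fun y => ξ y v 0) x w =
      param ξ σ e x * fderiv ℝ (fun y => σ y v 0) x w + fderiv ℝ (param ξ σ e) x w * σ x v 0 := by
    intro v w
    have e1 : (fun y => ξ y v 0) =ᶠ[𝓝 x] fun y => param ξ σ e y * σ y v 0 := by
      filter_upwards [h.eventually_self, he'] with y hy h1
      rw [(hy.eq_param h1).1]
      rfl
    rw [e1.fderiv_eq, fderiv_fun_mul hd (h.differentiableAt_comp v 0).2]
    simp [mul_comm]
  have h1 := congrFun (h.log.maurerCartan (b 1) (b 2)) 0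
  have h2 := congrFun ((h.eq_param he).2 (b 1) (b 2)) 0
  have h3 : extD ξ x (b 1) (b 2) 0 = param ξ σ e x * extD σ x (b 1) (b 2) 0 := by
    rw [extD_apply fun v => (h.log.contDiffAt_apply v).differentiableAt (by simp),
      extD_apply h.differentiableAt_apply, hξ, hξ, hb, hb]
    simp
    ring
  rw [h2] at h3
  have h4 : extD ξ x (b 1) (b 2) 0 = _ := h1
  rw [h4] at h3
  simp [(h.eq_param he).1, hb, cross_apply] at h3
  have h5 : param ξ σ e x * (2 * param ξ σ e x + 1) = 0 := by linarith
  rcases mul_eq_zero.1 h5 with h6 | h6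
  · exact Or.inl h6
  · right; linarith

/-- The parameter is continuous with two possible values, hence locally constant. -/
theorem structure_cases (h : IsCoframe u P Q ξ σ x) :
    (∀ᶠ y in 𝓝 x, (∀ v, ξ y v = ![0, -σ y v 1, 0]) ∧ ∀ s t, extD σ y s t = 0) ∨
      ∀ᶠ y in 𝓝 x, ∀ v, ξ y v = (-1 / 2 : ℝ) • σ y v := by
  obtain ⟨e, he⟩ := surjective_of_injective h.inj.self_of_nhds (Pi.single 0 1)
  have he0 : σ x e 0 ≠ 0 := by simp [he]
  have he' : ∀ᶠ y in 𝓝 x, σ y e 0 ≠ 0 := (h.differentiableAt_comp e 0).2.continuousAt.eventually_ne he0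
  have hc := (h.differentiableAt_param he0).continuousAt
  rcases h.param_eq he0 with h0 | h0
  · left
    have h1 : ∀ᶠ y in 𝓝 x, param ξ σ e y ≠ -1 / 2 := hc.eventually_ne (by rw [h0]; norm_num)
    filter_upwards [h.eventually_self, he', h1] with y hy h2 h3
    have h4 := hy.eq_param h2
    rw [(hy.param_eq h2).resolve_right h3] at h4
    simpa using h4
  · right
    have h1 : ∀ᶠ y in 𝓝 x, param ξ σ e y ≠ 0 := hc.eventually_ne (by rw [h0]; norm_num)
    filter_upwards [h.eventually_self, he', h1] with y hy h2 h3 v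
    rw [(hy.eq_param h2).1 v, (hy.param_eq h2).resolve_left h3]
    ext k
    fin_cases k
    · rfl
    · change -(1 + -1 / 2) * σ y v 1 = -1 / 2 * σ y v 1
      ring
    · rfl

end IsCoframe

end NearlyKahler

end

noncomputable section

namespace NearlyKahler

open Filter Topology

/-! ### The seventh normal form -/

section Exp

variable {x : E3}

/-- The Poincaré lemma on a ball; the primitive is smooth because its derivative is. -/
theorem exists_primitive {σ : E3 → E3 →L[ℝ] V3} (hs : ∀ᶠ y in 𝓝 x, ContDiffAt ℝ ∞ σ y)
    (hd : ∀ᶠ y in 𝓝 x, ∀ s t, IsCoframe.extD σ y s t = 0) :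
    ∃ h : E3 → V3, ∀ᶠ y in 𝓝 x, ContDiffAt ℝ ∞ h y ∧ HasFDerivAt h (σ y) y := by
  obtain ⟨r, hr, hB⟩ := Metric.eventually_nhds_iff_ball.1 (hs.and hd)
  have hdiff : ∀ y ∈ Metric.ball x r, DifferentiableAt ℝ σ y := fun y hy =>
    (hB y hy).1.differentiableAt (by simp)
  obtain ⟨h, hh⟩ := (convex_ball x r).exists_forall_hasFDerivAt_of_fderiv_symmetric
    Metric.isOpen_ball (fun y hy => (hdiff y hy).differentiableWithinAt) (fun y hy s t => by
      have h1 : ∀ v w, fderiv ℝ (fun y => σ y v) y w = fderiv ℝ σ y w v := fun v w => by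
        rw [fderiv_clm_apply (hdiff y hy) (differentiableAt_const v)]; simp
      have h2 := (hB y hy).2 s t
      rw [IsCoframe.extD, h1, h1] at h2
      exact sub_eq_zero.1 h2)
  have hsm : ContDiffOn ℝ ∞ h (Metric.ball x r) := by
    rw [contDiffOn_infty_iff_fderiv_of_isOpen Metric.isOpen_ball]
    refine ⟨fun y hy => (hh y hy).differentiableAt.differentiableWithinAt, fun y hy => ?_⟩
    refine ContDiffWithinAt.congr (hB y hy).1.contDiffWithinAt (fun z hz => (hh z hz).fderiv)
      (hh y hy).fderiv
  refine ⟨h, ?_⟩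
  filter_upwards [Metric.ball_mem_nhds x hr] with y hy
  exact ⟨hsm.contDiffAt (Metric.isOpen_ball.mem_nhds hy), hh y hy⟩

/-- The exponential of the imaginary quaternion `θ n` for a unit vector `n`. -/
def expQ (n : V3) (θ : ℝ) : ℍ[ℝ] := Real.cos θ • (1 : ℍ[ℝ]) + Real.sin θ • quat n

theorem norm_expQ {n : V3} (hn : n ⬝ᵥ n = 1) (θ : ℝ) : ‖expQ n θ‖ = 1 := by
  rw [← sq_eq_sq₀ (norm_nonneg _) zero_le_one, ← real_inner_self_eq_norm_sq, Quaternion.inner_def]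
  rw [Matrix.vec3_dotProduct] at hn
  simp [expQ]
  linear_combination Real.cos_sq_add_sin_sq θ + Real.sin θ ^ 2 * hn

theorem star_expQ (n : V3) (θ : ℝ) : star (expQ n (-θ)) = expQ n θ := by
  ext <;> simp [expQ]

theorem hasLog_expQ {n : V3} (hn : n ⬝ᵥ n = 1) {φ : E3 → ℝ}
    (hφ : ∀ᶠ y in 𝓝 x, ContDiffAt ℝ ∞ φ y) :
    HasLog (fun y => expQ n (φ y)) (fun y => (fderiv ℝ φ y).smulRight n) x where
  norm_eq := Eventually.of_forall fun y => norm_expQ hn _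
  smooth := hφ.mono fun y hy => (hy.cos.smul contDiffAt_const).add (hy.sin.smul contDiffAt_const)
  fderiv_eq := by
    filter_upwards [hφ] with y hy v
    have h1 := (hy.differentiableAt (by simp)).hasFDerivAt
    have h2 : HasFDerivAt (fun y => expQ n (φ y)) _ y :=
      (h1.cos.smul_const (1 : ℍ[ℝ])).add (h1.sin.smul_const (quat n))
    rw [h2.fderiv]
    rw [Matrix.vec3_dotProduct] at hn
    ext <;> simp [expQ]
    · linear_combination (Real.sin (φ y) * fderiv ℝ φ y v) * hn
    all_goals ring

end Exp

section

variable {M : Type*} [TopologicalSpace M] [ChartedSpace E3 M] [IsManifold (𝓡 3) ∞ M]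
  {f : M → ℍ[ℝ] × ℍ[ℝ]} {p : M}

theorem torusP_eq (s t : ℝ) : torusP (2 / √3 * s) (2 / √3 * t) =
    expQ (Pi.single 0 1) t * expQ (Pi.single 1 1) s := by
  have h : ∀ r : ℝ, √3 * (2 / √3 * r) / 2 = r := fun r => by field_simp
  simp only [torusP, h]
  ext <;> simp [expQ] <;> ring

/-- The factor `(1 + j) / √2 = exp (jπ/4)` undoes the shift of the angle by π/4 in `torusQ` and
conjugates rotations generated by `i` into ones generated by `k`, with a change of sign that
explains `-t`. -/
theorem torusQ_eq (s t : ℝ) : ((1 / √2 : ℝ) • (1 + qj)) * torusQ (2 / √3 * s) (2 / √3 * -t) =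
    expQ (Pi.single 2 1) t * expQ (Pi.single 1 1) s := by
  have h : ∀ r : ℝ, √3 * (2 / √3 * r) / 2 = r := fun r => by field_simp
  have h2 : (√2)⁻¹ * (√2)⁻¹ = (1 / 2 : ℝ) := by
    rw [← mul_inv, Real.mul_self_sqrt (by norm_num), one_div]
  have h0 : (torusQ (2 / √3 * s) (2 / √3 * -t)).re =
      (√2)⁻¹ * (Real.cos t * (Real.sin s + Real.cos s)) := by
    simp only [torusQ, h]; simp
  have h1 : (torusQ (2 / √3 * s) (2 / √3 * -t)).imI =
      (√2)⁻¹ * (-Real.sin t * (Real.sin s + Real.cos s)) := by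
    simp only [torusQ, h]; simp
  have h3 : (torusQ (2 / √3 * s) (2 / √3 * -t)).imJ =
      (√2)⁻¹ * (Real.cos t * (Real.sin s - Real.cos s)) := by
    simp only [torusQ, h]; simp
  have h4 : (torusQ (2 / √3 * s) (2 / √3 * -t)).imK =
      (√2)⁻¹ * (-Real.sin t * (Real.sin s - Real.cos s)) := by
    simp only [torusQ, h]; simp
  generalize torusQ (2 / √3 * s) (2 / √3 * -t) = w at *
  ext <;> simp [expQ, qj_eq_quat, h0, h1, h3, h4]
  · linear_combination (2 * Real.cos t * Real.cos s) * h2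
  · linear_combination (-2 * Real.sin t * Real.sin s) * h2
  · linear_combination (2 * Real.cos t * Real.sin s) * h2
  · linear_combination (2 * Real.sin t * Real.cos s) * h2

/-- A linear change of coordinates. -/
def torusCoord : V3 →L[ℝ] E3 :=
  LinearMap.toContinuousLinearMap
    { toFun := fun v => WithLp.toLp 2 ![2 / √3 * v 1, 2 / √3 * -v 2, 2 / √3 * v 0]
      map_add' := fun v w => by ext k; fin_cases k <;> simp <;> ring
      map_smul' := fun c v => by ext k; fin_cases k <;> simp <;> ring }

theorem torusCoord_apply (v : V3) :
    torusCoord v = WithLp.toLp 2 ![2 / √3 * v 1, 2 / √3 * -v 2, 2 / √3 * v 0] := rfl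

theorem injective_torusCoord : Function.Injective torusCoord := by
  rw [injective_iff_map_eq_zero]
  intro v hv
  have h : ∀ k, torusCoord v k = 0 := fun k => by rw [hv]; rfl
  have h0 := h 0
  have h1 := h 1
  have h2 := h 2
  simp [torusCoord_apply] at h0 h1 h2
  ext k
  fin_cases k <;> simp [*]

theorem IsCoframe.locallyGivenBy {u : E3 → ℍ[ℝ]} {ξ σ : E3 → E3 →L[ℝ] V3}
    (h : IsCoframe u (fun y => (localExpr f p y).1 * u y) (fun y => (localExpr f p y).2 * u y) ξ σ
      (extChartAt (𝓡 3) p p)) : LocallyGivenBy f p 6 ∨ LocallyGivenBy f p 7 := by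
  have hback : ∀ y, ‖u y‖ = 1 → ∀ {z w : ℍ[ℝ]}, z * u y = w → z = w * star (u y) :=
    fun y hy z w hz => by rw [← hz, mul_assoc, mul_star_self_of_norm hy, mul_one]
  have h1 : ∀ k : Fin 3, (Pi.single k 1 : V3) ⬝ᵥ Pi.single k 1 = 1 := fun k => by simp
  rcases h.structure_cases with hc | hc
  · right
    obtain ⟨φ, hφ⟩ := exists_primitive h.smooth (hc.mono fun y hy => hy.2)
    have hφk : ∀ k, ∀ᶠ y in 𝓝 (extChartAt (𝓡 3) p p), ContDiffAt ℝ ∞ (fun y => φ y k) y :=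
      fun k => hφ.mono fun y hy => contDiffAt_pi.1 hy.1 k
    have hdφ : ∀ᶠ y in 𝓝 (extChartAt (𝓡 3) p p), ∀ k v, fderiv ℝ (fun y => φ y k) y v = σ y v k := by
      filter_upwards [hφ] with y hy k v
      rw [((ContinuousLinearMap.proj (R := ℝ) (φ := fun _ : Fin 3 => ℝ) k).hasFDerivAt.comp y
        hy.2).fderiv (f := fun y => φ y k)]
      rfl
    -- The three logarithmic derivatives are `-dφ₁ j`, `dφ₀ i` and `dφ₂ k`, so up to left constants
    -- `u`, `P` and `Q` are one-parameter exponentials.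
    obtain ⟨c, hcn, hu⟩ := h.log.exists_eq_mul ((hasLog_expQ (h1 1) ((hφk 1).mono fun y hy =>
      hy.neg)).congr (by
        filter_upwards [hc, hdφ] with y h2 h3 v
        rw [h2.1]
        ext k
        fin_cases k <;> simp [fderiv_fun_neg, h3]))
    obtain ⟨a, han, hP⟩ := h.log_fst.exists_eq_mul ((hasLog_expQ (h1 0) (hφk 0)).congr (by
        filter_upwards [hc, hdφ] with y h2 h3 v
        simp only [add_apply, ContinuousLinearMap.comp_apply, h2.1]
        ext k
        fin_cases k <;> simp [h3, diagL_apply]))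
    obtain ⟨b, hbn, hQ⟩ := h.log_snd.exists_eq_mul ((hasLog_expQ (h1 2) (hφk 2)).congr (by
        filter_upwards [hc, hdφ] with y h2 h3 v
        simp only [add_apply, ContinuousLinearMap.comp_apply, h2.1]
        ext k
        fin_cases k <;> simp [h3, diagL_apply]))
    have hm : ‖(1 / √2 : ℝ) • (1 + qj)‖ = 1 := by
      rw [← sq_eq_sq₀ (norm_nonneg _) zero_le_one, ← real_inner_self_eq_norm_sq,
        Quaternion.inner_def]
      simp [qj_eq_quat]
      field_simp
      norm_num
    have hφx := hφ.self_of_nhds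
    refine locallyCongruentAt_euclidean (ψ := f8) (u := fun y => torusCoord (φ y))
      (hφ.mono fun y hy => torusCoord.contDiff.contDiffAt.comp y hy.1) ?_
      (a := a) (b := b * ((1 / √2 : ℝ) • (1 + qj))) (c := c) han (by rw [norm_mul, hbn, hm, one_mul])
      hcn ?_
    · rw [(torusCoord.hasFDerivAt.comp _ hφx.2).fderiv (f := fun y => torusCoord (φ y))]
      exact injective_torusCoord.comp h.inj.self_of_nhds
    · filter_upwards [hu, hP, hQ, h.log.norm_eq] with y h2 h3 h4 h5
      have h6 := hback y h5 h3
      have h7 := hback y h5 h4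
      rw [h2, star_mul, star_expQ] at h6 h7
      simp only [nkIsometry, f8, torusCoord_apply, inv_eq_star_of_norm hcn, Prod.ext_iff, h6, h7]
      constructor
      · simp only [Matrix.cons_val, torusP_eq, mul_assoc]
      · simp only [Matrix.cons_val, torusQ_eq, mul_assoc]
  · left
    -- Conjugation by `(1 - i - j - k) / 2` permutes the units cyclically, taking `i` to `k` and `j`
    -- to `i`.
    obtain ⟨m, hm⟩ : ∃ m : ℍ[ℝ], m = (1 / 2 : ℝ) • (1 - quat fun _ => 1) := ⟨_, rfl⟩
    have hmn : ‖m‖ = 1 := by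
      rw [← sq_eq_sq₀ (norm_nonneg _) zero_le_one, ← real_inner_self_eq_norm_sq,
        Quaternion.inner_def]
      simp [hm]
      norm_num
    have hrot : ∀ k : Fin 3, ‖quat (Pi.single k 1)‖ = 1 := fun k => by
      rw [← sq_eq_sq₀ (norm_nonneg _) zero_le_one, ← real_inner_self_eq_norm_sq, inner_quat, h1,
        one_pow]
    -- With `ξ = -σ / 2` the logarithmic derivatives of `P` and `Q` are the rotations of `ξ` by π
    -- about the third and the first axis, so `P` and `Q` are constant left multiples of `u k` and
    -- `u i`.
    obtain ⟨a, han, hP⟩ := h.log_fst.exists_eq_mul ((h.log.mul_const (hrot 2)).congr (by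
        filter_upwards [hc] with y h2 v
        simp only [add_apply, ContinuousLinearMap.comp_apply, h2, rotL_quat (h1 2)]
        ext k
        fin_cases k <;> simp [diagL_apply] <;> ring))
    obtain ⟨b, hbn, hQ⟩ := h.log_snd.exists_eq_mul ((h.log.mul_const (hrot 0)).congr (by
        filter_upwards [hc] with y h2 v
        simp only [add_apply, ContinuousLinearMap.comp_apply, h2, rotL_quat (h1 0)]
        ext k
        fin_cases k <;> simp [diagL_apply] <;> ring))
    have hU := h.log.mul_const hmn
    have hinj : Function.Injective (ξ (extChartAt (𝓡 3) p p)) := fun v w hvw => by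
      rw [hc.self_of_nhds, hc.self_of_nhds] at hvw
      exact h.inj.self_of_nhds (smul_right_injective _ (by norm_num) hvw)
    refine locallyCongruentAt_sphere (ψ := f7) hU.smooth hU.norm_eq
      (hU.injective_fderiv ((rotL_injective hmn).comp hinj)) (a := a) (b := b) (c := 1) han hbn
      (by simp) ?_
    have hi : m * qi * star m = quat (Pi.single 2 1) := by
      ext <;> simp [hm, qi_eq_quat]; norm_num
    have hj : m * qj * star m = quat (Pi.single 0 1) := by
      ext <;> simp [hm, qj_eq_quat]; norm_num
    filter_upwards [hP, hQ, h.log.norm_eq, hU.norm_eq] with y h3 h4 h5 h6 U hUy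
    have h7 := hback y h5 h3
    have h8 := hback y h5 h4
    rw [← hi] at h7
    rw [← hj] at h8
    simp only [nkIsometry, f7, hUy, Prod.ext_iff, h7, h8, inv_eq_star_of_norm h6, inv_one, mul_one,
      star_mul, mul_assoc, and_self]

theorem IsLagrangianGerm.locallyGivenBy_of_six
    (h : IsLagrangianGerm (localExpr f p) (extChartAt (𝓡 3) p p))
    (hc : ∀ᶠ y in 𝓝 (extChartAt (𝓡 3) p p), HasNormalForm (mcForm (localExpr f p)) y 6) :
    LocallyGivenBy f p 6 ∨ LocallyGivenBy f p 7 := by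
  obtain ⟨u, ξ, σ, h⟩ := h.exists_isCoframe hc
  exact h.locallyGivenBy

end

end NearlyKahler

end

noncomputable section

namespace NearlyKahler

open Filter Topology

/-! ### The index of the immersion -/

section

variable {M : Type*} [TopologicalSpace M] [ChartedSpace E3 M] {f : M → ℍ[ℝ] × ℍ[ℝ]} {p : M}

theorem LocallyCongruentAt.eventually {D : Type*} [TopologicalSpace D] [ChartedSpace E3 D]
    {ψ : D → ℍ[ℝ] × ℍ[ℝ]} (h : LocallyCongruentAt f p ψ) :
    ∀ᶠ p' in 𝓝 p, LocallyCongruentAt f p' ψ := by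
  obtain ⟨a, b, c, ha, hb, hc, Θ, hp, hΘ⟩ := h
  filter_upwards [Θ.open_source.mem_nhds hp] with p' hp'
  exact ⟨a, b, c, ha, hb, hc, Θ, hp', hΘ⟩

theorem eq_zero_of_cos_sin {a b s t : ℝ} (h : Real.sin (t - s) ≠ 0)
    (h1 : Real.cos s * a + Real.sin s * b = 0) (h2 : Real.cos t * a + Real.sin t * b = 0) :
    a = 0 ∧ b = 0 := by
  rw [Real.sin_sub] at h
  constructor
  · refine (mul_eq_zero.1 (?_ : _ * a = 0)).resolve_left h
    linear_combination Real.sin t * h1 - Real.sin s * h2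
  · refine (mul_eq_zero.1 (?_ : _ * b = 0)).resolve_left h
    linear_combination Real.cos s * h2 - Real.cos t * h1

/-- The torus `p(u, w)` is locally not contained in a hyperplane. -/
theorem exists_inner_torusP_ne_zero {D : ℍ[ℝ]} (hD : D ≠ 0) {V : Set E3} (hV : IsOpen V) {t : E3}
    (ht : t ∈ V) : ∃ s ∈ V, inner ℝ D (torusP (s 0) (s 2)) ≠ 0 := by
  by_contra! h
  have hc : Continuous fun r : ℝ × ℝ =>
      (WithLp.toLp 2 ![t 0 + 2 / √3 * r.1, t 1, t 2 + 2 / √3 * r.2] : E3) := by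
    refine (PiLp.continuous_toLp 2 _).comp (continuous_pi fun k => ?_)
    fin_cases k <;> simp <;> fun_prop
  have h0 : ∀ᶠ r : ℝ × ℝ in 𝓝 (0 : ℝ × ℝ),
      (WithLp.toLp 2 ![t 0 + 2 / √3 * r.1, t 1, t 2 + 2 / √3 * r.2] : E3) ∈ V := by
    refine hc.continuousAt.eventually_mem (hV.mem_nhds ?_)
    convert ht using 1
    ext k
    fin_cases k <;> simp
  obtain ⟨ε, hε, hB⟩ := Metric.eventually_nhds_iff_ball.1 h0
  set δ : ℝ := min (ε / 2) 1 with hδ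
  have hδ0 : 0 < δ := by positivity
  have hδε : δ < ε := (min_le_left _ _).trans_lt (half_lt_self hε)
  have hsin : Real.sin δ ≠ 0 :=
    (Real.sin_pos_of_pos_of_lt_pi hδ0 ((min_le_right _ _).trans_lt (by linarith [Real.pi_gt_three]))).ne'
  set S := √3 * t 0 / 2 with hS
  set T := √3 * t 2 / 2 with hT
  -- If the torus lay locally in the hyperplane orthogonal to `D`, this trigonometric equation would
  -- hold for all small shifts. Shifts by 0 and `δ` in each angle, where `sin δ ≠ 0`, already force
  -- the four components of `D` to vanish.
  have key : ∀ r s : ℝ, |r| < ε → |s| < ε →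
      Real.cos (S + r) * (Real.cos (T + s) * D.re + Real.sin (T + s) * D.imI) +
      Real.sin (S + r) * (Real.cos (T + s) * D.imJ + Real.sin (T + s) * D.imK) = 0 := by
    intro r s hr hs
    have h1 := h _ (hB (r, s) (by simpa [Prod.norm_def] using ⟨hr, hs⟩))
    have h2 : ∀ a r : ℝ, √3 * (a + 2 / √3 * r) / 2 = √3 * a / 2 + r := fun a r => by field_simp
    rw [Quaternion.inner_def] at h1
    simp only [Quaternion.re_mul, Quaternion.re_star, Quaternion.imI_star, Quaternion.imJ_star,
      Quaternion.imK_star] at h1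
    simp only [torusP, Matrix.cons_val, h2] at h1
    linarith
  have e0 : |(0 : ℝ)| < ε := by simpa using hε
  have e1 : |δ| < ε := by rwa [abs_of_pos hδ0]
  have hs : ∀ a : ℝ, Real.sin (a + δ - (a + 0)) ≠ 0 := fun a => by simpa using hsin
  have k0 := eq_zero_of_cos_sin (hs S) (key 0 0 e0 e0) (key δ 0 e1 e0)
  have k1 := eq_zero_of_cos_sin (hs S) (key 0 δ e0 e1) (key δ δ e1 e1)
  have l0 := eq_zero_of_cos_sin (hs T) k0.1 k1.1
  have l1 := eq_zero_of_cos_sin (hs T) k0.2 k1.2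
  exact hD (by ext <;> simp [l0, l1])

/-- The immersions `f7` and `f8` are nowhere locally congruent. -/
theorem LocallyCongruentAt.not_f8_of_f7 (h7 : LocallyCongruentAt f p f7) :
    ¬ LocallyCongruentAt f p f8 := by
  rintro ⟨a, b, c, ha, -, hc, Θ, hp, -, -, hΘ⟩
  obtain ⟨a', b', c', ha', -, hc', Ψ, hp', -, -, hΨ⟩ := h7
  set V := Θ.target ∩ Θ.symm ⁻¹' Ψ.source with hV
  have hVo : IsOpen V := Θ.isOpen_inter_preimage_symm Ψ.open_source
  -- The first component of `f7` is orthogonal to 1; the isometries carry this hyperplane to the one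
  -- orthogonal to `D` for `torusP`.
  set D : ℍ[ℝ] := star a * a' * star c' * c with hD
  have hDn : ‖D‖ = 1 := by simp [hD, ha, ha', hc, hc']
  obtain ⟨s, hs, hne⟩ := exists_inner_torusP_ne_zero (D := D)
    (by intro h0; simp [h0] at hDn) hVo (t := Θ p) ⟨Θ.map_source hp, by simpa [hp] using hp'⟩
  refine hne ?_
  have h1 := hΘ _ (Θ.map_target hs.1)
  rw [hΨ _ hs.2, Θ.right_inv hs.1] at h1
  have h2 := congrArg Prod.fst h1
  set U := Ψ (Θ.symm s)
  have hU : ‖(U : ℍ[ℝ])‖ = 1 := by simp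
  simp only [nkIsometry, f7, f8, inv_eq_star_of_norm hc, inv_eq_star_of_norm hc',
    inv_eq_star_of_norm hU] at h2
  have h3 : torusP (s 0) (s 2) = star a * a' * (U * qi * star (U : ℍ[ℝ])) * star c' * c := by
    calc torusP (s 0) (s 2) = (star a * a) * torusP (s 0) (s 2) * (star c * c) := by
          rw [star_mul_self_of_norm ha, star_mul_self_of_norm hc, one_mul, mul_one]
      _ = star a * (a * torusP (s 0) (s 2) * star c) * c := by simp only [mul_assoc]
      _ = _ := by rw [← h2]; simp only [mul_assoc]
  have h4 : D = star a * (a' * (U * 1 * star (U : ℍ[ℝ]))) * star c' * c := by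
    rw [mul_one, mul_star_self_of_norm hU, mul_one]
  have hst : ∀ {z : ℍ[ℝ]}, ‖z‖ = 1 → ‖star z‖ = 1 := fun h => by simpa using h
  rw [h3, h4, mul_assoc (star a) a', inner_mul_unit hc, inner_mul_unit (hst hc'),
    inner_unit_mul (hst ha), inner_unit_mul ha', inner_mul_unit (hst hU), inner_unit_mul hU,
    Quaternion.inner_def]
  simp [qi_eq_quat]

end

section

variable {M : Type*} [TopologicalSpace M] [ChartedSpace E3 M] [IsManifold (𝓡 3) ∞ M]
  {f : M → ℍ[ℝ] × ℍ[ℝ]}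

theorem HasNormalForm.unique {ζ : E3 → E3 →L[ℝ] V3 × V3} {x : E3} {c d : Fin 7}
    (hc : HasNormalForm ζ x c) (hd : HasNormalForm ζ x d) : c = d :=
  nfVal_injective ((invariant_eq hc).2.symm.trans (invariant_eq hd).2)

theorem IsLagrangianImmersion.exists_index (hf : IsLagrangianImmersion f) {lam : M → ℝ}
    (hlam : IsJIsotropic f lam) :
    ∃ ι : M → Fin 8, IsLocallyConstant ι ∧ ∀ p : M, LocallyGivenBy f p (ι p) := by
  classical
  choose cl hcl using fun p => (hf.exists_normalForm_self hlam p).2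
  have hcl' : ∀ p, ∀ᶠ y in 𝓝 (extChartAt (𝓡 3) p p), HasNormalForm (mcForm (localExpr f p)) y (cl p) :=
    fun p => by
      obtain ⟨c, hc⟩ := hf.eventually_normalForm hlam p
      rwa [(hcl p).unique hc.self_of_nhds]
  have hconst : ∀ p, ∀ᶠ p' in 𝓝 p, cl p' = cl p := fun p => by
    filter_upwards [(continuousAt_extChartAt (I := 𝓡 3) p).eventually (hcl' p),
      extChartAt_source_mem_nhds (I := 𝓡 3) p] with p' h1 h2
    exact (hf.hasNormalForm_localExpr p ((extChartAt (𝓡 3) p).map_source h2)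
      ((extChartAt (𝓡 3) p).left_inv h2) (hcl p')).unique h1
  have hgerm : ∀ p, IsLagrangianGerm (localExpr f p) (extChartAt (𝓡 3) p p) := fun p =>
    hf.isLagrangianGerm p (mem_extChartAt_target p)
  -- The normal form determines the index except for form 6. There congruence with `f7` and
  -- congruence with `f8` are both open conditions, they exclude each other and one of them holds,
  -- so the choice is locally constant.
  refine ⟨fun p => if cl p = 6 then if LocallyGivenBy f p 6 then 6 else 7
    else Fin.castSucc (cl p), ?_, fun p => ?_⟩
  · rw [IsLocallyConstant.iff_eventually_eq]
    intro p
    by_cases h6 : cl p = 6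
    · by_cases h : LocallyGivenBy f p 6
      · filter_upwards [hconst p, LocallyCongruentAt.eventually (ψ := f7) h] with p' h1 h2
        have h2' : LocallyGivenBy f p' 6 := h2
        simp [h1, h6, h, h2']
      · have h7 : LocallyCongruentAt f p f8 :=
          ((hgerm p).locallyGivenBy_of_six (h6 ▸ hcl' p)).resolve_left h
        filter_upwards [hconst p, h7.eventually] with p' h1 h2
        have h2' : ¬ LocallyGivenBy f p' 6 := fun h3 => LocallyCongruentAt.not_f8_of_f7 h3 h2
        simp [h1, h6, h, h2']
    · filter_upwards [hconst p] with p' h1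
      simp [h1, h6]
  · beta_reduce
    split_ifs with h6 h
    · exact h
    · exact ((hgerm p).locallyGivenBy_of_six (h6 ▸ hcl' p)).resolve_left h
    · exact (hgerm p).locallyGivenBy h6 (hcl' p)

end

end NearlyKahler

end

theorem mainTheorem1 {M : Type*} [TopologicalSpace M]
    [ChartedSpace (EuclideanSpace ℝ (Fin 3)) M] [IsManifold (𝓡 3) ∞ M]
    (f : M → ℍ[ℝ] × ℍ[ℝ]) (hf : NearlyKahler.IsLagrangianImmersion f)
    (lam : M → ℝ) (hlam : NearlyKahler.IsJIsotropic f lam) :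
    (∀ p : M, lam p = 0) ∧ NearlyKahler.IsJParallel f ∧
      ∃ ι : M → Fin 8, IsLocallyConstant ι ∧
        ∀ p : M, NearlyKahler.LocallyGivenBy f p (ι p) := by
  have h0 : ∀ p, lam p = 0 := fun p => (hf.exists_normalForm_self hlam p).1
  refine ⟨h0, fun p v => ?_, hf.exists_index hlam⟩
  rw [hlam p v, h0]
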